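/- Let $f$ be a probability density on $\mathbb{R}$, let $(X_j)_{j\ge1}$ be i.i.d. random variables with density $f$ and $E X_1^4<\infty$, and let $N$ be a Poisson process of intensity $1$ independent of $(X_j)$. Put $Z_t=\sum_{j=1}^{N_t}X_j$, and for $n\in\mathbb{N}$ and $\Delta>0$ let $Y_j=Z_{j\Delta}-Z_{(j-1)\Delta}$, $j=1,\dots,n$. Let $\phi$ and $\phi_\Delta$ be the characteristic functions of $X_1$ and $Z_\Delta$, let $\|\cdot\|$ be the $L^2(\mathbb{R})$-norm, and let $f_m(x)=\frac1{2\pi}\int_{-m}^m e^{-iux}\phi(u)\,du$. Let $\hat\phi_{\Delta,n}(u)=\frac1n\sum_{j=1}^n e^{iuY_j}$ and $$\hat\phi_n(u)=1+\frac1\Delta\int_0^u\frac{\hat\phi_{\Delta,n}'(z)}{\hat\phi_{\Delta,n}(z)}\,dz,\qquad \tilde\phi_n(u)=\hat\phi_n(u)\mathbf 1_{|\hat\phi_n(u)|\le4},$$ where $\tilde\phi_n(u)=0$ if $\hat\phi_{\Delta,n}$ has a zero between $0$ and $u$. For $\kappa>0$ and $\alpha\in(0,1]$ let $\kappa_{n,\Delta}=e^{2\Delta}+\kappa\sqrt{\log(n\Delta)}$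 and $$\bar\phi_n(u)=\tilde\phi_n(u)\mathbf 1_{|\tilde\phi_n(u)|\ge\kappa_{n,\Delta}/\sqrt{n\Delta}},\qquad \bar f_{m,\Delta}(x)=\frac1{2\pi}\int_{-m}^m e^{-iux}\bar\phi_n(u)\,du,$$ $$\hat m_n=\max\Big\{m\ge0:\ |\bar\phi_n(m)|=\frac{\kappa_{n,\Delta}}{\sqrt{n\Delta}}\Big\}\wedge(n\Delta)^\alpha,$$ where $\hat m_n=(n\Delta)^\alpha$ if the set is empty or unbounded. Then there are a constant $C_2>0$ depending only on $E X_1^2$ and $E X_1^4$, and a constant $C_1>0$ depending only on $\kappa$, $E X_1^2$ and $E X_1^4$, such that for all $\alpha\in(0,1]$, all $n$ and all $\Delta>0$ with $\Delta\le\frac14\log(n\Delta)$ (in particular along every sequence $\Delta=\Delta_n$ that satisfies this with $n\Delta_n\to\infty$), $$E\|\bar f_{\hat m_n,\Delta}-f\|^2\le C_1\inf_{m\in[0,(n\Delta)^\alpha]}\Big\{\|f_m-f\|^2+\frac{\log(n\Delta)\,m}{n\Delta}+\frac1{n\Delta}\int_{-m}^m\frac{du}{|\phi_\Delta(u)|^2}+\frac{m^2}{(n\Delta)^2}\Big\}+C_2\Big(\frac1{n\Delta}+(n\Delta)^{\alpha-\kappa^2\Delta^2e^{-4\Delta}}\Big).$$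 -/

import Mathlib

open MeasureTheory ProbabilityTheory Set
open scoped NNReal ENNReal

noncomputable section

namespace Decompounding

/-! ### The compound Poisson process -/

/-- `N` is a homogeneous Poisson process with intensity `r` under `P`: a counting process with
right-continuous nondecreasing paths started at `0`, with independent increments, such that
`N t - N s` is Poisson distributed with parameter `r * (t - s)` for `s ≤ t`.
(The subtraction of natural numbers is not truncated, because the paths are nondecreasing.) -/
structure IsPoissonProcess {Ω : Type*} [MeasurableSpace Ω]
    (N : ℝ≥0 → Ω → ℕ) (r : ℝ≥0) (P : Measure Ω) : Prop where
  measurable : ∀ t, Measurable (N t)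
  zero : ∀ᵐ ω ∂P, N 0 ω = 0
  monotone : ∀ᵐ ω ∂P, Monotone fun t => N t ω
  rightContinuous : ∀ᵐ ω ∂P, ∀ t, ContinuousWithinAt (fun s => N s ω) (Ici t) t
  indepIncrements : HasIndepIncrements N P
  hasLaw_increment : ∀ s t, s ≤ t →
    HasLaw (fun ω => N t ω - N s ω) (poissonMeasure (r * (t - s))) P

/-- The compound process `Z_t = ∑_{j ≤ N_t} X_j` (the jumps are indexed from `0`). -/
def compound {Ω : Type*} (N : ℝ≥0 → Ω → ℕ) (X : ℕ → Ω → ℝ) (t : ℝ≥0) (ω : Ω) : ℝ :=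
  ∑ j ∈ Finset.range (N t ω), X j ω

/-- The observed increments `Z_{(j+1)Δ} - Z_{jΔ}`, `j = 0, …, n - 1`. -/
def increments {Ω : Type*} (Z : ℝ≥0 → Ω → ℝ) (Δ : ℝ≥0) (n : ℕ) (ω : Ω) (j : Fin n) : ℝ :=
  Z (((j : ℕ) + 1 : ℝ≥0) * Δ) ω - Z (((j : ℕ) : ℝ≥0) * Δ) ω

/-! ### Spectral cutoff -/

/-- The Fourier inversion of `φ` restricted to `[-m, m]`:
`x ↦ (2π)⁻¹ ∫_{-m}^{m} e^{-iux} φ(u) du`. -/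
def spectralCutoff (φ : ℝ → ℂ) (m x : ℝ) : ℂ :=
  (2 * Real.pi : ℂ)⁻¹ * ∫ u in (-m)..m, Complex.exp (-(Complex.I * u * x)) * φ u

/-! ### The estimators, as functions of the sample `y = (y_1, …, y_n)` of increments -/

/-- The empirical characteristic function. -/
def empCharFun {n : ℕ} (y : Fin n → ℝ) (u : ℝ) : ℂ :=
  (n : ℂ)⁻¹ * ∑ j, Complex.exp (Complex.I * u * y j)

/-- The derivative of the empirical characteristic function. -/
def empCharFunDeriv {n : ℕ} (y : Fin n → ℝ) (u : ℝ) : ℂ :=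
  (n : ℂ)⁻¹ * ∑ j, Complex.I * y j * Complex.exp (Complex.I * u * y j)

/-- The distinguished logarithm of the empirical characteristic function; meaningful at `u` when
the empirical characteristic function has no zero between `0` and `u`. -/
def empLog {n : ℕ} (y : Fin n → ℝ) (u : ℝ) : ℂ :=
  ∫ z in (0 : ℝ)..u, empCharFunDeriv y z / empCharFun y z

/-- The estimator `1 + Δ⁻¹ Log` of the characteristic function of the jumps. -/
def phiHat {n : ℕ} (Δ : ℝ) (y : Fin n → ℝ) (u : ℝ) : ℂ :=
  1 + (Δ : ℂ)⁻¹ * empLog y u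

open Classical in
/-- The estimator `phiHat`, set to `0` where its modulus exceeds `4`. If the empirical
characteristic function has a zero between `0` and `u`, then the integral that defines the
logarithm diverges, the modulus counts as infinite, and the value is `0` as well. -/
def phiTilde {n : ℕ} (Δ : ℝ) (y : Fin n → ℝ) (u : ℝ) : ℂ :=
  if (∀ z ∈ uIcc 0 u, empCharFun y z ≠ 0) ∧ ‖phiHat Δ y u‖ ≤ 4 then phiHat Δ y u else 0

/-- The threshold `(e^{2Δ} + κ √(log (nΔ))) / √(nΔ)`. -/
def level (n : ℕ) (Δ κ : ℝ) : ℝ :=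
  (Real.exp (2 * Δ) + κ * √(Real.log (n * Δ))) / √(n * Δ)

open Classical in
/-- The estimator `phiTilde`, set to `0` where its modulus is below the threshold. -/
def phiBar {n : ℕ} (Δ κ : ℝ) (y : Fin n → ℝ) (u : ℝ) : ℂ :=
  if level n Δ κ ≤ ‖phiTilde Δ y u‖ then phiTilde Δ y u else 0

/-- The frequencies at which the modulus of `phiBar` equals the threshold. -/
def crossings {n : ℕ} (Δ κ : ℝ) (y : Fin n → ℝ) : Set ℝ :=
  {m | 0 ≤ m ∧ ‖phiBar Δ κ y m‖ = level n Δ κ}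

open Classical in
/-- The empirical cutoff: the minimum of the largest crossing and `(nΔ)^α`. It is `(nΔ)^α` if
the crossings are unbounded or if there are none. -/
def mHat {n : ℕ} (Δ κ α : ℝ) (y : Fin n → ℝ) : ℝ :=
  if (crossings Δ κ y).Nonempty ∧ BddAbove (crossings Δ κ y) then
    min (sSup (crossings Δ κ y)) ((n * Δ) ^ α)
  else (n * Δ) ^ α

/-- The adaptive estimator of the jump density. -/
def adaptiveEstimator {n : ℕ} (Δ κ α : ℝ) (y : Fin n → ℝ) : ℝ → ℂ :=
  spectralCutoff (phiBar Δ κ y) (mHat Δ κ α y)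

end Decompounding

end

noncomputable section

namespace Decompounding

/-! Write `T = nΔ`, `a = T^α`, `ℓ` for the threshold and `φ_Δ = exp(Δ(φ-1))`. By Plancherel the loss
is `1/(2π)` times the integral of the squared error in the Fourier domain, and the bias of `f_m` is
`1/(2π)` times the energy of `φ` on `|u| > m`. The error can therefore be studied frequency by
frequency.

Outside an event of probability at most `2/T²`, the empirical characteristic function is relatively
close to `φ_Δ` on `[-U, U]`, `U = a + aT` (`exists_measurableSet_isClose`). There the distinguished
logarithm is `Δ(φ-1)` plus the principal logarithm of a ratio near `1`. Hence `phiHat - φ` is at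
most `1.01` times the deviation divided by `Δ|φ_Δ|`, and the truncation at `4` is inactive. The
second moment of this linear error is at most `5/(T|φ_Δ|²)`, because `1 - |φ_Δ|² ≤ 4Δ`.

Fix an oracle cutoff `m ≤ a`. For `m < |u| ≤ a` the loss exceeds `|φ|²` only if `|phiHat| ≥ ℓ`. Then
either `|φ| ≥ ℓ/100`, and the variance, of order `ℓ²`, is charged to `|φ|²`; or the deviation is at
least of order `Δe^{-Δ}ℓ`, which by Hoeffding has probability of order `T^{-κ²Δ²e^{-4Δ}}`. For `|u|
≤ m` the danger is that the empirical cutoff lies below `|u|`. Beyond the last crossing `|phiHat|`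
stays, by continuity, on one side of `ℓ` up to `U` (`IsClose.dichotomy`). If below, `|φ(u)|` is at
most `ℓ` plus the linear error. If above, either `|φ| > ℓ/100` on all of `[a, U]`, an interval so
long that the tail energy dominates `m` (here `Tℓ² ≥ 1` enters), or one fixed frequency shows a
large deviation (`exists_indicator_bound`). Integration gives `lintegral_risk_le`.

The constants are settled in `exists_lintegral_risk_le_oracle`. A trivial risk bound suffices if
`T^{-κ²Δ²e^{-4Δ}}` is bounded below or `T` is bounded; otherwise `e^{2Δ} ≤ T^{1/16}` and `Δ ≥
T^{-1/32}`, which is what the closeness event needs. Moments enter the constants only through `E|X|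
≤ 1 + E X²`. -/

/-! ### Plancherel's identity for spectral cutoffs -/

open FourierTransform SchwartzMap in
/-- Two locally integrable functions agree almost everywhere if they have the same integrals
against Schwartz functions. -/
theorem ae_eq_of_integral_schwartz_eq {f g : ℝ → ℂ} (hf : LocallyIntegrable f)
    (hg : LocallyIntegrable g) (h : ∀ h : 𝓢(ℝ, ℂ), ∫ x, h x • f x = ∫ x, h x • g x) :
    f =ᵐ[volume] g := by
  have h0 : ∀ᵐ x ∂(volume : Measure ℝ), f x - g x = 0 := by
    apply ae_eq_zero_of_integral_contDiff_smul_eq_zero (hf.sub hg)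
    intro k hk hkc
    have hk₁ : HasCompactSupport (Complex.ofRealCLM ∘ k) := hkc.comp_left rfl
    have hk₂ : ContDiff ℝ (⊤ : ℕ∞) (Complex.ofRealCLM ∘ k) := by fun_prop
    have hint := h (hk₁.toSchwartzMap hk₂)
    have hsm (x : ℝ) (z : ℂ) : hk₁.toSchwartzMap hk₂ x • z = k x • z := by simp
    simp only [hsm] at hint
    simp only [Pi.sub_apply, smul_sub]
    rw [integral_sub, hint, sub_self]
    · exact hf.integrable_smul_left_of_hasCompactSupport hk.continuous hkc
    · exact hg.integrable_smul_left_of_hasCompactSupport hk.continuous hkc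
  filter_upwards [h0] with x hx using sub_eq_zero.mp hx

open FourierTransform SchwartzMap in
/-- On `L¹ ∩ L²` the `L²` Fourier transform is given by the Fourier integral. -/
theorem fourier_toLp_ae_eq {f : ℝ → ℂ} (hf : Integrable f) (hf2 : MemLp f 2 volume) :
    ((𝓕 (hf2.toLp f) : Lp ℂ 2 (volume : Measure ℝ)) : ℝ → ℂ) =ᵐ[volume] 𝓕 f := by
  have hcont : Continuous (𝓕 f) :=
    VectorFourier.fourierIntegral_continuous Real.continuous_fourierChar
      (by exact continuous_inner) hf
  refine ae_eq_of_integral_schwartz_eq ((Lp.memLp _).locallyIntegrable (by norm_num))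
    hcont.locallyIntegrable fun g => ?_
  have h1 := congrArg (fun d : TemperedDistribution ℝ ℂ => d g)
    (Lp.fourier_toTemperedDistribution_eq (hf2.toLp f))
  simp only [TemperedDistribution.fourier_apply, Lp.toTemperedDistribution_apply] at h1
  rw [← h1]
  have h2 := VectorFourier.integral_fourierIntegral_smul_eq_flip (L := innerₗ ℝ)
    (μ := volume) (ν := volume) Real.continuous_fourierChar continuous_inner g.integrable hf
  have h3 : ∫ x, (𝓕 g) x • (hf2.toLp f) x = ∫ x, (𝓕 g) x • f x := by
    apply integral_congr_ae
    filter_upwards [hf2.coeFn_toLp] with x hx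
    rw [hx]
  rw [h3]
  rw [flip_innerₗ] at h2
  exact h2

open FourierTransform SchwartzMap in
/-- On `L¹ ∩ L²` the inverse `L²` Fourier transform is given by the inverse Fourier integral. -/
theorem fourierInv_toLp_ae_eq {f : ℝ → ℂ} (hf : Integrable f) (hf2 : MemLp f 2 volume) :
    ((𝓕⁻ (hf2.toLp f) : Lp ℂ 2 (volume : Measure ℝ)) : ℝ → ℂ) =ᵐ[volume] 𝓕⁻ f := by
  have hcont : Continuous (𝓕⁻ f) :=
    VectorFourier.fourierIntegral_continuous Real.continuous_fourierChar
      (by exact continuous_inner.neg) hf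
  refine ae_eq_of_integral_schwartz_eq ((Lp.memLp _).locallyIntegrable (by norm_num))
    hcont.locallyIntegrable fun g => ?_
  have h1 := congrArg (fun d : TemperedDistribution ℝ ℂ => d g)
    (Lp.fourierInv_toTemperedDistribution_eq (hf2.toLp f))
  simp only [TemperedDistribution.fourierInv_apply, Lp.toTemperedDistribution_apply] at h1
  rw [← h1]
  have h2 := VectorFourier.integral_fourierIntegral_smul_eq_flip (L := -innerₗ ℝ)
    (μ := volume) (ν := volume) Real.continuous_fourierChar (by exact continuous_inner.neg)
    g.integrable hf
  have h3 : ∫ x, (𝓕⁻ g) x • (hf2.toLp f) x = ∫ x, (𝓕⁻ g) x • f x := by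
    apply integral_congr_ae
    filter_upwards [hf2.coeFn_toLp] with x hx
    rw [hx]
  have h4 : (-innerₗ ℝ).flip = -innerₗ ℝ := by
    ext; simp
  rw [h3]
  rw [h4] at h2
  simp only [SchwartzMap.fourierInv_coe]
  exact h2

/-- Substitution for a linear change of variables in a lower Lebesgue integral. -/
theorem lintegral_comp_two_pi_mul (g : ℝ → ℝ≥0∞) :
    ∫⁻ v, g (2 * Real.pi * v) = ENNReal.ofReal (1 / (2 * Real.pi)) * ∫⁻ u, g u := by
  have h2 : (2 * Real.pi) ≠ 0 := by positivity
  have e := Real.map_volume_mul_left h2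
  have hm : MeasurableEmbedding (fun v : ℝ => 2 * Real.pi * v) :=
    (Homeomorph.mulLeft₀ _ h2).measurableEmbedding
  rw [← hm.lintegral_map g, e, lintegral_smul_measure, abs_of_pos (by positivity), one_div,
    smul_eq_mul]

open FourierTransform in
-- The substitution `u = 2πv` absorbs the factor `(2π)⁻¹` and passes to the kernel `e^{-2πivx}` of
-- `𝓕`.
theorem spectralCutoff_eq_fourier (ψ : ℝ → ℂ) {m : ℝ} (hm : 0 ≤ m) (x : ℝ) :
    spectralCutoff ψ m x
      = 𝓕 (fun v : ℝ => (Ioc (-m) m).indicator ψ (2 * Real.pi * v)) x := by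
  have h2 : (2 * Real.pi) ≠ 0 := by positivity
  rw [Real.fourier_eq', spectralCutoff, intervalIntegral.integral_of_le (by linarith),
    ← integral_indicator measurableSet_Ioc]
  have := Measure.integral_comp_mul_left
    (fun u : ℝ => (Ioc (-m) m).indicator
      (fun u : ℝ => Complex.exp (-(Complex.I * u * x)) * ψ u) u) (2 * Real.pi)
  rw [abs_of_pos (by positivity), Complex.real_smul] at this
  push_cast at this
  rw [← this]
  congr 1
  ext v
  by_cases hv : 2 * Real.pi * v ∈ Ioc (-m) m
  · simp only [indicator_of_mem hv, smul_eq_mul]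
    congr 2
    simp
    ring
  · simp [indicator_of_notMem hv]

/-- Bounded with bounded support. `L¹` makes `𝓕` a genuine integral, `L²` makes Plancherel
applicable. -/
theorem integrable_indicator_comp {ψ : ℝ → ℂ} (hψ : Measurable ψ) {B : ℝ} (hB : ∀ u, ‖ψ u‖ ≤ B)
    (m : ℝ) : MemLp (fun v : ℝ => (Ioc (-m) m).indicator ψ (2 * Real.pi * v)) 1 volume
      ∧ MemLp (fun v : ℝ => (Ioc (-m) m).indicator ψ (2 * Real.pi * v)) 2 volume := by
  have hpi : (0 : ℝ) < 2 * Real.pi := by positivity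
  have heq : (fun v : ℝ => (Ioc (-m) m).indicator ψ (2 * Real.pi * v))
      = (Ioc (-m / (2 * Real.pi)) (m / (2 * Real.pi))).indicator
        fun v => ψ (2 * Real.pi * v) := by
    ext v
    have : 2 * Real.pi * v ∈ Ioc (-m) m ↔ v ∈ Ioc (-m / (2 * Real.pi)) (m / (2 * Real.pi)) := by
      rw [mem_Ioc, mem_Ioc, div_lt_iff₀ hpi, le_div_iff₀ hpi, mul_comm v]
    by_cases h : 2 * Real.pi * v ∈ Ioc (-m) m
    · rw [indicator_of_mem h, indicator_of_mem (this.1 h)]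
    · rw [indicator_of_notMem h, indicator_of_notMem (fun h' => h (this.2 h'))]
  have key (p : ℝ≥0∞) :
      MemLp (fun v : ℝ => (Ioc (-m) m).indicator ψ (2 * Real.pi * v)) p volume := by
    rw [heq, memLp_indicator_iff_restrict measurableSet_Ioc]
    exact MemLp.of_bound (hψ.comp (measurable_const_mul _)).aestronglyMeasurable B
      (ae_of_all _ fun v => hB _)
  exact ⟨key 1, key 2⟩

open FourierTransform in
theorem memLp_spectralCutoff {ψ : ℝ → ℂ} (hψ : Measurable ψ) {B : ℝ} (hB : ∀ u, ‖ψ u‖ ≤ B)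
    {m : ℝ} (hm : 0 ≤ m) : MemLp (spectralCutoff ψ m) 2 volume := by
  obtain ⟨h1, h2⟩ := integrable_indicator_comp hψ hB m
  rw [funext (spectralCutoff_eq_fourier ψ hm)]
  exact (memLp_congr_ae (fourier_toLp_ae_eq (memLp_one_iff_integrable.1 h1) h2)).1 (Lp.memLp _)

open FourierTransform in
/-- Plancherel's identity for the error of a spectral cutoff estimator. -/
theorem eLpNorm_spectralCutoff_sub_sq {ψ : ℝ → ℂ} (hψ : Measurable ψ) {B : ℝ}
    (hB : ∀ u, ‖ψ u‖ ≤ B) {m : ℝ} (hm : 0 ≤ m) {f : ℝ → ℂ} (hf : Integrable f)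
    (hf2 : MemLp f 2 volume) :
    eLpNorm (fun x => spectralCutoff ψ m x - f x) 2 volume ^ 2
      = ENNReal.ofReal (1 / (2 * Real.pi)) * ∫⁻ u, ‖(Ioc (-m) m).indicator ψ u
        - ∫ x : ℝ, Complex.exp (u * x * Complex.I) * f x‖ₑ ^ 2 := by
  obtain ⟨h1, h2⟩ := integrable_indicator_comp hψ hB m
  set Ψ := fun v : ℝ => (Ioc (-m) m).indicator ψ (2 * Real.pi * v)
  have hΨ := fourier_toLp_ae_eq (memLp_one_iff_integrable.1 h1) h2
  have hfi := fourierInv_toLp_ae_eq hf hf2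
  have e1 : eLpNorm (fun x => spectralCutoff ψ m x - f x) 2 volume
      = eLpNorm ((𝓕 (h2.toLp Ψ) - hf2.toLp f : Lp ℂ 2 (volume : Measure ℝ))) 2 volume := by
    apply eLpNorm_congr_ae
    filter_upwards [hΨ, hf2.coeFn_toLp, Lp.coeFn_sub (𝓕 (h2.toLp Ψ)) (hf2.toLp f)]
      with x hx1 hx2 hx3
    rw [hx3, Pi.sub_apply, hx1, hx2, spectralCutoff_eq_fourier ψ hm]
  -- Since `f = 𝓕 (𝓕⁻ f)` in `L²`, the isometry moves the error to the frequency side; there `𝓕⁻ f`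
  -- at `v` is the characteristic function at `2πv`.
  have e2 : eLpNorm ((𝓕 (h2.toLp Ψ) - hf2.toLp f : Lp ℂ 2 (volume : Measure ℝ))) 2 volume
      = eLpNorm ((h2.toLp Ψ - 𝓕⁻ (hf2.toLp f) : Lp ℂ 2 (volume : Measure ℝ))) 2 volume := by
    rw [← Lp.enorm_def, ← Lp.enorm_def, ← ofReal_norm, ← ofReal_norm]
    congr 1
    rw [← Lp.norm_fourier_eq (h2.toLp Ψ - 𝓕⁻ (hf2.toLp f)), show 𝓕 (h2.toLp Ψ - 𝓕⁻ (hf2.toLp f))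
      = 𝓕 (h2.toLp Ψ) - 𝓕 (𝓕⁻ (hf2.toLp f)) from (Lp.fourierTransformₗᵢ ℝ ℂ).map_sub _ _,
      FourierTransform.fourier_fourierInv_eq]
  have e3 : eLpNorm ((h2.toLp Ψ - 𝓕⁻ (hf2.toLp f) : Lp ℂ 2 (volume : Measure ℝ))) 2 volume
      = eLpNorm (fun v => Ψ v - 𝓕⁻ f v) 2 volume := by
    apply eLpNorm_congr_ae
    filter_upwards [hfi, h2.coeFn_toLp, Lp.coeFn_sub (h2.toLp Ψ) (𝓕⁻ (hf2.toLp f))]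
      with x hx1 hx2 hx3
    rw [hx3, Pi.sub_apply, hx1, hx2]
  rw [e1, e2, e3, ← lintegral_comp_two_pi_mul,
    eLpNorm_eq_lintegral_rpow_enorm_toReal (by norm_num) (by norm_num)]
  rw [← ENNReal.rpow_natCast, ← ENNReal.rpow_mul]
  simp only [ENNReal.toReal_ofNat, Nat.cast_ofNat]
  norm_num
  congr 1
  ext v
  congr 3
  rw [Real.fourierInv_eq']
  congr 1
  ext x
  rw [smul_eq_mul]
  congr 2
  simp
  ring

/-! ### Law of the increments of the compound Poisson process -/

variable {Ω : Type*} [MeasurableSpace Ω] {P : Measure Ω}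

theorem measurable_compound {N : ℝ≥0 → Ω → ℕ} {X : ℕ → Ω → ℝ} (hN : ∀ t, Measurable (N t))
    (hX : ∀ j, Measurable (X j)) (t : ℝ≥0) : Measurable (compound N X t) := by
  have : Measurable (fun p : ℕ × Ω => ∑ j ∈ Finset.range p.1, X j p.2) :=
    measurable_from_prod_countable_right fun k => by
      simpa using Finset.measurable_sum (Finset.range k) fun j _ => hX j
  exact this.comp ((hN t).prodMk measurable_id)

theorem measurable_increments {N : ℝ≥0 → Ω → ℕ} {X : ℕ → Ω → ℝ} (hN : ∀ t, Measurable (N t))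
    (hX : ∀ j, Measurable (X j)) (Δ : ℝ≥0) (n : ℕ) (j : Fin n) :
    Measurable fun ω => increments (compound N X) Δ n ω j :=
  (measurable_compound hN hX _).sub (measurable_compound hN hX _)

/-- The probability generating function of the Poisson distribution. -/
theorem integral_pow_poissonMeasure (r : ℝ≥0) (z : ℂ) :
    ∫ k, z ^ k ∂(poissonMeasure r) = Complex.exp (r * (z - 1)) := by
  rw [integral_poissonMeasure]
  have h := (NormedSpace.expSeries_div_hasSum_exp ((r : ℂ) * z)).mul_left (Complex.exp (-r))
  rw [← Complex.exp_eq_exp_ℂ, ← Complex.exp_add] at h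
  rw [show (r : ℂ) * (z - 1) = -r + r * z by ring, ← h.tsum_eq]
  congr 1
  ext k
  rw [Complex.real_smul]
  push_cast
  rw [mul_pow]
  ring

/-- A crude bound from `k ≤ 2 ^ k` and the generating function at `2`; only some bound of order
`e^Δ` is needed later. -/
theorem lintegral_natCast_poissonMeasure_le (r : ℝ≥0) :
    ∫⁻ k, (k : ℝ≥0∞) ∂(poissonMeasure r) ≤ ENNReal.ofReal (Real.exp r) := by
  have hint : Integrable (fun k : ℕ => (2 : ℝ) ^ k) (poissonMeasure r) := by
    rw [integrable_poissonMeasure_iff]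
    refine ((Real.summable_pow_div_factorial (2 * r)).mul_left (Real.exp (-r))).congr fun k => ?_
    rw [Real.norm_of_nonneg (by positivity), mul_pow]
    ring
  have hval : ∫ k : ℕ, (2 : ℝ) ^ k ∂(poissonMeasure r) = Real.exp r := by
    have h := integral_pow_poissonMeasure r 2
    have h' : ∫ k : ℕ, (2 : ℂ) ^ k ∂(poissonMeasure r)
        = ((∫ k : ℕ, (2 : ℝ) ^ k ∂(poissonMeasure r) : ℝ) : ℂ) := by
      rw [← integral_complex_ofReal]
      simp
    rw [h'] at h
    have : (r : ℂ) * (2 - 1) = ((r : ℝ) : ℂ) := by ring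
    rw [this] at h
    exact_mod_cast h
  rw [← hval, ofReal_integral_eq_lintegral_ofReal hint (ae_of_all _ fun k => by positivity)]
  refine lintegral_mono fun k => ?_
  rw [← ENNReal.ofReal_natCast]
  refine ENNReal.ofReal_le_ofReal ?_
  exact_mod_cast Nat.lt_two_pow_self.le

/-- Joint characteristic function of sums over consecutive blocks of an i.i.d. sequence. -/
theorem integral_exp_blocks {X : ℕ → Ω → ℝ} (hX : ∀ j, Measurable (X j)) (hind : iIndepFun X P)
    {φ : ℝ → ℂ} (hφ : ∀ j, charFun (P.map (X j)) = φ) {n : ℕ} (k : ℕ → ℕ) (hk : Monotone k)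
    (t : Fin n → ℝ) :
    ∫ ω, Complex.exp ((∑ j : Fin n, t j * ∑ i ∈ Finset.Ico (k j) (k (j + 1)), X i ω : ℝ)
      * Complex.I) ∂P = ∏ j : Fin n, φ (t j) ^ (k (j + 1) - k j) := by
  -- Pairs (block, index). Consecutive blocks are disjoint, so the index determines the pair, and
  -- independence of `X` passes to this family.
  set s : Finset (Σ _ : Fin n, ℕ) :=
    Finset.univ.sigma fun j : Fin n => Finset.Ico (k j) (k (j + 1)) with hs
  have hinj : Function.Injective (fun p : s => p.1.2) := by
    have aux (j j' : Fin n) (i : ℕ) (h1 : k j ≤ i) (h2 : i < k (j' + 1)) : j ≤ j' := by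
      by_contra hlt
      have : k (j' + 1) ≤ k j := hk (by have := Fin.lt_def.1 (not_le.1 hlt); omega)
      omega
    rintro ⟨⟨j, i⟩, h⟩ ⟨⟨j', i'⟩, h'⟩ hii
    simp only [hs, Finset.mem_sigma, Finset.mem_univ, Finset.mem_Ico, true_and] at h h' hii
    subst hii
    have : j = j' := le_antisymm (aux j j' i h.1 h'.2) (aux j' j i h'.1 h.2)
    subst this
    rfl
  have hI := (hind.precomp hinj).comp
    (fun (p : s) (x : ℝ) => Complex.exp ((t p.1.1 * x : ℝ) * Complex.I))
    (fun p => by fun_prop)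
  have hprod := hI.integral_fun_prod_eq_prod_integral (fun p => by
    exact ((by fun_prop : Measurable fun x : ℝ =>
      Complex.exp ((t p.1.1 * x : ℝ) * Complex.I)).comp (hX _)).aestronglyMeasurable)
  simp only [Function.comp_apply] at hprod
  have hone (p : Σ _ : Fin n, ℕ) :
      ∫ ω, Complex.exp ((t p.1 * X p.2 ω : ℝ) * Complex.I) ∂P = φ (t p.1) := by
    rw [← hφ p.2, charFun_apply_real, integral_map (hX _).aemeasurable (by fun_prop)]
    push_cast
    rfl
  have e1 (ω : Ω) : Complex.exp ((∑ j : Fin n, t j * ∑ i ∈ Finset.Ico (k j) (k (j + 1)), X i ω : ℝ)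
      * Complex.I) = ∏ p : s, Complex.exp ((t p.1.1 * X p.1.2 ω : ℝ) * Complex.I) := by
    rw [Finset.prod_coe_sort s fun p => Complex.exp ((t p.1 * X p.2 ω : ℝ) * Complex.I),
      ← Complex.exp_sum, ← Finset.sum_mul, ← Complex.ofReal_sum, hs, Finset.sum_sigma]
    simp only [Finset.mul_sum]
  simp only [e1]
  rw [hprod]
  simp only [hone]
  rw [Finset.prod_coe_sort s fun p => φ (t p.1), hs, Finset.prod_sigma]
  simp

theorem measurable_partialSum : Measurable fun p : ℕ × (ℕ → ℝ) => ∑ i ∈ Finset.range p.1, p.2 i :=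
  measurable_from_prod_countable_right fun k =>
    Finset.measurable_sum (Finset.range k) fun j _ => measurable_pi_apply j

/-- Joint characteristic function of the increments of a compound Poisson process. -/
theorem integral_exp_increments [IsProbabilityMeasure P] {N : ℝ≥0 → Ω → ℕ} {X : ℕ → Ω → ℝ}
    (hX : ∀ j, Measurable (X j)) (hind : iIndepFun X P)
    {φ : ℝ → ℂ} (hφ : ∀ j, charFun (P.map (X j)) = φ) (hN : IsPoissonProcess N 1 P)
    (hNX : IndepFun (fun ω t => N t ω) (fun ω j => X j ω) P) (Δ : ℝ≥0) {n : ℕ} (t : Fin n → ℝ) :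
    ∫ ω, Complex.exp ((∑ j, t j * increments (compound N X) Δ n ω j : ℝ) * Complex.I) ∂P
      = ∏ j, Complex.exp (Δ * (φ (t j) - 1)) := by
  set K : Ω → ℕ → ℕ := fun ω j => N (j * Δ) ω with hK
  set F : (ℕ → ℕ) × (ℕ → ℝ) → ℂ := fun p => Complex.exp ((∑ j : Fin n, t j *
    (∑ i ∈ Finset.range (p.1 (j + 1)), p.2 i - ∑ i ∈ Finset.range (p.1 j), p.2 i) : ℝ)
      * Complex.I) with hF
  have hFm : Measurable F := by
    have h1 (l : ℕ) : Measurable fun p : (ℕ → ℕ) × (ℕ → ℝ) =>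
        ∑ i ∈ Finset.range (p.1 l), p.2 i := by
      have hl : Measurable fun p : (ℕ → ℕ) × (ℕ → ℝ) => (p.1 l, p.2) :=
        ((measurable_pi_apply l).comp measurable_fst).prodMk measurable_snd
      exact measurable_partialSum.comp hl
    have h2 : Measurable fun p : (ℕ → ℕ) × (ℕ → ℝ) => ∑ j : Fin n, t j *
        (∑ i ∈ Finset.range (p.1 (j + 1)), p.2 i - ∑ i ∈ Finset.range (p.1 j), p.2 i) :=
      Finset.measurable_sum _ fun j _ => ((h1 _).sub (h1 _)).const_mul _
    exact (by fun_prop : Measurable fun x : ℝ => Complex.exp (x * Complex.I)).comp h2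
  have hKm : Measurable K := measurable_pi_lambda _ fun j => hN.measurable _
  have hXm : Measurable fun ω j => X j ω := measurable_pi_lambda _ hX
  have hKX : IndepFun K (fun ω j => X j ω) P :=
    hNX.comp (φ := fun g : ℝ≥0 → ℕ => fun j : ℕ => g (j * Δ))
      (measurable_pi_lambda _ fun j => measurable_pi_apply _) measurable_id
  have hmap := (indepFun_iff_map_prod_eq_prod_map_map hKm.aemeasurable hXm.aemeasurable).1 hKX
  have hPK := Measure.isProbabilityMeasure_map (μ := P) hKm.aemeasurable
  have hPX := Measure.isProbabilityMeasure_map (μ := P) hXm.aemeasurable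
  have hFb (p) : ‖F p‖ ≤ 1 := by rw [hF, Complex.norm_exp_ofReal_mul_I]
  have e1 (ω : Ω) : Complex.exp ((∑ j, t j * increments (compound N X) Δ n ω j : ℝ) * Complex.I)
      = F (K ω, fun j => X j ω) := by
    simp only [hF, hK, increments, compound]
    push_cast
    rfl
  -- Independence of `N` and `X` allows the counts to be frozen: the jumps are integrated out first,
  -- then the Poisson process.
  have e2 : ∫ ω, F (K ω, fun j => X j ω) ∂P
      = ∫ ω, ∫ ω', F (K ω, fun j => X j ω') ∂P ∂P := by
    have h1 : ∫ ω, F (K ω, fun j => X j ω) ∂P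
        = ∫ p, F p ∂((P.map K).prod (P.map fun ω j => X j ω)) := by
      rw [← hmap, integral_map (hKm.prodMk hXm).aemeasurable hFm.aestronglyMeasurable]
    rw [h1, integral_prod _ (Integrable.of_bound hFm.aestronglyMeasurable 1 (ae_of_all _ hFb)),
      integral_map hKm.aemeasurable]
    · congr 1
      ext ω
      rw [integral_map hXm.aemeasurable]
      exact (hFm.comp measurable_prodMk_left).aestronglyMeasurable
    · exact (hFm.stronglyMeasurable.integral_prod_right).aestronglyMeasurable
  have e3 : ∀ᵐ ω ∂P, ∫ ω', F (K ω, fun j => X j ω') ∂P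
      = ∏ j : Fin n, φ (t j) ^ (K ω (j + 1) - K ω j) := by
    filter_upwards [hN.monotone] with ω hω
    have hmono : Monotone (K ω) := fun i j hij => hω (by gcongr)
    rw [← integral_exp_blocks hX hind hφ (K ω) hmono t]
    congr 1
    ext ω'
    simp only [hF]
    congr 4
    ext j
    rw [Finset.sum_Ico_eq_sub _ (hmono (Nat.le_succ _))]
  have hinc := hN.indepIncrements.nat (t := fun j : ℕ => (j : ℝ≥0) * Δ)
    (fun i j hij => by dsimp only; gcongr)
  have hinc' := (hinc.precomp (g := fun j : Fin n => (j : ℕ)) Fin.val_injective).comp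
    (fun j (k : ℕ) => φ (t j) ^ k) (fun j => measurable_of_countable _)
  have hprod := hinc'.integral_fun_prod_eq_prod_integral (fun j =>
    ((measurable_of_countable fun k : ℕ => φ (t j) ^ k).comp
      ((hN.measurable _).sub (hN.measurable _))).aestronglyMeasurable)
  simp only [Function.comp_apply] at hprod
  simp only [e1]
  rw [e2, integral_congr_ae e3]
  simp only [hK]
  rw [hprod]
  refine Finset.prod_congr rfl fun j _ => ?_
  have hlaw := hN.hasLaw_increment ((j : ℕ) * Δ) (((j : ℕ) + 1 : ℕ) * Δ) (by gcongr; simp)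
  have hr : (1 : ℝ≥0) * ((((j : ℕ) + 1 : ℕ) : ℝ≥0) * Δ - (j : ℕ) * Δ) = Δ := by
    rw [one_mul, ← tsub_mul]
    simp
  rw [hr] at hlaw
  rw [← integral_pow_poissonMeasure, ← hlaw.map_eq,
    integral_map hlaw.aemeasurable (measurable_of_countable _).aestronglyMeasurable]

/-- This is the joint transform at a vector supported on one coordinate; each other factor is
`exp(Δ(φ 0 - 1)) = 1`. -/
theorem charFun_increments [IsProbabilityMeasure P] {N : ℝ≥0 → Ω → ℕ} {X : ℕ → Ω → ℝ}
    (hX : ∀ j, Measurable (X j)) (hind : iIndepFun X P)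
    {φ : ℝ → ℂ} (hφ : ∀ j, charFun (P.map (X j)) = φ) (hN : IsPoissonProcess N 1 P)
    (hNX : IndepFun (fun ω t => N t ω) (fun ω j => X j ω) P) (Δ : ℝ≥0) (n : ℕ) (j : Fin n)
    (u : ℝ) :
    charFun (P.map fun ω => increments (compound N X) Δ n ω j) u
      = Complex.exp (Δ * (φ u - 1)) := by
  have h := integral_exp_increments hX hind hφ hN hNX Δ (Pi.single j u : Fin n → ℝ)
  have hφ0 : φ 0 = 1 := by
    have := Measure.isProbabilityMeasure_map (μ := P) (hX 0).aemeasurable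
    rw [← hφ 0]; simp
  rw [charFun_apply_real, integral_map (measurable_increments hN.measurable hX Δ n j).aemeasurable
    (by fun_prop)]
  rw [Finset.prod_eq_single j] at h
  · simp only [Pi.single_eq_same] at h
    rw [← h]
    congr 1
    ext ω
    rw [Finset.sum_eq_single j]
    · simp
    · intro i _ hi
      simp [hi]
    · simp
  · intro i _ hi
    simp [hi, hφ0]
  · exact fun h => absurd (Finset.mem_univ j) h

/-- The joint characteristic function is the product of the marginal ones. -/
theorem iIndepFun_increments [IsProbabilityMeasure P] {N : ℝ≥0 → Ω → ℕ} {X : ℕ → Ω → ℝ}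
    (hX : ∀ j, Measurable (X j)) (hind : iIndepFun X P)
    {φ : ℝ → ℂ} (hφ : ∀ j, charFun (P.map (X j)) = φ) (hN : IsPoissonProcess N 1 P)
    (hNX : IndepFun (fun ω t => N t ω) (fun ω j => X j ω) P) (Δ : ℝ≥0) (n : ℕ) :
    iIndepFun (fun j ω => increments (compound N X) Δ n ω j) P := by
  rw [iIndepFun_iff_charFun_pi fun j =>
    (measurable_increments hN.measurable hX Δ n j).aemeasurable]
  intro t
  have hm : Measurable fun ω => WithLp.toLp 2 fun j => increments (compound N X) Δ n ω j :=
    (WithLp.measurable_toLp 2 _).comp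
      (measurable_pi_lambda _ (measurable_increments hN.measurable hX Δ n))
  rw [charFun_apply, integral_map hm.aemeasurable (by fun_prop)]
  simp only [charFun_increments hX hind hφ hN hNX]
  rw [← integral_exp_increments hX hind hφ hN hNX Δ]
  congr 1

theorem charFun_compound [IsProbabilityMeasure P] {N : ℝ≥0 → Ω → ℕ} {X : ℕ → Ω → ℝ}
    (hX : ∀ j, Measurable (X j)) (hind : iIndepFun X P)
    {φ : ℝ → ℂ} (hφ : ∀ j, charFun (P.map (X j)) = φ) (hN : IsPoissonProcess N 1 P)
    (hNX : IndepFun (fun ω t => N t ω) (fun ω j => X j ω) P) (Δ : ℝ≥0) (u : ℝ) :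
    charFun (P.map (compound N X Δ)) u = Complex.exp (Δ * (φ u - 1)) := by
  rw [← charFun_increments hX hind hφ hN hNX Δ 1 0 u]
  congr 1
  apply Measure.map_congr
  filter_upwards [hN.zero] with ω hω
  simp [increments, compound, hω]

/-- A Wald-type bound: whether jump `i` falls in the time interval depends on `N` alone and is
independent of its size, so the mean is at most the expected number of jumps times `c`. -/
theorem lintegral_increments_le [IsProbabilityMeasure P] {N : ℝ≥0 → Ω → ℕ} {X : ℕ → Ω → ℝ}
    (hX : ∀ j, Measurable (X j)) (hN : IsPoissonProcess N 1 P)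
    (hNX : IndepFun (fun ω t => N t ω) (fun ω j => X j ω) P) {c : ℝ≥0∞}
    (hc : ∀ j, ∫⁻ ω, ‖X j ω‖ₑ ∂P = c) (Δ : ℝ≥0) (n : ℕ) (j : Fin n) :
    ∫⁻ ω, ‖increments (compound N X) Δ n ω j‖ₑ ∂P ≤ ENNReal.ofReal (Real.exp Δ) * c := by
  set s : ℝ≥0 := (j : ℕ) * Δ with hs
  set t : ℝ≥0 := ((j : ℕ) + 1) * Δ with ht
  have hst : s ≤ t := by rw [hs, ht]; gcongr; simp
  set A : ℕ → Set Ω := fun i => {ω | N s ω ≤ i ∧ i < N t ω} with hA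
  have hAm (i) : MeasurableSet (A i) :=
    (measurableSet_le (hN.measurable s) measurable_const).inter
      (measurableSet_lt measurable_const (hN.measurable t))
  have hb : ∀ᵐ ω ∂P, ‖increments (compound N X) Δ n ω j‖ₑ
      ≤ ∑' i, (A i).indicator 1 ω * ‖X i ω‖ₑ := by
    filter_upwards [hN.monotone] with ω hω
    have h1 : increments (compound N X) Δ n ω j
        = ∑ i ∈ Finset.Ico (N s ω) (N t ω), X i ω := by
      rw [Finset.sum_Ico_eq_sub _ (hω hst)]
      rfl
    rw [h1]
    refine (enorm_sum_le _ _).trans ?_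
    refine le_trans (le_of_eq ?_)
      (ENNReal.sum_le_tsum (Finset.Ico (N s ω) (N t ω)))
    refine Finset.sum_congr rfl fun i hi => ?_
    have : ω ∈ A i := Finset.mem_Ico.1 hi
    simp [this]
  have hcount : ∀ ω, ∑' i, (A i).indicator (1 : Ω → ℝ≥0∞) ω = ((N t ω - N s ω : ℕ) : ℝ≥0∞) := by
    intro ω
    rw [tsum_eq_sum (s := Finset.Ico (N s ω) (N t ω))]
    · rw [Finset.sum_congr rfl (g := fun _ => (1 : ℝ≥0∞))]
      · simp
      · intro i hi
        have : ω ∈ A i := Finset.mem_Ico.1 hi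
        simp [this]
    · intro i hi
      have : ω ∉ A i := fun h => hi (Finset.mem_Ico.2 h)
      simp [this]
  have hterm (i : ℕ) : ∫⁻ ω, (A i).indicator 1 ω * ‖X i ω‖ₑ ∂P
      = (∫⁻ ω, (A i).indicator 1 ω ∂P) * c := by
    rw [← hc i]
    apply lintegral_mul_eq_lintegral_mul_lintegral_of_indepFun
      (measurable_one.indicator (hAm i)) (hX i).enorm
    have hS : MeasurableSet {g : ℝ≥0 → ℕ | g s ≤ i ∧ i < g t} :=
      (measurableSet_le (measurable_pi_apply s) measurable_const).inter
        (measurableSet_lt measurable_const (measurable_pi_apply t))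
    exact hNX.comp (φ := {g : ℝ≥0 → ℕ | g s ≤ i ∧ i < g t}.indicator (1 : (ℝ≥0 → ℕ) → ℝ≥0∞))
      (ψ := fun x : ℕ → ℝ => ‖x i‖ₑ) (measurable_one.indicator hS) (measurable_pi_apply i).enorm
  have hlaw := hN.hasLaw_increment s t hst
  have hr : (1 : ℝ≥0) * (t - s) = Δ := by
    rw [one_mul, hs, ht, ← tsub_mul]
    simp
  rw [hr] at hlaw
  calc ∫⁻ ω, ‖increments (compound N X) Δ n ω j‖ₑ ∂P
      ≤ ∫⁻ ω, ∑' i, (A i).indicator 1 ω * ‖X i ω‖ₑ ∂P := lintegral_mono_ae hb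
    _ = ∑' i, (∫⁻ ω, (A i).indicator 1 ω ∂P) * c := by
        rw [← tsum_congr hterm]
        exact lintegral_tsum fun i =>
          ((measurable_one.indicator (hAm i)).mul (hX i).enorm).aemeasurable
    _ = (∫⁻ ω, ((N t ω - N s ω : ℕ) : ℝ≥0∞) ∂P) * c := by
        rw [ENNReal.tsum_mul_right, ← lintegral_tsum fun i =>
          (measurable_one.indicator (hAm i)).aemeasurable]
        simp only [hcount]
    _ ≤ ENNReal.ofReal (Real.exp Δ) * c := by
        gcongr
        rw [← lintegral_map' (f := fun k : ℕ => (k : ℝ≥0∞))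
          (measurable_of_countable _).aemeasurable hlaw.aemeasurable, hlaw.map_eq]
        exact lintegral_natCast_poissonMeasure_le Δ

/-! ### Concentration and variance of the empirical characteristic function -/

/-- Two-sided Hoeffding inequality for the mean of a bounded function of an i.i.d. sample. -/
theorem measureReal_abs_mean_sub_ge_le [IsProbabilityMeasure P] {n : ℕ} (hn : 0 < n)
    {Y : Fin n → Ω → ℝ} (hY : ∀ j, Measurable (Y j)) (hind : iIndepFun Y P) {g : ℝ → ℝ}
    (hg : Measurable g) (hg1 : ∀ x, |g x| ≤ 1) {c : ℝ} (hc : ∀ j, ∫ ω, g (Y j ω) ∂P = c) {ε : ℝ}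
    (hε : 0 ≤ ε) :
    P.real {ω | ε ≤ |(n : ℝ)⁻¹ * ∑ j, g (Y j ω) - c|} ≤ 2 * Real.exp (-(n * ε ^ 2 / 2)) := by
  have hn' : (0 : ℝ) < n := by exact_mod_cast hn
  have hsub (j : Fin n) : HasSubgaussianMGF (fun ω => g (Y j ω) - c) 1 P := by
    have h := hasSubgaussianMGF_of_mem_Icc (μ := P) (a := -1) (b := 1)
      (X := fun ω => g (Y j ω)) (hg.comp (hY j)).aemeasurable
      (ae_of_all _ fun ω => abs_le.1 (hg1 _))
    rw [hc j] at h
    convert h using 1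
    ext
    norm_num
  have hI : iIndepFun (fun j ω => g (Y j ω) - c) P :=
    hind.comp (fun _ x => g x - c) fun _ => hg.sub_const c
  have hI' : iIndepFun (fun j ω => -(g (Y j ω) - c)) P :=
    hind.comp (fun _ x => -(g x - c)) fun _ => (hg.sub_const c).neg
  have hε' : 0 ≤ n * ε := by positivity
  have h1 := HasSubgaussianMGF.measure_sum_ge_le_of_iIndepFun hI (s := Finset.univ)
    (fun j _ => hsub j) hε'
  have h2 := HasSubgaussianMGF.measure_sum_ge_le_of_iIndepFun hI' (s := Finset.univ)
    (fun j _ => (hsub j).neg) hε'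
  have hexp : Real.exp (-(n * ε) ^ 2 / (2 * ((∑ _j : Fin n, (1 : ℝ≥0) : ℝ≥0) : ℝ)))
      = Real.exp (-(n * ε ^ 2 / 2)) := by
    congr 1
    simp
    field_simp
  rw [hexp] at h1 h2
  have hset : {ω | ε ≤ |(n : ℝ)⁻¹ * ∑ j, g (Y j ω) - c|}
      ⊆ {ω | n * ε ≤ ∑ j, (g (Y j ω) - c)} ∪ {ω | n * ε ≤ ∑ j, -(g (Y j ω) - c)} := by
    intro ω hω
    simp only [mem_ofPred_eq, mem_union, Finset.sum_neg_distrib, Finset.sum_sub_distrib,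
      Finset.sum_const, Finset.card_univ, Fintype.card_fin, nsmul_eq_mul] at hω ⊢
    rcases le_abs.1 hω with h | h
    · left
      have := mul_le_mul_of_nonneg_left h hn'.le
      rwa [mul_sub, mul_inv_cancel_left₀ hn'.ne'] at this
    · right
      have := mul_le_mul_of_nonneg_left h hn'.le
      rwa [mul_neg, mul_sub, mul_inv_cancel_left₀ hn'.ne'] at this
  refine (measureReal_mono hset).trans ((measureReal_union_le _ _).trans ?_)
  linarith

/-- Variance of the mean of a bounded function of an i.i.d. sample. -/
theorem integral_mean_sub_sq [IsProbabilityMeasure P] {n : ℕ} (hn : 0 < n)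
    {Y : Fin n → Ω → ℝ} (hY : ∀ j, Measurable (Y j)) (hind : iIndepFun Y P) {g : ℝ → ℝ}
    (hg : Measurable g) (hg1 : ∀ x, |g x| ≤ 1) {c b : ℝ} (hc : ∀ j, ∫ ω, g (Y j ω) ∂P = c)
    (hb : ∀ j, ∫ ω, g (Y j ω) ^ 2 ∂P = b) :
    ∫ ω, ((n : ℝ)⁻¹ * ∑ j, g (Y j ω) - c) ^ 2 ∂P = (b - c ^ 2) / n := by
  have hn' : (n : ℝ) ≠ 0 := by exact_mod_cast hn.ne'
  have hL (j : Fin n) : MemLp (fun ω => g (Y j ω)) 2 P :=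
    MemLp.of_bound (hg.comp (hY j)).aestronglyMeasurable 1 (ae_of_all _ fun ω => hg1 _)
  have hI : iIndepFun (fun j ω => g (Y j ω)) P := hind.comp (fun _ x => g x) fun _ => hg
  have hv (j : Fin n) : variance (fun ω => g (Y j ω)) P = b - c ^ 2 := by
    rw [variance_eq_sub (hL j), hc j]
    simp only [Pi.pow_apply, hb j]
  have hsum := IndepFun.variance_sum (s := Finset.univ) (X := fun j ω => g (Y j ω))
    (fun j _ => hL j) (fun i _ j _ hij => hI.indepFun hij)
  rw [show (∑ j, fun ω => g (Y j ω)) = fun ω => ∑ j, g (Y j ω) by ext; simp] at hsum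
  simp only [hv, Finset.sum_const, Finset.card_univ, Fintype.card_fin, nsmul_eq_mul] at hsum
  have hmean : ∫ ω, ∑ j, g (Y j ω) ∂P = n * c := by
    rw [integral_finsetSum _ fun j _ => (hL j).integrable (by norm_num)]
    simp [hc]
  have hm : Measurable fun ω => ∑ j, g (Y j ω) :=
    Finset.measurable_sum _ fun j _ => hg.comp (hY j)
  rw [variance_eq_integral hm.aemeasurable, hmean] at hsum
  have : ∀ ω, ((n : ℝ)⁻¹ * ∑ j, g (Y j ω) - c) ^ 2
      = ((n : ℝ) ^ 2)⁻¹ * (∑ j, g (Y j ω) - n * c) ^ 2 := by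
    intro ω
    field_simp
  simp only [this]
  rw [integral_const_mul, hsum]
  field_simp

section empirical

theorem empCharFun_re {n : ℕ} (y : Fin n → ℝ) (u : ℝ) :
    (empCharFun y u).re = (n : ℝ)⁻¹ * ∑ j, Real.cos (u * y j) := by
  have (j : Fin n) : Complex.I * u * y j = ((u * y j : ℝ) : ℂ) * Complex.I := by
    push_cast
    ring
  rw [empCharFun, ← Complex.ofReal_natCast, ← Complex.ofReal_inv, Complex.re_ofReal_mul,
    Complex.re_sum]
  simp only [this, Complex.exp_ofReal_mul_I_re]

theorem empCharFun_im {n : ℕ} (y : Fin n → ℝ) (u : ℝ) :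
    (empCharFun y u).im = (n : ℝ)⁻¹ * ∑ j, Real.sin (u * y j) := by
  have (j : Fin n) : Complex.I * u * y j = ((u * y j : ℝ) : ℂ) * Complex.I := by
    push_cast
    ring
  rw [empCharFun, ← Complex.ofReal_natCast, ← Complex.ofReal_inv, Complex.im_ofReal_mul,
    Complex.im_sum]
  simp only [this, Complex.exp_ofReal_mul_I_im]

theorem integral_cos_eq_re_charFun [IsFiniteMeasure P] {Y : Ω → ℝ} (hY : Measurable Y) (u : ℝ) :
    ∫ ω, Real.cos (u * Y ω) ∂P = (charFun (P.map Y) u).re := by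
  rw [charFun_apply_real, integral_map hY.aemeasurable (by fun_prop), ← RCLike.re_eq_complex_re,
    ← integral_re]
  · congr 1
    ext ω
    rw [RCLike.re_eq_complex_re, ← Complex.ofReal_mul, Complex.exp_ofReal_mul_I_re]
  · refine Integrable.of_bound (by fun_prop) 1 (ae_of_all _ fun ω => ?_)
    rw [← Complex.ofReal_mul, Complex.norm_exp_ofReal_mul_I]

theorem integral_sin_eq_im_charFun [IsFiniteMeasure P] {Y : Ω → ℝ} (hY : Measurable Y) (u : ℝ) :
    ∫ ω, Real.sin (u * Y ω) ∂P = (charFun (P.map Y) u).im := by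
  rw [charFun_apply_real, integral_map hY.aemeasurable (by fun_prop), ← RCLike.im_eq_complex_im,
    ← integral_im]
  · congr 1
    ext ω
    rw [RCLike.im_eq_complex_im, ← Complex.ofReal_mul, Complex.exp_ofReal_mul_I_im]
  · refine Integrable.of_bound (by fun_prop) 1 (ae_of_all _ fun ω => ?_)
    rw [← Complex.ofReal_mul, Complex.norm_exp_ofReal_mul_I]

/-- Hoeffding's inequality for the empirical characteristic function at one point. -/
theorem measureReal_empCharFun_sub_ge_le [IsProbabilityMeasure P] {n : ℕ} (hn : 0 < n)
    {Y : Fin n → Ω → ℝ} (hY : ∀ j, Measurable (Y j)) (hind : iIndepFun Y P) {χ : ℝ → ℂ}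
    (hχ : ∀ j, charFun (P.map (Y j)) = χ) (u : ℝ) {t : ℝ} (ht : 0 ≤ t) :
    P.real {ω | t ≤ ‖empCharFun (fun j => Y j ω) u - χ u‖}
      ≤ 4 * Real.exp (-(n * t ^ 2 / 4)) := by
  have h1 := measureReal_abs_mean_sub_ge_le hn hY hind (g := fun x => Real.cos (u * x))
    (by fun_prop) (fun x => Real.abs_cos_le_one _) (c := (χ u).re)
    (fun j => by rw [integral_cos_eq_re_charFun (hY j), hχ]) (ε := t / √2) (by positivity)
  have h2 := measureReal_abs_mean_sub_ge_le hn hY hind (g := fun x => Real.sin (u * x))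
    (by fun_prop) (fun x => Real.abs_sin_le_one _) (c := (χ u).im)
    (fun j => by rw [integral_sin_eq_im_charFun (hY j), hχ]) (ε := t / √2) (by positivity)
  -- A complex deviation of size `t` forces the real or the imaginary part to deviate by `t / √2`,
  -- which halves the exponent.
  have he : n * (t / √2) ^ 2 / 2 = n * t ^ 2 / 4 := by
    rw [div_pow, Real.sq_sqrt (by norm_num)]
    ring
  rw [he] at h1 h2
  have hset : {ω | t ≤ ‖empCharFun (fun j => Y j ω) u - χ u‖}
      ⊆ {ω | t / √2 ≤ |(n : ℝ)⁻¹ * ∑ j, Real.cos (u * Y j ω) - (χ u).re|}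
        ∪ {ω | t / √2 ≤ |(n : ℝ)⁻¹ * ∑ j, Real.sin (u * Y j ω) - (χ u).im|} := by
    intro ω hω
    simp only [mem_ofPred_eq, mem_union] at hω ⊢
    rw [← empCharFun_re (fun j => Y j ω), ← empCharFun_im (fun j => Y j ω), ← Complex.sub_re,
      ← Complex.sub_im]
    by_contra! hcon
    have hs : (t / √2) ^ 2 = t ^ 2 / 2 := by rw [div_pow, Real.sq_sqrt (by norm_num)]
    have ha := pow_lt_pow_left₀ hcon.1 (abs_nonneg _) two_ne_zero
    have hb := pow_lt_pow_left₀ hcon.2 (abs_nonneg _) two_ne_zero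
    rw [sq_abs, hs] at ha hb
    have hsq := pow_le_pow_left₀ ht hω 2
    rw [← Complex.normSq_eq_norm_sq, Complex.normSq_apply] at hsq
    nlinarith
  refine (measureReal_mono hset).trans ((measureReal_union_le _ _).trans ?_)
  linarith

/-- Variance of the empirical characteristic function. -/
theorem lintegral_empCharFun_sub_sq [IsProbabilityMeasure P] {n : ℕ} (hn : 0 < n)
    {Y : Fin n → Ω → ℝ} (hY : ∀ j, Measurable (Y j)) (hind : iIndepFun Y P) {χ : ℝ → ℂ}
    (hχ : ∀ j, charFun (P.map (Y j)) = χ) (u : ℝ) :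
    ∫⁻ ω, ‖empCharFun (fun j => Y j ω) u - χ u‖ₑ ^ 2 ∂P
      = ENNReal.ofReal ((1 - ‖χ u‖ ^ 2) / n) := by
  set j₀ : Fin n := ⟨0, hn⟩
  have hmap (g : ℝ → ℝ) (hg : Measurable g) (j : Fin n) :
      ∫ ω, g (Y j ω) ∂P = ∫ ω, g (Y j₀ ω) ∂P := by
    have : P.map (Y j) = P.map (Y j₀) := by
      have := Measure.isProbabilityMeasure_map (μ := P) (hY j).aemeasurable
      have := Measure.isProbabilityMeasure_map (μ := P) (hY j₀).aemeasurable
      exact Measure.ext_of_charFun (by rw [hχ, hχ])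
    rw [← integral_map (hY j).aemeasurable hg.aestronglyMeasurable, this,
      integral_map (hY j₀).aemeasurable hg.aestronglyMeasurable]
  have h1 := integral_mean_sub_sq hn hY hind (g := fun x => Real.cos (u * x))
    (by fun_prop) (fun x => Real.abs_cos_le_one _) (c := (χ u).re)
    (fun j => by rw [integral_cos_eq_re_charFun (hY j), hχ])
    (hmap (fun x => Real.cos (u * x) ^ 2) (by fun_prop))
  have h2 := integral_mean_sub_sq hn hY hind (g := fun x => Real.sin (u * x))
    (by fun_prop) (fun x => Real.abs_sin_le_one _) (c := (χ u).im)
    (fun j => by rw [integral_sin_eq_im_charFun (hY j), hχ])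
    (hmap (fun x => Real.sin (u * x) ^ 2) (by fun_prop))
  have hbd (g : ℝ → ℝ) (hg : Measurable g) (hg1 : ∀ x, |g x| ≤ 1) (c : ℝ) :
      Integrable (fun ω => ((n : ℝ)⁻¹ * ∑ j, g (Y j ω) - c) ^ 2) P := by
    have hn' : (0 : ℝ) < n := by exact_mod_cast hn
    have hm : Measurable fun ω => ((n : ℝ)⁻¹ * ∑ j, g (Y j ω) - c) ^ 2 :=
      (((Finset.measurable_sum _ fun j _ => hg.comp (hY j)).const_mul _).sub_const _).pow_const _
    refine Integrable.of_bound hm.aestronglyMeasurable ((1 + |c|) ^ 2) (ae_of_all _ fun ω => ?_)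
    rw [Real.norm_of_nonneg (sq_nonneg _), ← sq_abs]
    refine pow_le_pow_left₀ (abs_nonneg _) ((abs_sub _ _).trans ?_) 2
    gcongr
    rw [abs_mul, abs_of_pos (inv_pos.2 hn'), inv_mul_le_iff₀ hn', mul_one]
    refine (Finset.abs_sum_le_sum_abs _ _).trans ((Finset.sum_le_sum fun j _ => hg1 _).trans ?_)
    simp
  have i1 := hbd (fun x => Real.cos (u * x)) (by fun_prop) (fun x => Real.abs_cos_le_one _)
    (χ u).re
  have i2 := hbd (fun x => Real.sin (u * x)) (by fun_prop) (fun x => Real.abs_sin_le_one _)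
    (χ u).im
  have hpt (ω : Ω) : ‖empCharFun (fun j => Y j ω) u - χ u‖ₑ ^ 2
      = ENNReal.ofReal (((n : ℝ)⁻¹ * ∑ j, Real.cos (u * Y j ω) - (χ u).re) ^ 2
        + ((n : ℝ)⁻¹ * ∑ j, Real.sin (u * Y j ω) - (χ u).im) ^ 2) := by
    rw [← ofReal_norm, ← ENNReal.ofReal_pow (norm_nonneg _), ← Complex.normSq_eq_norm_sq,
      Complex.normSq_apply, Complex.sub_re, Complex.sub_im, empCharFun_re, empCharFun_im]
    congr 1
    ring
  simp only [hpt]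
  refine (ofReal_integral_eq_lintegral_ofReal (i1.add i2) (ae_of_all _ fun ω => by
    simp only [Pi.zero_apply, Pi.add_apply]; positivity)).symm.trans ?_
  simp only [Pi.add_apply]
  rw [integral_add i1 i2, h1, h2]
  congr 1
  -- The second moments of cosine and sine add up to `1`, whatever the law; only `1 - |χ|²`
  -- survives.
  have hcs : ∫ ω, Real.cos (u * Y j₀ ω) ^ 2 ∂P + ∫ ω, Real.sin (u * Y j₀ ω) ^ 2 ∂P = 1 := by
    rw [← integral_add]
    · simp
    · exact Integrable.of_bound (by fun_prop) 1 (ae_of_all _ fun ω => by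
        rw [Real.norm_of_nonneg (by positivity)]; exact Real.cos_sq_le_one _)
    · exact Integrable.of_bound (by fun_prop) 1 (ae_of_all _ fun ω => by
        rw [Real.norm_of_nonneg (by positivity)]; exact Real.sin_sq_le_one _)
  rw [← Complex.normSq_eq_norm_sq, Complex.normSq_apply, ← add_div]
  congr 1
  linarith

theorem norm_exp_I_mul_sub_le (a b y : ℝ) :
    ‖Complex.exp (Complex.I * a * y) - Complex.exp (Complex.I * b * y)‖ ≤ |a - b| * |y| := by
  have h : Complex.exp (Complex.I * a * y) - Complex.exp (Complex.I * b * y)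
      = Complex.exp ((b * y : ℝ) * Complex.I)
        * (Complex.exp (Complex.I * ((a - b) * y : ℝ)) - 1) := by
    rw [mul_sub, ← Complex.exp_add, mul_one]
    congr 2 <;> push_cast <;> ring
  rw [h, norm_mul, Complex.norm_exp_ofReal_mul_I, one_mul, ← abs_mul]
  exact Real.norm_exp_I_mul_ofReal_sub_one_le

theorem norm_empCharFun_sub_le {n : ℕ} (y : Fin n → ℝ) (a b : ℝ) :
    ‖empCharFun y a - empCharFun y b‖ ≤ |a - b| * ((n : ℝ)⁻¹ * ∑ j, |y j|) := by
  rw [empCharFun, empCharFun, ← mul_sub, ← Finset.sum_sub_distrib, norm_mul, norm_inv,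
    Complex.norm_natCast, mul_left_comm, Finset.mul_sum]
  gcongr
  exact (norm_sum_le _ _).trans (Finset.sum_le_sum fun j _ => norm_exp_I_mul_sub_le a b (y j))

theorem norm_charFun_sub_le [IsProbabilityMeasure P] {Y : Ω → ℝ} (hY : Measurable Y) {c : ℝ}
    (hc0 : 0 ≤ c) (hc : ∫⁻ ω, ‖Y ω‖ₑ ∂P ≤ ENNReal.ofReal c) (a b : ℝ) :
    ‖charFun (P.map Y) a - charFun (P.map Y) b‖ ≤ |a - b| * c := by
  have hint : Integrable Y P := ⟨hY.aestronglyMeasurable, hc.trans_lt ENNReal.ofReal_lt_top⟩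
  have hE : ∫ ω, |Y ω| ∂P ≤ c := by
    have := ofReal_integral_norm_eq_lintegral_enorm hint
    rw [← this] at hc
    exact (ENNReal.ofReal_le_ofReal_iff hc0).1 hc
  have hi (a : ℝ) : Integrable (fun ω => Complex.exp (a * Y ω * Complex.I)) P := by
    refine Integrable.of_bound (by fun_prop) 1 (ae_of_all _ fun ω => ?_)
    rw [← Complex.ofReal_mul, Complex.norm_exp_ofReal_mul_I]
  rw [charFun_apply_real, charFun_apply_real, integral_map hY.aemeasurable (by fun_prop),
    integral_map hY.aemeasurable (by fun_prop), ← integral_sub (hi a) (hi b)]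
  refine (norm_integral_le_integral_norm _).trans ?_
  calc _ ≤ ∫ ω, |a - b| * |Y ω| ∂P := by
        refine integral_mono ((hi a).sub (hi b)).norm (hint.abs.const_mul _) fun ω => ?_
        have := norm_exp_I_mul_sub_le a b (Y ω)
        rwa [show Complex.I * a * Y ω = a * Y ω * Complex.I by ring,
          show Complex.I * b * Y ω = b * Y ω * Complex.I by ring] at this
    _ = |a - b| * ∫ ω, |Y ω| ∂P := integral_const_mul _ _
    _ ≤ |a - b| * c := by gcongr

theorem measurable_empCharFun {n : ℕ} {Y : Fin n → Ω → ℝ} (hY : ∀ j, Measurable (Y j)) :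
    Measurable fun p : Ω × ℝ => empCharFun (fun j => Y j p.1) p.2 := by
  unfold empCharFun
  refine Measurable.const_mul (Finset.measurable_sum _ fun j _ => ?_) _
  have : Measurable fun p : Ω × ℝ => Y j p.1 := (hY j).comp measurable_fst
  fun_prop

/-- The empirical characteristic function is uniformly close to the characteristic function on a
compact interval, outside a measurable set of small probability. -/
theorem exists_measurableSet_empCharFun_sub_le [IsProbabilityMeasure P] {n : ℕ} (hn : 0 < n)
    {Y : Fin n → Ω → ℝ} (hY : ∀ j, Measurable (Y j)) (hind : iIndepFun Y P) {χ : ℝ → ℂ}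
    (hχ : ∀ j, charFun (P.map (Y j)) = χ) {c L U h s : ℝ} (hc0 : 0 ≤ c)
    (hc : ∀ j, ∫⁻ ω, ‖Y j ω‖ₑ ∂P ≤ ENNReal.ofReal c) (hcL : c ≤ L) (hL : 0 < L)
    (hh : 0 < h) (hs : 2 * L * h ≤ s / 2) (hs0 : 0 ≤ s) (hU : 0 ≤ U) :
    ∃ E : Set Ω, MeasurableSet E ∧
      P.real E ≤ c / L + (2 * (U / h + 1) + 1) * (4 * Real.exp (-(n * (s / 2) ^ 2 / 4))) ∧
      ∀ ω ∉ E, ∀ u, |u| ≤ U → ‖empCharFun (fun j => Y j ω) u - χ u‖ ≤ s := by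
  set M : ℕ := ⌈U / h⌉₊ with hM
  have hn' : (0 : ℝ) < n := by exact_mod_cast hn
  -- Exceptional set: either the Lipschitz constant of the empirical function exceeds `L` (Markov),
  -- or some point of the grid of spacing `h` deviates by `s / 2` (Hoeffding). Off it, moving to the
  -- nearest grid point on the left costs at most `2Lh ≤ s / 2`.
  set A : Set Ω := {ω | ENNReal.ofReal L ≤ ENNReal.ofReal ((n : ℝ)⁻¹ * ∑ j, |Y j ω|)} with hA
  set B : ℤ → Set Ω := fun k => {ω | s / 2 ≤ ‖empCharFun (fun j => Y j ω) (k * h) - χ (k * h)‖}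
    with hB
  have hmeanm : Measurable fun ω => (n : ℝ)⁻¹ * ∑ j, |Y j ω| :=
    (Finset.measurable_sum _ fun j _ => (hY j).abs).const_mul _
  have hAm : MeasurableSet A := measurableSet_le measurable_const hmeanm.ennreal_ofReal
  have hBm (k : ℤ) : MeasurableSet (B k) :=
    measurableSet_le measurable_const
      ((((measurable_empCharFun hY).comp measurable_prodMk_right).sub_const _).norm)
  have hmean : ∫⁻ ω, ENNReal.ofReal ((n : ℝ)⁻¹ * ∑ j, |Y j ω|) ∂P ≤ ENNReal.ofReal c := by
    have h1 (ω : Ω) : ENNReal.ofReal ((n : ℝ)⁻¹ * ∑ j, |Y j ω|)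
        = ENNReal.ofReal (n : ℝ)⁻¹ * ∑ j, ‖Y j ω‖ₑ := by
      rw [ENNReal.ofReal_mul (by positivity), ENNReal.ofReal_sum_of_nonneg fun j _ => abs_nonneg _]
      simp only [← Real.enorm_eq_ofReal_abs]
    simp only [h1]
    rw [lintegral_const_mul' _ _ ENNReal.ofReal_ne_top,
      lintegral_finsetSum _ fun j _ => (hY j).enorm]
    calc _ ≤ ENNReal.ofReal (n : ℝ)⁻¹ * ∑ _j : Fin n, ENNReal.ofReal c := by
          gcongr with j; exact hc j
      _ = ENNReal.ofReal c := by
          rw [Finset.sum_const, Finset.card_univ, Fintype.card_fin, nsmul_eq_mul, ← mul_assoc,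
            ← ENNReal.ofReal_natCast, ← ENNReal.ofReal_mul (by positivity),
            inv_mul_cancel₀ hn'.ne', ENNReal.ofReal_one, one_mul]
  have hPA : P.real A ≤ c / L := by
    have h1 := (mul_meas_ge_le_lintegral (μ := P) hmeanm.ennreal_ofReal (ENNReal.ofReal L)).trans
      hmean
    have h2 : P A ≤ ENNReal.ofReal (c / L) := by
      rw [ENNReal.ofReal_div_of_pos hL, ENNReal.le_div_iff_mul_le (by simp [hL]) (by simp),
        mul_comm]
      exact h1
    exact ENNReal.toReal_le_of_le_ofReal (by positivity) h2
  refine ⟨A ∪ ⋃ k ∈ Finset.Icc (-(M : ℤ)) M, B k,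
    hAm.union (Finset.measurableSet_biUnion _ fun k _ => hBm k), ?_, ?_⟩
  · refine (measureReal_union_le _ _).trans (add_le_add hPA ?_)
    refine (measureReal_biUnion_finset_le _ _).trans ?_
    have hPB (k : ℤ) : P.real (B k) ≤ 4 * Real.exp (-(n * (s / 2) ^ 2 / 4)) :=
      measureReal_empCharFun_sub_ge_le hn hY hind hχ (k * h) (by linarith)
    refine (Finset.sum_le_sum fun k _ => hPB k).trans ?_
    rw [Finset.sum_const, nsmul_eq_mul]
    gcongr
    rw [Int.card_Icc]
    have h1 : ((M : ℤ) + 1 - -(M : ℤ)).toNat = 2 * M + 1 := by omega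
    rw [h1]
    push_cast
    have h2 : (M : ℝ) < U / h + 1 := Nat.ceil_lt_add_one (by positivity)
    linarith
  · intro ω hω u hu
    rw [mem_union, not_or] at hω
    obtain ⟨hωA, hωB⟩ := hω
    have hmL : (n : ℝ)⁻¹ * ∑ j, |Y j ω| ≤ L := by
      by_contra hcon
      exact hωA (ENNReal.ofReal_le_ofReal (not_le.1 hcon).le)
    set k : ℤ := ⌊u / h⌋ with hk
    have hk1 : (k : ℝ) ≤ u / h := Int.floor_le _
    have hk2 : u / h < k + 1 := Int.lt_floor_add_one _
    have hUM : U / h ≤ M := Nat.le_ceil _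
    have habs := abs_le.1 hu
    have hlo : -(M : ℝ) ≤ u / h := by
      have : -(U / h) ≤ u / h := by rw [← neg_div]; gcongr; exact habs.1
      linarith
    have hhi : u / h ≤ M := le_trans (by gcongr; exact habs.2) hUM
    have hkM : k ∈ Finset.Icc (-(M : ℤ)) M := by
      rw [Finset.mem_Icc]
      refine ⟨Int.le_floor.2 (by push_cast; exact hlo), ?_⟩
      have : (k : ℝ) ≤ M := hk1.trans hhi
      exact_mod_cast this
    have hωk : ‖empCharFun (fun j => Y j ω) (k * h) - χ (k * h)‖ < s / 2 := by
      by_contra hcon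
      exact hωB (mem_biUnion (Finset.mem_coe.2 hkM) (not_lt.1 hcon))
    have hdist : |u - k * h| ≤ h := by
      rw [le_div_iff₀ hh] at hk1
      rw [div_lt_iff₀ hh] at hk2
      rw [abs_le]
      constructor <;> linarith
    have e1 : ‖empCharFun (fun j => Y j ω) u - empCharFun (fun j => Y j ω) (k * h)‖ ≤ h * L :=
      (norm_empCharFun_sub_le _ _ _).trans (by gcongr)
    have e2 : ‖χ u - χ (k * h)‖ ≤ h * L := by
      rw [← hχ ⟨0, hn⟩]
      exact (norm_charFun_sub_le (hY _) hc0 (hc _) _ _).trans (by gcongr)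
    calc ‖empCharFun (fun j => Y j ω) u - χ u‖
        = ‖(empCharFun (fun j => Y j ω) u - empCharFun (fun j => Y j ω) (k * h))
          + (empCharFun (fun j => Y j ω) (k * h) - χ (k * h)) - (χ u - χ (k * h))‖ := by
          congr 1; ring
      _ ≤ h * L + s / 2 + h * L := by
          refine (norm_sub_le _ _).trans (add_le_add ((norm_add_le _ _).trans ?_) e2)
          exact add_le_add e1 hωk.le
      _ ≤ s := by linarith

end empirical

/-! ### Measurability and elementary bounds for the estimators and the cutoff -/

section measurability

variable {n : ℕ} (y : Fin n → ℝ)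

theorem hasDerivAt_empCharFun (u : ℝ) :
    HasDerivAt (empCharFun y) (empCharFunDeriv y u) u := by
  have h (j : Fin n) : HasDerivAt (fun u : ℝ => Complex.exp (Complex.I * u * y j))
      (Complex.I * y j * Complex.exp (Complex.I * u * y j)) u := by
    have h1 : HasDerivAt (fun u : ℝ => Complex.I * u * y j) (Complex.I * 1 * y j) u :=
      ((Complex.ofRealCLM.hasDerivAt (x := u)).const_mul _).mul_const _
    convert h1.cexp using 1
    ring
  exact (HasDerivAt.fun_sum fun j _ => h j).const_mul _

theorem continuous_empCharFun : Continuous (empCharFun y) := by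
  unfold empCharFun
  fun_prop

theorem continuous_empCharFunDeriv : Continuous (empCharFunDeriv y) := by
  unfold empCharFunDeriv
  fun_prop

theorem empCharFun_zero (hn : n ≠ 0) : empCharFun y 0 = 1 := by
  simp [empCharFun, hn]

theorem empCharFun_neg (u : ℝ) : empCharFun y (-u) = starRingEnd ℂ (empCharFun y u) := by
  simp only [empCharFun, map_mul, map_inv₀, map_natCast, map_sum, ← Complex.exp_conj,
    Complex.conj_I, Complex.conj_ofReal]
  simp

/-- No integrability is assumed, since the logarithmic derivative may blow up at zeros; hence
parametrised integrals are used instead of continuity of the primitive. -/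
theorem measurable_primitive {h : ℝ → ℂ} (hh : Measurable h) :
    Measurable fun u : ℝ => ∫ z in (0 : ℝ)..u, h z := by
  have key (s : Set (ℝ × ℝ)) (hs : MeasurableSet s) :
      Measurable fun u : ℝ => ∫ z, s.indicator (fun p => h p.2) (u, z) :=
    (((hh.comp measurable_snd).indicator hs).stronglyMeasurable.integral_prod_right').measurable
  have h1 := key {p | 0 < p.2 ∧ p.2 ≤ p.1} ((measurableSet_lt measurable_const
    measurable_snd).inter (measurableSet_le measurable_snd measurable_fst))
  have h2 := key {p | p.1 < p.2 ∧ p.2 ≤ 0} ((measurableSet_lt measurable_fst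
    measurable_snd).inter (measurableSet_le measurable_snd measurable_const))
  convert h1.sub h2 using 2 with u
  rw [intervalIntegral, ← integral_indicator measurableSet_Ioc,
    ← integral_indicator measurableSet_Ioc]
  rfl

theorem measurable_phiHat (Δ : ℝ) : Measurable (phiHat Δ y) := by
  have : Measurable (empLog y) := measurable_primitive
    ((continuous_empCharFunDeriv y).measurable.div (continuous_empCharFun y).measurable)
  exact (this.const_mul _).const_add _

theorem measurable_phiTilde (Δ : ℝ) : Measurable (phiTilde Δ y) := by
  classical
  -- The frequencies reachable from `0` without meeting a zero form an interval.
  have hS : MeasurableSet {u : ℝ | ∀ z ∈ uIcc 0 u, empCharFun y z ≠ 0} := by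
    apply OrdConnected.measurableSet
    refine ⟨fun a ha b hb u hu z hz => ?_⟩
    rcases le_total 0 u with h0 | h0
    · rw [uIcc_of_le h0] at hz
      refine hb z ?_
      rw [uIcc_of_le (h0.trans hu.2)]
      exact ⟨hz.1, hz.2.trans hu.2⟩
    · rw [uIcc_of_ge h0] at hz
      refine ha z ?_
      rw [uIcc_of_ge (hu.1.trans h0)]
      exact ⟨hu.1.trans hz.1, hz.2⟩
  unfold phiTilde
  exact Measurable.ite (hS.inter (measurableSet_le (measurable_phiHat y Δ).norm measurable_const))
    (measurable_phiHat y Δ) measurable_const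

theorem measurable_phiBar (Δ κ : ℝ) : Measurable (phiBar Δ κ y) := by
  classical
  unfold phiBar
  exact Measurable.ite (measurableSet_le measurable_const (measurable_phiTilde y Δ).norm)
    (measurable_phiTilde y Δ) measurable_const

theorem norm_phiTilde_le (Δ u : ℝ) : ‖phiTilde Δ y u‖ ≤ 4 := by
  unfold phiTilde
  split_ifs with h
  · exact h.2
  · simp

theorem norm_phiBar_le (Δ κ u : ℝ) : ‖phiBar Δ κ y u‖ ≤ 4 := by
  unfold phiBar
  split_ifs with h
  · exact norm_phiTilde_le y Δ u
  · simp

theorem mHat_le (Δ κ α : ℝ) : mHat Δ κ α y ≤ (n * Δ) ^ α := by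
  unfold mHat
  split_ifs
  · exact min_le_right _ _
  · exact le_rfl

theorem mHat_nonneg {Δ : ℝ} (hΔ : 0 ≤ Δ) (κ α : ℝ) : 0 ≤ mHat Δ κ α y := by
  have h0 : 0 ≤ (n * Δ) ^ α := by positivity
  unfold mHat
  split_ifs
  · exact le_min (Real.sSup_nonneg fun x hx => hx.1) h0
  · exact h0

/-- In the default branch the cutoff equals `(nΔ)^α`; strict inequality rules this out and
identifies the cutoff with the supremum of the crossings. -/
theorem le_mHat_of_mem_crossings {Δ κ α : ℝ} (h : mHat Δ κ α y < (n * Δ) ^ α) {u : ℝ}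
    (hu : u ∈ crossings Δ κ y) : u ≤ mHat Δ κ α y := by
  unfold mHat at h ⊢
  split_ifs at h ⊢ with hc
  · rcases min_lt_iff.1 h with h' | h'
    · rw [min_eq_left h'.le]
      exact le_csSup hc.2 hu
    · exact absurd h' (lt_irrefl _)
  · exact absurd h (lt_irrefl _)

end measurability

/-! ### Error bounds for samples close to their characteristic function -/

/-- The empirical characteristic function of a sample is relatively close to
`u ↦ exp (Δ (φ u - 1))` on `[-U, U]`. -/
structure IsClose {n : ℕ} (y : Fin n → ℝ) (φ : ℝ → ℂ) (Δ U : ℝ) : Prop where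
  small : ∀ u, |u| ≤ U → ‖empCharFun y u - Complex.exp (Δ * (φ u - 1))‖
    ≤ 1 / 100 * ‖Complex.exp (Δ * (φ u - 1))‖
  small' : ∀ u, |u| ≤ U → ‖empCharFun y u - Complex.exp (Δ * (φ u - 1))‖
    ≤ Δ * ‖Complex.exp (Δ * (φ u - 1))‖

theorem abs_le_abs_of_mem_uIcc {u z : ℝ} (hz : z ∈ uIcc 0 u) : |z| ≤ |u| := by
  simpa using abs_sub_left_of_mem_uIcc hz

section close

variable {n : ℕ} {y : Fin n → ℝ} {φ : ℝ → ℂ} {Δ U : ℝ}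

theorem IsClose.ne_zero (h : IsClose y φ Δ U) {u : ℝ} (hu : |u| ≤ U) : empCharFun y u ≠ 0 := by
  intro h0
  have h1 := h.small u hu
  have h2 : 0 < ‖Complex.exp (Δ * (φ u - 1))‖ := norm_pos_iff.2 (Complex.exp_ne_zero _)
  rw [h0, zero_sub, norm_neg] at h1
  linarith

theorem IsClose.norm_ratio_sub_one_le (h : IsClose y φ Δ U) {u : ℝ} (hu : |u| ≤ U) :
    ‖empCharFun y u / Complex.exp (Δ * (φ u - 1)) - 1‖ ≤ 1 / 100 := by
  have h2 : 0 < ‖Complex.exp (Δ * (φ u - 1))‖ := norm_pos_iff.2 (Complex.exp_ne_zero _)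
  rw [div_sub_one (Complex.exp_ne_zero _), norm_div, div_le_iff₀ h2]
  exact h.small u hu

/-- The distinguished logarithm of the empirical characteristic function is the exponent of the
true one, corrected by the principal logarithm of the ratio. -/
theorem IsClose.phiHat_eq (h : IsClose y φ Δ U) (hn : n ≠ 0) (hΔ : 0 < Δ) (hφ : ContDiff ℝ 1 φ)
    (hφ0 : φ 0 = 1) {u : ℝ} (hu : |u| ≤ U) :
    phiHat Δ y u = φ u
      + (Δ : ℂ)⁻¹ * Complex.log (empCharFun y u / Complex.exp (Δ * (φ u - 1))) := by
  have hmem {z : ℝ} (hz : z ∈ uIcc 0 u) : |z| ≤ U := (abs_le_abs_of_mem_uIcc hz).trans hu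
  have hderiv : ∀ z ∈ uIcc 0 u, HasDerivAt
      (fun z => Δ * (φ z - 1) + Complex.log (empCharFun y z / Complex.exp (Δ * (φ z - 1))))
      (empCharFunDeriv y z / empCharFun y z) z := by
    intro z hz
    have hφz : HasDerivAt φ (deriv φ z) z :=
      (hφ.differentiable (by norm_num)).differentiableAt.hasDerivAt
    have h1 : HasDerivAt (fun z => (Δ : ℂ) * (φ z - 1)) (Δ * deriv φ z) z :=
      (hφz.sub_const 1).const_mul _
    have h2 := (hasDerivAt_empCharFun y z).div h1.cexp (Complex.exp_ne_zero _)
    -- The ratio stays in the disc of radius `1/100` around `1`, away from the branch cut of the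
    -- principal logarithm.
    have hslit : empCharFun y z / Complex.exp (Δ * (φ z - 1)) ∈ Complex.slitPlane := by
      have hr := h.norm_ratio_sub_one_le (hmem hz)
      have hre := (Complex.abs_re_le_norm _).trans hr
      rw [Complex.sub_re, Complex.one_re] at hre
      left
      linarith [(abs_le.1 hre).1]
    have h3 := h1.add (h2.clog_real hslit)
    have hne := h.ne_zero (hmem hz)
    have hexp := Complex.exp_ne_zero ((Δ : ℂ) * (φ z - 1))
    refine HasDerivAt.congr_deriv h3 ?_
    simp only [Pi.div_apply]
    field_simp
    ring
  have hcont : ContinuousOn (fun z => empCharFunDeriv y z / empCharFun y z) (uIcc 0 u) :=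
    (continuous_empCharFunDeriv y).continuousOn.div (continuous_empCharFun y).continuousOn
      fun z hz => h.ne_zero (hmem hz)
  have hint := intervalIntegral.integral_eq_sub_of_hasDerivAt hderiv hcont.intervalIntegrable
  have hΔ' : (Δ : ℂ) ≠ 0 := by exact_mod_cast hΔ.ne'
  rw [phiHat, empLog, hint, hφ0, empCharFun_zero y hn]
  simp only [sub_self, mul_zero, Complex.exp_zero, div_one, Complex.log_one, add_zero, sub_zero]
  field_simp
  ring

/-- With `w` the ratio minus `1`, `|log(1+w)| ≤ |w| + |w|² ≤ 1.01 |w|` because `|w| ≤ 1/100`. -/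
theorem IsClose.norm_phiHat_sub_le (h : IsClose y φ Δ U) (hn : n ≠ 0) (hΔ : 0 < Δ)
    (hφ : ContDiff ℝ 1 φ) (hφ0 : φ 0 = 1) {u : ℝ} (hu : |u| ≤ U) :
    ‖phiHat Δ y u - φ u‖ ≤ 101 / 100 * ‖empCharFun y u - Complex.exp (Δ * (φ u - 1))‖
      / (Δ * ‖Complex.exp (Δ * (φ u - 1))‖) := by
  set w := empCharFun y u / Complex.exp (Δ * (φ u - 1)) - 1 with hw
  have hwn : ‖w‖ = ‖empCharFun y u - Complex.exp (Δ * (φ u - 1))‖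
      / ‖Complex.exp (Δ * (φ u - 1))‖ := by
    rw [hw, div_sub_one (Complex.exp_ne_zero _), norm_div]
  have hw1 : ‖w‖ ≤ 1 / 100 := h.norm_ratio_sub_one_le hu
  have hlog : ‖Complex.log (1 + w)‖ ≤ 101 / 100 * ‖w‖ := by
    refine (Complex.norm_log_one_add_le (by linarith)).trans ?_
    have h1 : (1 - ‖w‖)⁻¹ ≤ 2 := by
      rw [inv_le_comm₀ (by linarith) (by norm_num)]
      linarith
    have h2 : ‖w‖ ^ 2 * (1 - ‖w‖)⁻¹ / 2 ≤ ‖w‖ ^ 2 * 2 / 2 := by gcongr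
    nlinarith [norm_nonneg w]
  rw [h.phiHat_eq hn hΔ hφ hφ0 hu, add_sub_cancel_left, norm_mul, norm_inv, Complex.norm_real,
    Real.norm_of_nonneg hΔ.le, show empCharFun y u / Complex.exp (Δ * (φ u - 1)) = 1 + w by
      rw [hw]; ring]
  have he : 101 / 100 * ‖empCharFun y u - Complex.exp (Δ * (φ u - 1))‖
      / (Δ * ‖Complex.exp (Δ * (φ u - 1))‖) = Δ⁻¹ * (101 / 100 * ‖w‖) := by
    rw [hwn]
    field_simp
  rw [he]
  gcongr

/-- The bound `small'`, relative to `Δ`, absorbs the factor `Δ⁻¹` of the estimator: its modulus is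
at most `1 + 1.01`, below the truncation level `4`. -/
theorem IsClose.phiTilde_eq (h : IsClose y φ Δ U) (hn : n ≠ 0) (hΔ : 0 < Δ)
    (hφ : ContDiff ℝ 1 φ) (hφ0 : φ 0 = 1) (hφ1 : ∀ u, ‖φ u‖ ≤ 1) {u : ℝ} (hu : |u| ≤ U) :
    phiTilde Δ y u = phiHat Δ y u := by
  unfold phiTilde
  rw [if_pos]
  refine ⟨fun z hz => h.ne_zero ((abs_le_abs_of_mem_uIcc hz).trans hu), ?_⟩
  · have h1 := h.norm_phiHat_sub_le hn hΔ hφ hφ0 hu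
    have hpos : 0 < ‖Complex.exp (Δ * (φ u - 1))‖ := norm_pos_iff.2 (Complex.exp_ne_zero _)
    have h2 : 101 / 100 * ‖empCharFun y u - Complex.exp (Δ * (φ u - 1))‖
        / (Δ * ‖Complex.exp (Δ * (φ u - 1))‖) ≤ 101 / 100 := by
      rw [div_le_iff₀ (by positivity)]
      linarith [h.small' u hu]
    have h3 := norm_le_norm_add_norm_sub (φ u) (phiHat Δ y u)
    rw [norm_sub_rev] at h3
    linarith [hφ1 u]

theorem IsClose.continuousOn_phiHat (h : IsClose y φ Δ U) :
    ContinuousOn (phiHat Δ y) (Icc 0 U) := by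
  rcases le_or_gt 0 U with hU | hU
  · have hcont : ContinuousOn (fun z => empCharFunDeriv y z / empCharFun y z) (uIcc 0 U) := by
      rw [uIcc_of_le hU]
      exact (continuous_empCharFunDeriv y).continuousOn.div (continuous_empCharFun y).continuousOn
        fun z hz => h.ne_zero (by rw [abs_of_nonneg hz.1]; exact hz.2)
    have := intervalIntegral.continuousOn_primitive_interval (μ := volume)
      hcont.integrableOn_uIcc
    rw [uIcc_of_le hU] at this
    exact continuousOn_const.add (continuousOn_const.mul this)
  · simp [Icc_eq_empty (not_le.2 hU)]

/-- Beyond the empirical cutoff the estimator stays on one side of the threshold. -/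
theorem IsClose.dichotomy (h : IsClose y φ Δ U) (hn : n ≠ 0) (hΔ : 0 < Δ)
    (hφ : ContDiff ℝ 1 φ) (hφ0 : φ 0 = 1) (hφ1 : ∀ u, ‖φ u‖ ≤ 1) {κ α : ℝ}
    (hm : mHat Δ κ α y < (n * Δ) ^ α) :
    (∀ u ∈ Ioc (mHat Δ κ α y) U, ‖phiHat Δ y u‖ < level n Δ κ) ∨
      ∀ u ∈ Ioc (mHat Δ κ α y) U, level n Δ κ < ‖phiHat Δ y u‖ := by
  have h0 := mHat_nonneg y hΔ.le κ α
  have hsub : Ioc (mHat Δ κ α y) U ⊆ Icc 0 U := fun u hu => ⟨h0.trans hu.1.le, hu.2⟩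
  have hne : ∀ u ∈ Ioc (mHat Δ κ α y) U, ‖phiHat Δ y u‖ ≠ level n Δ κ := by
    intro u hu he
    have hu0 : 0 ≤ u := (hsub hu).1
    have ht := h.phiTilde_eq hn hΔ hφ hφ0 hφ1 (u := u) (by rw [abs_of_nonneg hu0]; exact hu.2)
    -- The thresholding in `phiBar` keeps values of modulus exactly equal to the level, so `u`
    -- counts as a crossing.
    have hcr : u ∈ crossings Δ κ y := by
      refine ⟨hu0, ?_⟩
      rw [phiBar, ht, if_pos he.ge, he]
    exact absurd (le_mHat_of_mem_crossings y hm hcr) (not_le.2 hu.1)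
  have hc : ContinuousOn (fun u => ‖phiHat Δ y u‖) (Ioc (mHat Δ κ α y) U) :=
    (h.continuousOn_phiHat.mono hsub).norm
  by_contra hcon
  push Not at hcon
  obtain ⟨⟨u, hu, hu'⟩, v, hv, hv'⟩ := hcon
  obtain ⟨w, hw, hw'⟩ := (isPreconnected_Ioc.intermediate_value hv hu hc) ⟨hv', hu'⟩
  exact hne w hw hw'

theorem norm_exp_eq (φ : ℝ → ℂ) (Δ u : ℝ) :
    ‖Complex.exp (Δ * (φ u - 1))‖ = Real.exp (Δ * ((φ u).re - 1)) := by
  rw [Complex.norm_exp, Complex.re_ofReal_mul, Complex.sub_re, Complex.one_re]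

/-- Crossings are sought at nonnegative frequencies only; Hermitian symmetry transfers the estimates
to negative ones. -/
theorem norm_empCharFun_sub_abs (hφn : ∀ u, φ (-u) = starRingEnd ℂ (φ u)) (u : ℝ) :
    ‖empCharFun y |u| - Complex.exp (Δ * (φ |u| - 1))‖
      = ‖empCharFun y u - Complex.exp (Δ * (φ u - 1))‖ := by
  rcases abs_choice u with h | h
  · rw [h]
  · rw [h, empCharFun_neg, hφn, ← Complex.norm_conj (empCharFun y u - _), map_sub,
      ← Complex.exp_conj, map_mul, map_sub, map_one, Complex.conj_ofReal]

/-- The error of the estimator at frequency `u`, in the Fourier domain. -/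
def fourierError {n : ℕ} (Δ κ α : ℝ) (y : Fin n → ℝ) (φ : ℝ → ℂ) (u : ℝ) : ℝ :=
  ‖(Ioc (-mHat Δ κ α y) (mHat Δ κ α y)).indicator (phiBar Δ κ y) u - φ u‖

theorem fourierError_le_five (hφ1 : ∀ u, ‖φ u‖ ≤ 1) (κ α u : ℝ) :
    fourierError Δ κ α y φ u ≤ 5 := by
  refine (norm_sub_le _ _).trans ?_
  have h1 : ‖(Ioc (-mHat Δ κ α y) (mHat Δ κ α y)).indicator (phiBar Δ κ y) u‖ ≤ 4 :=
    (norm_indicator_le_norm_self _ _).trans (norm_phiBar_le _ _ _ _)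
  linarith [hφ1 u]

theorem fourierError_eq_of_lt (κ α : ℝ) {u : ℝ} (hu : (n * Δ) ^ α < |u|) :
    fourierError Δ κ α y φ u = ‖φ u‖ := by
  rw [fourierError, indicator_of_notMem, zero_sub, norm_neg]
  intro hmem
  have := abs_le.2 ⟨hmem.1.le, hmem.2⟩
  linarith [mHat_le y Δ κ α]

/-- Either the estimator vanishes, or its modulus is above the threshold. -/
theorem IsClose.fourierError_cases (h : IsClose y φ Δ U) (hn : n ≠ 0) (hΔ : 0 < Δ)
    (hφ : ContDiff ℝ 1 φ) (hφ0 : φ 0 = 1) (hφ1 : ∀ u, ‖φ u‖ ≤ 1) (κ α : ℝ) {u : ℝ}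
    (hu : |u| ≤ U) :
    fourierError Δ κ α y φ u = ‖φ u‖ ∨ (level n Δ κ ≤ ‖phiHat Δ y u‖ ∧
      fourierError Δ κ α y φ u = ‖phiHat Δ y u - φ u‖) := by
  by_cases hmem : u ∈ Ioc (-mHat Δ κ α y) (mHat Δ κ α y)
  · rw [fourierError, indicator_of_mem hmem, phiBar, h.phiTilde_eq hn hΔ hφ hφ0 hφ1 hu]
    split_ifs with hl
    · exact Or.inr ⟨hl, rfl⟩
    · left
      rw [zero_sub, norm_neg]
  · left
    rw [fourierError, indicator_of_notMem hmem, zero_sub, norm_neg]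

/-- Away from the endpoints of the cutoff the error is controlled by the threshold and the
deviation, unless the estimator exceeds the threshold all the way up to `U`. -/
theorem IsClose.fourierError_le (h : IsClose y φ Δ U) (hn : n ≠ 0) (hΔ : 0 < Δ)
    (hφ : ContDiff ℝ 1 φ) (hφ0 : φ 0 = 1) (hφ1 : ∀ u, ‖φ u‖ ≤ 1)
    (hφn : ∀ u, φ (-u) = starRingEnd ℂ (φ u)) {κ α : ℝ} (hlevel : 0 ≤ level n Δ κ)
    (haU : (n * Δ) ^ α ≤ U) {u : ℝ} (hu : |u| ≤ (n * Δ) ^ α)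
    (hne : |u| ≠ mHat Δ κ α y) :
    fourierError Δ κ α y φ u ≤ level n Δ κ
        + 101 / 100 * ‖empCharFun y u - Complex.exp (Δ * (φ u - 1))‖
          / (Δ * ‖Complex.exp (Δ * (φ u - 1))‖) ∨
      (fourierError Δ κ α y φ u ≤ 1 ∧
        ∀ v, (n * Δ) ^ α ≤ v → v ≤ U → level n Δ κ < ‖phiHat Δ y v‖) := by
  have huU := hu.trans haU
  have hR := h.norm_phiHat_sub_le hn hΔ hφ hφ0 huU
  by_cases hmem : u ∈ Ioc (-mHat Δ κ α y) (mHat Δ κ α y)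
  · left
    rw [fourierError, indicator_of_mem hmem, phiBar, h.phiTilde_eq hn hΔ hφ hφ0 hφ1 huU]
    split_ifs with hl
    · linarith
    · have h3 := norm_le_norm_add_norm_sub (phiHat Δ y u) (φ u)
      rw [zero_sub, norm_neg]
      linarith [not_le.1 hl]
  · have he : fourierError Δ κ α y φ u = ‖φ u‖ := by
      rw [fourierError, indicator_of_notMem hmem, zero_sub, norm_neg]
    -- The half-open interval omits its left endpoint, so `u` outside it gives only `mHat ≤ |u|`;
    -- `hne` makes this strict.
    have hlt : mHat Δ κ α y < |u| := by
      refine lt_of_le_of_ne ?_ hne.symm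
      by_contra hcon
      push Not at hcon
      exact hmem ⟨(abs_lt.1 hcon).1, (abs_lt.1 hcon).2.le⟩
    rcases h.dichotomy hn hΔ hφ hφ0 hφ1 (hlt.trans_le hu) with hd | hd
    · left
      have habs : |(|u|)| ≤ U := by rwa [abs_abs]
      have h1 := hd |u| ⟨hlt, huU⟩
      have h2 := h.norm_phiHat_sub_le hn hΔ hφ hφ0 habs
      have hφabs : ‖φ |u|‖ = ‖φ u‖ ∧
          ‖Complex.exp (Δ * (φ |u| - 1))‖ = ‖Complex.exp (Δ * (φ u - 1))‖ := by
        rw [norm_exp_eq, norm_exp_eq]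
        rcases abs_choice u with h' | h' <;> rw [h']
        · exact ⟨rfl, rfl⟩
        · rw [hφn, Complex.norm_conj, Complex.conj_re]
          exact ⟨rfl, rfl⟩
      rw [norm_empCharFun_sub_abs hφn, hφabs.2] at h2
      have h3 := norm_le_norm_add_norm_sub (phiHat Δ y |u|) (φ |u|)
      rw [he, ← hφabs.1]
      linarith
    · right
      exact ⟨he ▸ hφ1 u, fun v hv hvU => hd v ⟨(hlt.trans_le hu).trans_le hv, hvU⟩⟩

/-- If the estimator exceeds the threshold where the target is much smaller, then the empirical
characteristic function has a large deviation. -/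
theorem IsClose.le_deviation (h : IsClose y φ Δ U) (hn : n ≠ 0) (hΔ : 0 < Δ)
    (hφ : ContDiff ℝ 1 φ) (hφ0 : φ 0 = 1) {ℓ : ℝ} (hΔℓ : Δ * ℓ ≤ 1)
    {u : ℝ} (hu : |u| ≤ U) (hφu : ‖φ u‖ ≤ ℓ / 100) (hl : ℓ ≤ ‖phiHat Δ y u‖) :
    9 / 10 * (Δ * Real.exp (-Δ) * ℓ) ≤ ‖empCharFun y u - Complex.exp (Δ * (φ u - 1))‖ := by
  have hR := h.norm_phiHat_sub_le hn hΔ hφ hφ0 hu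
  have h3 := norm_le_norm_add_norm_sub (φ u) (phiHat Δ y u)
  rw [norm_sub_rev] at h3
  have hℓ : 0 ≤ ℓ := by linarith [norm_nonneg (φ u)]
  have hpos : 0 < ‖Complex.exp (Δ * (φ u - 1))‖ := norm_pos_iff.2 (Complex.exp_ne_zero _)
  have h4 : 99 / 100 * ℓ ≤ 101 / 100 * ‖empCharFun y u - Complex.exp (Δ * (φ u - 1))‖
      / (Δ * ‖Complex.exp (Δ * (φ u - 1))‖) := by linarith
  rw [le_div_iff₀ (by positivity)] at h4
  -- Here `φ u` is nearly zero, so `|φ_Δ|` is about `e^{-Δ}`, much better than the general lower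
  -- bound `e^{-2Δ}`; this fixes the exponent of the final rate.
  have h5 : 99 / 100 * Real.exp (-Δ) ≤ ‖Complex.exp (Δ * (φ u - 1))‖ := by
    have hre := (abs_le.1 ((Complex.abs_re_le_norm (φ u)).trans hφu)).1
    have h6 : -Δ + -(1 / 100) ≤ Δ * ((φ u).re - 1) := by nlinarith
    have h7 : (99 : ℝ) / 100 ≤ Real.exp (-(1 / 100)) := by
      have := Real.add_one_le_exp (-(1 / 100) : ℝ)
      linarith
    rw [norm_exp_eq]
    calc 99 / 100 * Real.exp (-Δ) ≤ Real.exp (-(1 / 100)) * Real.exp (-Δ) := by gcongr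
      _ = Real.exp (-Δ + -(1 / 100)) := by rw [← Real.exp_add]; ring_nf
      _ ≤ _ := Real.exp_le_exp.2 h6
  have h8 : Δ * ℓ * (99 / 100 * Real.exp (-Δ)) ≤ Δ * ℓ * ‖Complex.exp (Δ * (φ u - 1))‖ := by
    gcongr
  have h9 : 0 ≤ Δ * ℓ * Real.exp (-Δ) := by positivity
  nlinarith

end close

/-! ### Integrated risk for a fixed oracle cutoff -/

/-- The energy of `φ` beyond the frequency `m`. -/
def tailEnergy (φ : ℝ → ℂ) (m : ℝ) : ℝ≥0∞ := ∫⁻ u in {u : ℝ | m < |u|}, ‖φ u‖ₑ ^ 2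

theorem measurableSet_abs_gt (m : ℝ) : MeasurableSet {u : ℝ | m < |u|} :=
  measurableSet_lt measurable_const measurable_id.abs

theorem tailEnergy_anti (φ : ℝ → ℂ) {m a : ℝ} (h : m ≤ a) : tailEnergy φ a ≤ tailEnergy φ m :=
  lintegral_mono_set fun _ hu => lt_of_le_of_lt h hu

/-- Applied to the long interval `[a, U]`, and near the origin, where `φ` is close to `1`. -/
theorem le_tailEnergy {φ : ℝ → ℂ} {m a b c : ℝ} (hma : m ≤ a) (ha : 0 ≤ a)
    (hc : 0 ≤ c) (h : ∀ u ∈ Ioc a b, c ≤ ‖φ u‖ ^ 2) :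
    ENNReal.ofReal ((b - a) * c) ≤ tailEnergy φ m := by
  calc ENNReal.ofReal ((b - a) * c) = ∫⁻ _u in Ioc a b, ENNReal.ofReal c := by
        rw [setLIntegral_const, Real.volume_Ioc, ← ENNReal.ofReal_mul hc, mul_comm]
    _ ≤ ∫⁻ u in Ioc a b, ‖φ u‖ₑ ^ 2 := by
        refine setLIntegral_mono' measurableSet_Ioc fun u hu => ?_
        rw [← ofReal_norm, ← ENNReal.ofReal_pow (norm_nonneg _)]
        exact ENNReal.ofReal_le_ofReal (h u hu)
    _ ≤ tailEnergy φ m := lintegral_mono_set fun u hu => by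
        have h0 : 0 ≤ u := ha.trans hu.1.le
        show m < |u|
        rw [abs_of_nonneg h0]
        exact hma.trans_lt hu.1

theorem lintegral_const_abs_le (a : ℝ) (c : ℝ≥0∞) :
    ∫⁻ u : ℝ, (if |u| ≤ a then c else 0) = ENNReal.ofReal (2 * a) * c := by
  have h : (fun u : ℝ => if |u| ≤ a then c else 0) = (Icc (-a) a).indicator fun _ => c := by
    ext u
    simp only [indicator, mem_Icc, abs_le]
  rw [h, lintegral_indicator measurableSet_Icc, setLIntegral_const, Real.volume_Icc, mul_comm]
  congr 2
  ring

/-- The bound for the error that holds for every sample. -/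
theorem lintegral_fourierError_sq_le {n : ℕ} (y : Fin n → ℝ) {φ : ℝ → ℂ} (hφm : Measurable φ)
    (hφ1 : ∀ u, ‖φ u‖ ≤ 1) {Δ : ℝ} (hΔ : 0 ≤ Δ) (κ α : ℝ) {m : ℝ} (hm : m ≤ (n * Δ) ^ α) :
    ∫⁻ u, ENNReal.ofReal (fourierError Δ κ α y φ u ^ 2)
      ≤ ENNReal.ofReal (50 * (n * Δ) ^ α) + tailEnergy φ m := by
  have ha : 0 ≤ (n * Δ) ^ α := by positivity
  calc ∫⁻ u, ENNReal.ofReal (fourierError Δ κ α y φ u ^ 2)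
      ≤ ∫⁻ u, ((if |u| ≤ (n * Δ) ^ α then ENNReal.ofReal 25 else 0)
          + {u : ℝ | (n * Δ) ^ α < |u|}.indicator (fun u => ‖φ u‖ₑ ^ 2) u) := by
        refine lintegral_mono fun u => ?_
        by_cases hu : |u| ≤ (n * Δ) ^ α
        · simp only [hu, if_true]
          refine le_add_right (ENNReal.ofReal_le_ofReal ?_)
          have := fourierError_le_five (y := y) (Δ := Δ) hφ1 κ α u
          have h0 : 0 ≤ fourierError Δ κ α y φ u := norm_nonneg _
          nlinarith
        · have hu' : u ∈ {u : ℝ | (n * Δ) ^ α < |u|} := not_le.1 hu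
          simp only [hu, if_false, zero_add, indicator_of_mem hu']
          rw [fourierError_eq_of_lt κ α (not_le.1 hu), ENNReal.ofReal_pow (norm_nonneg _),
            ofReal_norm]
    _ = ENNReal.ofReal (50 * (n * Δ) ^ α) + tailEnergy φ ((n * Δ) ^ α) := by
        rw [lintegral_add_right _ ((hφm.enorm.pow_const 2).indicator (measurableSet_abs_gt _)),
          lintegral_const_abs_le, lintegral_indicator (measurableSet_abs_gt _),
          ← ENNReal.ofReal_mul (by positivity), tailEnergy]
        congr 2
        ring
    _ ≤ _ := by gcongr; exact tailEnergy_anti φ hm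

/-- Second moment of the linearised error of the estimator. -/
theorem lintegral_linear_error_le [IsProbabilityMeasure P] {n : ℕ} (hn : 0 < n)
    {Y : Fin n → Ω → ℝ} (hY : ∀ j, Measurable (Y j)) (hind : iIndepFun Y P) {φ : ℝ → ℂ} {Δ : ℝ}
    (hΔ : 0 < Δ) (hφ1 : ∀ u, ‖φ u‖ ≤ 1)
    (hχ : ∀ j, charFun (P.map (Y j)) = fun u => Complex.exp (Δ * (φ u - 1))) (u : ℝ) :
    ∫⁻ ω, ENNReal.ofReal ((101 / 100 * ‖empCharFun (fun j => Y j ω) u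
        - Complex.exp (Δ * (φ u - 1))‖ / (Δ * ‖Complex.exp (Δ * (φ u - 1))‖)) ^ 2) ∂P
      ≤ ENNReal.ofReal (5 / (n * Δ * ‖Complex.exp (Δ * (φ u - 1))‖ ^ 2)) := by
  have hn' : (0 : ℝ) < n := by exact_mod_cast hn
  set X := ‖Complex.exp (Δ * (φ u - 1))‖ with hX
  have hpos : 0 < X := norm_pos_iff.2 (Complex.exp_ne_zero _)
  have hv := lintegral_empCharFun_sub_sq hn hY hind hχ u
  have hpt (ω : Ω) : ENNReal.ofReal ((101 / 100 * ‖empCharFun (fun j => Y j ω) u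
        - Complex.exp (Δ * (φ u - 1))‖ / (Δ * X)) ^ 2)
      = ENNReal.ofReal ((101 / 100) ^ 2 / (Δ * X) ^ 2) *
        ‖empCharFun (fun j => Y j ω) u - Complex.exp (Δ * (φ u - 1))‖ₑ ^ 2 := by
    rw [← ofReal_norm, ← ENNReal.ofReal_pow (norm_nonneg _),
      ← ENNReal.ofReal_mul (by positivity)]
    congr 1
    field_simp
  simp only [hpt]
  rw [lintegral_const_mul' _ _ ENNReal.ofReal_ne_top, hv, ← ENNReal.ofReal_mul (by positivity)]
  refine ENNReal.ofReal_le_ofReal ?_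
  -- For small `Δ` the increments are mostly zero: this factor `Δ` turns `1/(nΔ²)` into `1/(nΔ)`.
  have h1 : 1 - X ^ 2 ≤ 4 * Δ := by
    have hsq : X ^ 2 = Real.exp (2 * (Δ * ((φ u).re - 1))) := by
      rw [hX, norm_exp_eq, ← Real.exp_nat_mul]
      norm_num
    have h2 := Real.add_one_le_exp (2 * (Δ * ((φ u).re - 1)))
    have h3 := (abs_le.1 ((Complex.abs_re_le_norm (φ u)).trans (hφ1 u))).1
    rw [hsq]
    nlinarith
  rw [← hX]
  calc (101 / 100) ^ 2 / (Δ * X) ^ 2 * ((1 - X ^ 2) / n)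
      ≤ (101 / 100) ^ 2 / (Δ * X) ^ 2 * (4 * Δ / n) := by gcongr
    _ = ((101 / 100) ^ 2 * 4) / (n * Δ * X ^ 2) := by field_simp
    _ ≤ 5 / (n * Δ * X ^ 2) := by gcongr; norm_num

/-- The event that the estimator exceeds the threshold `ℓ` on the whole of `[a, U]` is unlikely,
unless the target has much energy there. -/
theorem exists_indicator_bound [IsProbabilityMeasure P] {n : ℕ} (hn : 0 < n)
    {Y : Fin n → Ω → ℝ} (hY : ∀ j, Measurable (Y j)) (hind : iIndepFun Y P) {φ : ℝ → ℂ} {Δ : ℝ}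
    (hΔ : 0 < Δ) (hφ : ContDiff ℝ 1 φ) (hφ0 : φ 0 = 1)
    (hχ : ∀ j, charFun (P.map (Y j)) = fun u => Complex.exp (Δ * (φ u - 1)))
    {ℓ a U m ρ : ℝ} (hℓ : 0 < ℓ) (hΔℓ : Δ * ℓ ≤ 1) (hm0 : 0 ≤ m) (hma : m ≤ a)
    (hU : a ≤ (U - a) * ℓ ^ 2)
    (hρ : Real.exp (-(n * (9 / 10 * (Δ * Real.exp (-Δ) * ℓ)) ^ 2 / 4)) ≤ ρ) :
    ∃ B : Ω → ℝ≥0∞, Measurable B ∧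
      (∀ ω, IsClose (fun j => Y j ω) φ Δ U →
        (∀ v, a ≤ v → v ≤ U → ℓ < ‖phiHat Δ (fun j => Y j ω) v‖) → 1 ≤ B ω) ∧
      ENNReal.ofReal (2 * m) * ∫⁻ ω, B ω ∂P
        ≤ 20000 * tailEnergy φ m + ENNReal.ofReal (8 * a * ρ) := by
  -- The alternative concerns the target, not the sample, so `u₀` is deterministic and Hoeffding at
  -- one point suffices.
  by_cases hex : ∃ u₀, a ≤ u₀ ∧ u₀ ≤ U ∧ ‖φ u₀‖ ≤ ℓ / 100
  · obtain ⟨u₀, h1, h2, h3⟩ := hex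
    set t := 9 / 10 * (Δ * Real.exp (-Δ) * ℓ) with ht
    set S : Set Ω := {ω | t ≤ ‖empCharFun (fun j => Y j ω) u₀ - Complex.exp (Δ * (φ u₀ - 1))‖}
      with hS
    have hSm : MeasurableSet S := measurableSet_le measurable_const
      ((((measurable_empCharFun hY).comp measurable_prodMk_right).sub_const _).norm)
    refine ⟨S.indicator 1, measurable_one.indicator hSm, ?_, ?_⟩
    · intro ω hω hv
      have hmem : ω ∈ S := hω.le_deviation hn.ne' hΔ hφ hφ0 hΔℓ
        (by rw [abs_of_nonneg (hm0.trans (hma.trans h1))]; exact h2) h3 (hv u₀ h1 h2).le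
      simp [hmem]
    · rw [lintegral_indicator_one hSm]
      refine le_add_left ?_
      have hP : P S ≤ ENNReal.ofReal (4 * ρ) := by
        rw [← ofReal_measureReal]
        refine ENNReal.ofReal_le_ofReal ?_
        refine (measureReal_empCharFun_sub_ge_le hn hY hind hχ u₀ (by positivity)).trans ?_
        gcongr
      have hρ0 : 0 ≤ ρ := (Real.exp_nonneg _).trans hρ
      calc ENNReal.ofReal (2 * m) * P S ≤ ENNReal.ofReal (2 * m) * ENNReal.ofReal (4 * ρ) := by
            gcongr
        _ = ENNReal.ofReal (2 * m * (4 * ρ)) := (ENNReal.ofReal_mul (by positivity)).symm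
        _ ≤ ENNReal.ofReal (8 * a * ρ) := by
            refine ENNReal.ofReal_le_ofReal ?_
            nlinarith
  · push Not at hex
    -- No probability is gained here; instead `2m ≤ 2(U - a)ℓ² = 20000 (U - a)(ℓ/100)²` is paid by
    -- the tail energy.
    refine ⟨fun _ => 1, measurable_const, fun _ _ _ => le_rfl, ?_⟩
    refine le_add_right ?_
    have h1 : ENNReal.ofReal ((U - a) * (ℓ / 100) ^ 2) ≤ tailEnergy φ m := by
      refine le_tailEnergy hma (hm0.trans hma) (by positivity) fun u hu => ?_
      exact pow_le_pow_left₀ (by positivity) (hex u hu.1.le hu.2).le 2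
    rw [lintegral_one, measure_univ, mul_one]
    calc ENNReal.ofReal (2 * m) ≤ ENNReal.ofReal (20000 * ((U - a) * (ℓ / 100) ^ 2)) := by
          refine ENNReal.ofReal_le_ofReal ?_
          nlinarith
      _ = 20000 * ENNReal.ofReal ((U - a) * (ℓ / 100) ^ 2) := by
          rw [ENNReal.ofReal_mul (by norm_num)]
          norm_num
      _ ≤ _ := by gcongr

/-- The deviation of the empirical characteristic function. -/
def deviation {n : ℕ} (Δ : ℝ) (φ : ℝ → ℂ) (y : Fin n → ℝ) (u : ℝ) : ℝ :=
  ‖empCharFun y u - Complex.exp (Δ * (φ u - 1))‖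

/-- The linearised error of the estimator, up to a constant. -/
def linearError {n : ℕ} (Δ : ℝ) (φ : ℝ → ℂ) (y : Fin n → ℝ) (u : ℝ) : ℝ :=
  101 / 100 * ‖empCharFun y u - Complex.exp (Δ * (φ u - 1))‖
    / (Δ * ‖Complex.exp (Δ * (φ u - 1))‖)

open Classical in
/-- A majorant of the squared error at frequency `u` that is jointly measurable. -/
def errorMajorant {n : ℕ} (Δ : ℝ) (φ : ℝ → ℂ) (ℓ a m t : ℝ) (b : ℝ≥0∞) (y : Fin n → ℝ) (u : ℝ) :
    ℝ≥0∞ :=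
  if |u| ≤ m then ENNReal.ofReal (2 * ℓ ^ 2) + 2 * ENNReal.ofReal (linearError Δ φ y u ^ 2) + b
  else ‖φ u‖ₑ ^ 2 + if |u| ≤ a then
    (if ℓ / 100 ≤ ‖φ u‖ then ENNReal.ofReal (linearError Δ φ y u ^ 2)
      else if t ≤ deviation Δ φ y u then 25 else 0) else 0

/-- The random cutoff disappears from the bound, so its measurability in the sample is not needed.
The term `b` pays for frequencies below `m` that the cutoff missed. -/
theorem IsClose.fourierError_sq_le_errorMajorant {n : ℕ} {y : Fin n → ℝ} {φ : ℝ → ℂ} {Δ U : ℝ}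
    (h : IsClose y φ Δ U) (hn : n ≠ 0) (hΔ : 0 < Δ) (hφ : ContDiff ℝ 1 φ) (hφ0 : φ 0 = 1)
    (hφ1 : ∀ u, ‖φ u‖ ≤ 1) (hφn : ∀ u, φ (-u) = starRingEnd ℂ (φ u)) {κ α m : ℝ} {b : ℝ≥0∞}
    (hℓ : 0 ≤ level n Δ κ) (hΔℓ : Δ * level n Δ κ ≤ 1) (hma : m ≤ (n * Δ) ^ α)
    (haU : (n * Δ) ^ α ≤ U)
    (hb : (∀ v, (n * Δ) ^ α ≤ v → v ≤ U → level n Δ κ < ‖phiHat Δ y v‖) → 1 ≤ b) {u : ℝ}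
    (hne : |u| ≠ mHat Δ κ α y) :
    ENNReal.ofReal (fourierError Δ κ α y φ u ^ 2)
      ≤ errorMajorant Δ φ (level n Δ κ) ((n * Δ) ^ α) m
        (9 / 10 * (Δ * Real.exp (-Δ) * level n Δ κ)) b y u := by
  have hfe0 : 0 ≤ fourierError Δ κ α y φ u := norm_nonneg _
  unfold errorMajorant
  split_ifs with h1 h2 h3 h4
  · rcases h.fourierError_le hn hΔ hφ hφ0 hφ1 hφn hℓ haU (h1.trans hma) hne with h5 | ⟨h5, h6⟩
    · refine le_add_right ?_
      have : (2 : ℝ≥0∞) = ENNReal.ofReal 2 := by norm_num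
      rw [this, ← ENNReal.ofReal_mul (by norm_num), ← ENNReal.ofReal_add (by positivity)
        (by positivity)]
      refine ENNReal.ofReal_le_ofReal ?_
      have h7 := pow_le_pow_left₀ hfe0 h5 2
      change _ ≤ (level n Δ κ + linearError Δ φ y u) ^ 2 at h7
      nlinarith [sq_nonneg (level n Δ κ - linearError Δ φ y u)]
    · refine le_add_left (le_trans ?_ (hb h6))
      rw [← ENNReal.ofReal_one]
      exact ENNReal.ofReal_le_ofReal (by nlinarith)
  all_goals try rw [ENNReal.ofReal_pow hfe0]
  · rcases h.fourierError_cases hn hΔ hφ hφ0 hφ1 κ α (h2.trans haU) with h5 | ⟨h5, h6⟩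
    · rw [h5, ofReal_norm]
      exact le_self_add
    · refine le_add_left ?_
      rw [← ENNReal.ofReal_pow hfe0]
      refine ENNReal.ofReal_le_ofReal (pow_le_pow_left₀ hfe0 ?_ 2)
      rw [h6]
      exact h.norm_phiHat_sub_le hn hΔ hφ hφ0 (h2.trans haU)
  · refine le_add_left ?_
    rw [← ENNReal.ofReal_pow hfe0, ENNReal.ofReal_le_iff_le_toReal (by norm_num)]
    have := fourierError_le_five (y := y) (Δ := Δ) hφ1 κ α u
    norm_num
    nlinarith
  · rcases h.fourierError_cases hn hΔ hφ hφ0 hφ1 κ α (h2.trans haU) with h5 | ⟨h5, h6⟩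
    · rw [h5, ofReal_norm]
      exact le_self_add
    · exact absurd (h.le_deviation hn hΔ hφ hφ0 hΔℓ (h2.trans haU) (not_le.1 h3).le h5) h4
  · rw [fourierError_eq_of_lt κ α (not_le.1 h2), ofReal_norm]
    exact le_self_add

theorem measurable_deviation {n : ℕ} {Y : Fin n → Ω → ℝ} (hY : ∀ j, Measurable (Y j)) {φ : ℝ → ℂ}
    (hφ : Continuous φ) (Δ : ℝ) :
    Measurable fun p : Ω × ℝ => deviation Δ φ (fun j => Y j p.1) p.2 := by
  have h : Measurable fun u : ℝ => Complex.exp (Δ * (φ u - 1)) :=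
    (by fun_prop : Continuous fun u : ℝ => Complex.exp (Δ * (φ u - 1))).measurable
  exact ((measurable_empCharFun hY).sub (h.comp measurable_snd)).norm

theorem measurable_deviation_left {n : ℕ} {Y : Fin n → Ω → ℝ} (hY : ∀ j, Measurable (Y j))
    {φ : ℝ → ℂ} (hφ : Continuous φ) (Δ u : ℝ) :
    Measurable fun ω => deviation Δ φ (fun j => Y j ω) u := by
  exact (measurable_deviation hY hφ Δ).of_uncurry_right (y := u)
    (f := fun ω u => deviation Δ φ (fun j => Y j ω) u)

theorem measurable_linearError {n : ℕ} {Y : Fin n → Ω → ℝ} (hY : ∀ j, Measurable (Y j))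
    {φ : ℝ → ℂ} (hφ : Continuous φ) (Δ : ℝ) :
    Measurable fun p : Ω × ℝ => linearError Δ φ (fun j => Y j p.1) p.2 := by
  have h : Measurable fun u : ℝ => Δ * ‖Complex.exp (Δ * (φ u - 1))‖ :=
    (by fun_prop : Continuous fun u : ℝ => Δ * ‖Complex.exp (Δ * (φ u - 1))‖).measurable
  exact ((measurable_deviation hY hφ Δ).const_mul _).div (h.comp measurable_snd)

theorem measurable_errorMajorant {n : ℕ} {Y : Fin n → Ω → ℝ} (hY : ∀ j, Measurable (Y j))
    {φ : ℝ → ℂ} (hφ : Continuous φ) (Δ ℓ a m t : ℝ) {B : Ω → ℝ≥0∞} (hB : Measurable B) :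
    Measurable fun p : Ω × ℝ => errorMajorant Δ φ ℓ a m t (B p.1) (fun j => Y j p.1) p.2 := by
  have hL := ((measurable_linearError hY hφ Δ).pow_const 2).ennreal_ofReal
  have hD := measurable_deviation hY hφ Δ
  have hφ' : Measurable fun p : Ω × ℝ => φ p.2 := hφ.measurable.comp measurable_snd
  have habs : Measurable fun p : Ω × ℝ => |p.2| := measurable_snd.abs
  unfold errorMajorant
  refine Measurable.ite (measurableSet_le habs measurable_const)
    (((hL.const_mul _).const_add _).add (hB.comp measurable_fst)) ?_
  refine (hφ'.enorm.pow_const 2).add ?_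
  refine Measurable.ite (measurableSet_le habs measurable_const) ?_ measurable_const
  refine Measurable.ite (measurableSet_le measurable_const hφ'.norm) hL ?_
  exact Measurable.ite (measurableSet_le measurable_const hD) measurable_const measurable_const

theorem lintegral_errorMajorant_le [IsProbabilityMeasure P] {n : ℕ} (hn : 0 < n)
    {Y : Fin n → Ω → ℝ} (hY : ∀ j, Measurable (Y j)) (hind : iIndepFun Y P) {φ : ℝ → ℂ} {Δ : ℝ}
    (hΔ : 0 < Δ) (hφ : Continuous φ) (hφ1 : ∀ u, ‖φ u‖ ≤ 1)
    (hχ : ∀ j, charFun (P.map (Y j)) = fun u => Complex.exp (Δ * (φ u - 1)))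
    {ℓ a m t ρ : ℝ} (hℓ2 : Real.exp (4 * Δ) / (n * Δ) ≤ ℓ ^ 2) (hℓ : 0 ≤ ℓ) (ht : 0 ≤ t)
    (hρ : Real.exp (-(n * t ^ 2 / 4)) ≤ ρ) {B : Ω → ℝ≥0∞} (hB : Measurable B) (u : ℝ) :
    ∫⁻ ω, errorMajorant Δ φ ℓ a m t (B ω) (fun j => Y j ω) u ∂P
      ≤ (if |u| ≤ m then ENNReal.ofReal (2 * ℓ ^ 2) + ∫⁻ ω, B ω ∂P else 0)
        + (if |u| ≤ m then
            ENNReal.ofReal (10 / (n * Δ) * (1 / ‖Complex.exp (Δ * (φ u - 1))‖ ^ 2)) else 0)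
        + {u : ℝ | m < |u|}.indicator (fun u => 60001 * ‖φ u‖ₑ ^ 2) u
        + (if |u| ≤ a then ENNReal.ofReal (100 * ρ) else 0) := by
  have hn' : (0 : ℝ) < n := by exact_mod_cast hn
  have hlin := lintegral_linear_error_le hn hY hind hΔ hφ1 hχ u
  change ∫⁻ ω, ENNReal.ofReal (linearError Δ φ (fun j => Y j ω) u ^ 2) ∂P ≤ _ at hlin
  have hLm : Measurable fun ω => ENNReal.ofReal (linearError Δ φ (fun j => Y j ω) u ^ 2) :=
    (((measurable_linearError hY hφ Δ).comp measurable_prodMk_right).pow_const 2).ennreal_ofReal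
  have hpos : 0 < ‖Complex.exp (Δ * (φ u - 1))‖ := norm_pos_iff.2 (Complex.exp_ne_zero _)
  unfold errorMajorant
  by_cases h1 : |u| ≤ m
  · have hmem : u ∉ {u : ℝ | m < |u|} := fun h => absurd h (not_lt.2 h1)
    simp only [h1, if_true, indicator_of_notMem hmem]
    refine le_add_right (le_add_right ?_)
    rw [lintegral_add_right _ hB, lintegral_add_left measurable_const, lintegral_const,
      measure_univ, mul_one, lintegral_const_mul _ hLm, add_right_comm]
    gcongr
    refine (mul_le_mul_right hlin 2).trans_eq ?_
    have : (2 : ℝ≥0∞) = ENNReal.ofReal 2 := by norm_num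
    rw [this, ← ENNReal.ofReal_mul (by norm_num)]
    congr 1
    field_simp
    norm_num
  · have hmem : u ∈ {u : ℝ | m < |u|} := not_le.1 h1
    simp only [h1, if_false, indicator_of_mem hmem, zero_add]
    rw [lintegral_add_left measurable_const, lintegral_const, measure_univ, mul_one]
    by_cases h2 : |u| ≤ a
    · simp only [h2, if_true]
      -- If the target is not small, the variance is at most `5ℓ² ≤ 50000 |φ|²`; if it is small,
      -- passing the threshold requires a large deviation, whose cost is `25 · 4ρ`.
      by_cases h3 : ℓ / 100 ≤ ‖φ u‖
      · simp only [h3, if_true]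
        refine le_add_right ?_
        have h4 : ∫⁻ ω, ENNReal.ofReal (linearError Δ φ (fun j => Y j ω) u ^ 2) ∂P
            ≤ 60000 * ‖φ u‖ₑ ^ 2 := by
          refine hlin.trans ?_
          have : (60000 : ℝ≥0∞) = ENNReal.ofReal 60000 := by norm_num
          rw [← ofReal_norm, ← ENNReal.ofReal_pow (norm_nonneg _), this,
            ← ENNReal.ofReal_mul (by norm_num)]
          refine ENNReal.ofReal_le_ofReal ?_
          have h5 : 1 / ‖Complex.exp (Δ * (φ u - 1))‖ ^ 2 ≤ Real.exp (4 * Δ) := by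
            rw [norm_exp_eq, ← Real.exp_nat_mul, one_div, ← Real.exp_neg]
            refine Real.exp_le_exp.2 ?_
            have h6 := (abs_le.1 ((Complex.abs_re_le_norm (φ u)).trans (hφ1 u))).1
            push_cast
            nlinarith
          have h7 : ℓ ^ 2 ≤ 10000 * ‖φ u‖ ^ 2 := by
            have := pow_le_pow_left₀ (by positivity) h3 2
            rw [div_pow, div_le_iff₀ (by norm_num)] at this
            linarith
          calc 5 / (n * Δ * ‖Complex.exp (Δ * (φ u - 1))‖ ^ 2)
              = 5 / (n * Δ) * (1 / ‖Complex.exp (Δ * (φ u - 1))‖ ^ 2) := by field_simp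
            _ ≤ 5 / (n * Δ) * Real.exp (4 * Δ) := by gcongr
            _ = 5 * (Real.exp (4 * Δ) / (n * Δ)) := by ring
            _ ≤ 60000 * ‖φ u‖ ^ 2 := by linarith [sq_nonneg ‖φ u‖]
        calc _ ≤ ‖φ u‖ₑ ^ 2 + 60000 * ‖φ u‖ₑ ^ 2 := by gcongr
          _ = 60001 * ‖φ u‖ₑ ^ 2 := by rw [← one_add_mul]; norm_num
      · simp only [h3, if_false]
        have hSm : MeasurableSet {ω | t ≤ deviation Δ φ (fun j => Y j ω) u} :=
          measurableSet_le measurable_const (measurable_deviation_left hY hφ Δ u)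
        have h4 : ∫⁻ ω, (if t ≤ deviation Δ φ (fun j => Y j ω) u then (25 : ℝ≥0∞) else 0) ∂P
            ≤ ENNReal.ofReal (100 * ρ) := by
          have h5 : ∫⁻ ω, (if t ≤ deviation Δ φ (fun j => Y j ω) u then (25 : ℝ≥0∞) else 0) ∂P
              = 25 * P {ω | t ≤ deviation Δ φ (fun j => Y j ω) u} := by
            rw [← lintegral_indicator_const hSm]
            refine lintegral_congr fun ω => ?_
            by_cases hω : t ≤ deviation Δ φ (fun j => Y j ω) u
            · rw [if_pos hω, indicator_of_mem (by exact hω)]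
            · rw [if_neg hω, indicator_of_notMem (by exact hω)]
          rw [h5, ← ofReal_measureReal]
          have : (25 : ℝ≥0∞) = ENNReal.ofReal 25 := by norm_num
          rw [this, ← ENNReal.ofReal_mul (by norm_num)]
          refine ENNReal.ofReal_le_ofReal ?_
          have := measureReal_empCharFun_sub_ge_le hn hY hind hχ u ht
          change P.real {ω | t ≤ deviation Δ φ (fun j => Y j ω) u} ≤ _ at this
          linarith
        exact add_le_add (le_mul_of_one_le_left zero_le (by norm_num)) h4
    · simp only [h2, if_false, lintegral_zero, add_zero]
      exact le_mul_of_one_le_left zero_le (by norm_num)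

/-- Upper bound for the integrated risk in terms of the probability of an exceptional event. -/
theorem lintegral_risk_le [IsProbabilityMeasure P] {n : ℕ} (hn : 0 < n)
    {Y : Fin n → Ω → ℝ} (hY : ∀ j, Measurable (Y j)) (hind : iIndepFun Y P) {φ : ℝ → ℂ} {Δ : ℝ}
    (hΔ : 0 < Δ) (hφ : ContDiff ℝ 1 φ) (hφ0 : φ 0 = 1) (hφ1 : ∀ u, ‖φ u‖ ≤ 1)
    (hφn : ∀ u, φ (-u) = starRingEnd ℂ (φ u))
    (hχ : ∀ j, charFun (P.map (Y j)) = fun u => Complex.exp (Δ * (φ u - 1)))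
    {κ α U m ρ : ℝ} (hℓ : 0 < level n Δ κ) (hΔℓ : Δ * level n Δ κ ≤ 1)
    (hℓ2 : Real.exp (4 * Δ) / (n * Δ) ≤ level n Δ κ ^ 2) (hm0 : 0 ≤ m) (hma : m ≤ (n * Δ) ^ α)
    (haU : (n * Δ) ^ α ≤ U) (hU : (n * Δ) ^ α ≤ (U - (n * Δ) ^ α) * level n Δ κ ^ 2)
    (hρ : Real.exp (-(n * (9 / 10 * (Δ * Real.exp (-Δ) * level n Δ κ)) ^ 2 / 4)) ≤ ρ)
    {E : Set Ω} (hE : MeasurableSet E) (hclose : ∀ ω ∉ E, IsClose (fun j => Y j ω) φ Δ U) :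
    ∫⁻ ω, (∫⁻ u : ℝ, ENNReal.ofReal (fourierError Δ κ α (fun j => Y j ω) φ u ^ 2)) ∂P
      ≤ 80002 * tailEnergy φ m
        + ENNReal.ofReal (4 * m * level n Δ κ ^ 2 + 10 / (n * Δ)
            * (∫ u in (-m)..m, 1 / ‖Complex.exp (Δ * (φ u - 1))‖ ^ 2)
          + 208 * (n * Δ) ^ α * ρ + 50 * (n * Δ) ^ α * P.real E) := by
  have hn' : (0 : ℝ) < n := by exact_mod_cast hn
  have ha0 : 0 ≤ (n * Δ) ^ α := by positivity
  have hρ0 : 0 ≤ ρ := (Real.exp_nonneg _).trans hρ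
  have hφc := hφ.continuous
  obtain ⟨B, hBm, hB1, hB2⟩ := exists_indicator_bound hn hY hind hΔ hφ hφ0 hχ hℓ hΔℓ hm0 hma hU hρ
  set t := 9 / 10 * (Δ * Real.exp (-Δ) * level n Δ κ) with ht
  set H : Ω → ℝ → ℝ≥0∞ := fun ω u => errorMajorant Δ φ (level n Δ κ) ((n * Δ) ^ α) m t (B ω)
    (fun j => Y j ω) u with hH
  have hHm : Measurable (Function.uncurry H) :=
    measurable_errorMajorant hY hφc Δ _ _ _ _ hBm
  have hpt (ω : Ω) : ∫⁻ u : ℝ, ENNReal.ofReal (fourierError Δ κ α (fun j => Y j ω) φ u ^ 2)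
      ≤ (∫⁻ u, H ω u) + (E.indicator (fun _ => ENNReal.ofReal (50 * (n * Δ) ^ α)) ω
        + tailEnergy φ m) := by
    by_cases hω : ω ∈ E
    · rw [indicator_of_mem hω]
      exact le_add_left (lintegral_fourierError_sq_le _ hφc.measurable hφ1 hΔ.le κ α hma)
    · refine le_add_right (lintegral_mono_ae ?_)
      -- The two endpoints `±mHat`, where the pathwise bound is not available, are negligible.
      have hfin : ∀ᵐ u : ℝ, |u| ≠ mHat Δ κ α (fun j => Y j ω) := by
        have hfs : ({u : ℝ | |u| = mHat Δ κ α (fun j => Y j ω)}).Finite := by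
          refine (Set.toFinite {mHat Δ κ α (fun j => Y j ω), -mHat Δ κ α (fun j => Y j ω)}).subset
            fun u hu => ?_
          have hu' : |u| = mHat Δ κ α (fun j => Y j ω) := hu
          rw [← hu']
          rcases abs_choice u with h | h <;> rw [h] <;> simp
        exact measure_eq_zero_iff_ae_notMem.1 (hfs.measure_zero volume)
      filter_upwards [hfin] with u hu
      exact (hclose ω hω).fourierError_sq_le_errorMajorant hn.ne' hΔ hφ hφ0 hφ1 hφn hℓ.le hΔℓ hma
        haU (hB1 ω (hclose ω hω)) hu
  have hint : ∫⁻ u : ℝ, (if |u| ≤ m then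
      ENNReal.ofReal (10 / (n * Δ) * (1 / ‖Complex.exp (Δ * (φ u - 1))‖ ^ 2)) else 0)
      = ENNReal.ofReal (10 / (n * Δ)
        * ∫ u in (-m)..m, 1 / ‖Complex.exp (Δ * (φ u - 1))‖ ^ 2) := by
    have h1 : (fun u : ℝ => if |u| ≤ m then
        ENNReal.ofReal (10 / (n * Δ) * (1 / ‖Complex.exp (Δ * (φ u - 1))‖ ^ 2)) else 0)
        = (Icc (-m) m).indicator fun u =>
          ENNReal.ofReal (10 / (n * Δ) * (1 / ‖Complex.exp (Δ * (φ u - 1))‖ ^ 2)) := by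
      ext u
      simp only [indicator, mem_Icc, abs_le]
    have hc : Continuous fun u : ℝ =>
        10 / (n * Δ) * (1 / ‖Complex.exp (Δ * (φ u - 1))‖ ^ 2) := by
      refine continuous_const.mul (continuous_const.div (by fun_prop) fun u => ?_)
      exact pow_ne_zero 2 (norm_ne_zero_iff.2 (Complex.exp_ne_zero _))
    rw [h1, lintegral_indicator measurableSet_Icc, setLIntegral_congr Ioc_ae_eq_Icc.symm,
      ← intervalIntegral.integral_const_mul,
      intervalIntegral.integral_of_le (by linarith), ofReal_integral_eq_lintegral_ofReal]
    · exact (hc.integrableOn_Icc).mono_set Ioc_subset_Icc_self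
    · exact ae_of_all _ fun u => by positivity
  calc ∫⁻ ω, (∫⁻ u : ℝ, ENNReal.ofReal (fourierError Δ κ α (fun j => Y j ω) φ u ^ 2)) ∂P
      ≤ ∫⁻ ω, ((∫⁻ u, H ω u) + (E.indicator (fun _ => ENNReal.ofReal (50 * (n * Δ) ^ α)) ω
        + tailEnergy φ m)) ∂P := lintegral_mono hpt
    _ = (∫⁻ ω, (∫⁻ u, H ω u) ∂P) + (ENNReal.ofReal (50 * (n * Δ) ^ α) * P E + tailEnergy φ m) := by
        rw [lintegral_add_right _ ((measurable_const.indicator hE).add_const _),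
          lintegral_add_right _ measurable_const, lintegral_indicator_const hE, lintegral_const,
          measure_univ, mul_one]
    _ ≤ ((ENNReal.ofReal (2 * m) * (ENNReal.ofReal (2 * level n Δ κ ^ 2) + ∫⁻ ω, B ω ∂P)
          + ENNReal.ofReal (10 / (n * Δ)
            * ∫ u in (-m)..m, 1 / ‖Complex.exp (Δ * (φ u - 1))‖ ^ 2)
          + 60001 * tailEnergy φ m
          + ENNReal.ofReal (2 * (n * Δ) ^ α) * ENNReal.ofReal (100 * ρ)))
        + (ENNReal.ofReal (50 * (n * Δ) ^ α) * P E + tailEnergy φ m) := by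
        gcongr
        -- Tonelli is applied only to the jointly measurable majorant.
        rw [lintegral_lintegral_swap hHm.aemeasurable]
        refine (lintegral_mono fun u => lintegral_errorMajorant_le hn hY hind hΔ hφc hφ1 hχ hℓ2
          hℓ.le (by positivity) hρ hBm u).trans ?_
        have hm1 (c : ℝ≥0∞) (a : ℝ) : Measurable fun u : ℝ => if |u| ≤ a then c else 0 :=
          Measurable.ite (measurableSet_le measurable_id.abs measurable_const) measurable_const
            measurable_const
        rw [lintegral_add_right _ (hm1 _ _), lintegral_add_right, lintegral_add_left (hm1 _ _),
          lintegral_const_abs_le, lintegral_const_abs_le, hint,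
          lintegral_indicator (measurableSet_abs_gt m), lintegral_const_mul]
        · rfl
        · exact hφc.measurable.enorm.pow_const 2
        · exact ((hφc.measurable.enorm.pow_const 2).const_mul _).indicator
            (measurableSet_abs_gt m)
    _ ≤ ((ENNReal.ofReal (2 * m * (2 * level n Δ κ ^ 2)) + (20000 * tailEnergy φ m
            + ENNReal.ofReal (8 * (n * Δ) ^ α * ρ))
          + ENNReal.ofReal (10 / (n * Δ)
            * ∫ u in (-m)..m, 1 / ‖Complex.exp (Δ * (φ u - 1))‖ ^ 2)
          + 60001 * tailEnergy φ m
          + ENNReal.ofReal (2 * (n * Δ) ^ α * (100 * ρ))))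
        + (ENNReal.ofReal (50 * (n * Δ) ^ α * P.real E) + tailEnergy φ m) := by
        rw [mul_add, ← ENNReal.ofReal_mul (by positivity), ← ENNReal.ofReal_mul (by positivity),
          ENNReal.ofReal_mul (p := 50 * (n * Δ) ^ α) (by positivity), ofReal_measureReal]
        gcongr
    _ = _ := by
        have hI : 0 ≤ 10 / (n * Δ)
            * ∫ u in (-m)..m, 1 / ‖Complex.exp (Δ * (φ u - 1))‖ ^ 2 := by
          refine mul_nonneg (by positivity)
            (intervalIntegral.integral_nonneg (by linarith) fun u _ => by positivity)
        have hx : 208 * (n * Δ) ^ α * ρ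
            = 8 * (n * Δ) ^ α * ρ + 2 * (n * Δ) ^ α * (100 * ρ) := by ring
        rw [hx, ENNReal.ofReal_add (by positivity) (by positivity),
          ENNReal.ofReal_add (by positivity) (by positivity),
          ENNReal.ofReal_add (by positivity) (by positivity),
          ENNReal.ofReal_add (by positivity) (by positivity),
          show (80002 : ℝ≥0∞) = 20000 + 60001 + 1 by norm_num,
          show 4 * m * level n Δ κ ^ 2 = 2 * m * (2 * level n Δ κ ^ 2) by ring]
        generalize (20000 : ℝ≥0∞) = c₁
        generalize (60001 : ℝ≥0∞) = c₂
        ring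

/-! ### Size of the threshold, the closeness event and the choice of constants -/

/-- Threshold beyond which exponentials and logarithms are dominated by powers. -/
theorem exists_dominating (κ c : ℝ) :
    ∃ w₀ : ℝ, 1 ≤ w₀ ∧ ∀ w, w₀ ≤ w → 100 ≤ w ∧ c ≤ w ∧ κ ^ 2 * Real.log (w ^ 16) ≤ w ∧
      80 * w ^ 100 ≤ Real.exp w := by
  have h1 : ∀ᶠ w : ℝ in Filter.atTop, κ ^ 2 * Real.log (w ^ 16) ≤ w := by
    have h := (Real.isLittleO_log_id_atTop.const_mul_left (κ ^ 2 * 16)).bound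
      (show (0 : ℝ) < 1 by norm_num)
    filter_upwards [h, Filter.eventually_ge_atTop 0] with w hw hw0
    rw [Real.log_pow, ← mul_assoc]
    simpa [abs_of_nonneg hw0] using (le_abs_self _).trans hw
  have h2 : ∀ᶠ w : ℝ in Filter.atTop, 80 * w ^ 100 ≤ Real.exp w := by
    have h := ((Real.isLittleO_pow_exp_atTop (n := 100)).const_mul_left (80 : ℝ)).bound
      (show (0 : ℝ) < 1 by norm_num)
    filter_upwards [h] with w hw
    rw [one_mul, Real.norm_of_nonneg (Real.exp_nonneg _)] at hw
    exact (le_abs_self _).trans hw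
  obtain ⟨w₀, hw₀⟩ := Filter.eventually_atTop.1 ((Filter.eventually_ge_atTop 100).and
    ((Filter.eventually_ge_atTop c).and (h1.and h2)))
  exact ⟨max 1 w₀, le_max_left _ _, fun w hw => hw₀ w ((le_max_right _ _).trans hw)⟩

/-- From `e^x ≥ e·x` at `x = 2Δ` and `2e > 5`. -/
theorem le_exp_two_mul (Δ : ℝ) : 5 * Δ ≤ Real.exp (2 * Δ) := by
  have h1 := Real.add_one_le_exp (2 * Δ - 1)
  have h2 : Real.exp (2 * Δ) = Real.exp (2 * Δ - 1) * Real.exp 1 := by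
    rw [← Real.exp_add]; ring_nf
  have h3 := Real.exp_one_gt_d9
  rcases le_total Δ 0 with h | h
  · linarith [Real.exp_pos (2 * Δ)]
  · rw [h2]
    nlinarith [Real.exp_pos (2 * Δ - 1)]

section Level

variable {n : ℕ} {Δ κ : ℝ}

theorem level_nonneg_aux (hκ : 0 ≤ κ) : 0 ≤ κ * √(Real.log (n * Δ)) :=
  mul_nonneg hκ (Real.sqrt_nonneg _)

theorem level_pos (hκ : 0 ≤ κ) (hT : 0 < n * Δ) : 0 < level n Δ κ :=
  div_pos (add_pos_of_pos_of_nonneg (Real.exp_pos _) (level_nonneg_aux hκ)) (Real.sqrt_pos.2 hT)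

theorem level_sq (hT : 0 < n * Δ) :
    level n Δ κ ^ 2 = (Real.exp (2 * Δ) + κ * √(Real.log (n * Δ))) ^ 2 / (n * Δ) := by
  rw [level, div_pow, Real.sq_sqrt hT.le]

theorem exp_div_le_level_sq (hκ : 0 ≤ κ) (hT : 0 < n * Δ) :
    Real.exp (4 * Δ) / (n * Δ) ≤ level n Δ κ ^ 2 := by
  rw [level_sq hT]
  have h : Real.exp (4 * Δ) = Real.exp (2 * Δ) ^ 2 := by
    rw [← Real.exp_nat_mul]; congr 1; push_cast; ring
  rw [h]
  have := level_nonneg_aux (n := n) (Δ := Δ) hκ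
  have := Real.exp_pos (2 * Δ)
  gcongr
  linarith

theorem log_div_le_level_sq (hκ : 0 ≤ κ) (hT : 1 ≤ n * Δ) :
    κ ^ 2 * Real.log (n * Δ) / (n * Δ) ≤ level n Δ κ ^ 2 := by
  rw [level_sq (by linarith)]
  have h : κ ^ 2 * Real.log (n * Δ) = (κ * √(Real.log (n * Δ))) ^ 2 := by
    rw [mul_pow, Real.sq_sqrt (Real.log_nonneg hT)]
  rw [h]
  have := level_nonneg_aux (n := n) (Δ := Δ) hκ
  have := Real.exp_pos (2 * Δ)
  gcongr
  linarith

theorem level_sq_le (hT : 1 ≤ n * Δ) :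
    level n Δ κ ^ 2
      ≤ 2 * (Real.exp (4 * Δ) / (n * Δ)) + 2 * κ ^ 2 * (Real.log (n * Δ) / (n * Δ)) := by
  have hT0 : 0 < n * Δ := by linarith
  rw [level_sq hT0]
  have h : Real.exp (4 * Δ) = Real.exp (2 * Δ) ^ 2 := by
    rw [← Real.exp_nat_mul]; congr 1; push_cast; ring
  have h' : κ ^ 2 * Real.log (n * Δ) = (κ * √(Real.log (n * Δ))) ^ 2 := by
    rw [mul_pow, Real.sq_sqrt (Real.log_nonneg hT)]
  have h2 : 2 * (Real.exp (4 * Δ) / (n * Δ)) + 2 * κ ^ 2 * (Real.log (n * Δ) / (n * Δ))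
      = (2 * Real.exp (4 * Δ) + 2 * (κ ^ 2 * Real.log (n * Δ))) / (n * Δ) := by ring
  rw [h2, h', h]
  gcongr
  exact add_sq_le.trans_eq (by ring)

/-- The probability that the empirical characteristic function deviates by the order of the
threshold decays like a power of `nΔ`. -/
theorem exp_deviation_le (hκ : 0 ≤ κ) (hΔ : 0 < Δ) (hT : 1 ≤ n * Δ) :
    Real.exp (-(n * (9 / 10 * (Δ * Real.exp (-Δ) * level n Δ κ)) ^ 2 / 4))
      ≤ (n * Δ) ^ (-(κ ^ 2 * Δ ^ 2 * Real.exp (-4 * Δ))) := by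
  have hT0 : 0 < n * Δ := by linarith
  rw [Real.rpow_def_of_pos hT0]
  refine Real.exp_le_exp.2 ?_
  have h1 := log_div_le_level_sq hκ hT
  rw [div_le_iff₀ hT0] at h1
  have hlog : 0 ≤ Real.log (n * Δ) := Real.log_nonneg hT
  have h2 := le_exp_two_mul Δ
  have h3 : Real.exp (-Δ) ^ 2 = Real.exp (2 * Δ) * Real.exp (-4 * Δ) := by
    rw [← Real.exp_nat_mul, ← Real.exp_add]; congr 1; push_cast; ring
  have h4 : n * (9 / 10 * (Δ * Real.exp (-Δ) * level n Δ κ)) ^ 2 / 4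
      = 81 / 400 * Δ * Real.exp (2 * Δ) * Real.exp (-4 * Δ) * (level n Δ κ ^ 2 * (n * Δ)) := by
    rw [mul_pow, mul_pow, mul_pow, h3]; ring
  -- The factor `81/400` comes from `(9/10)²/4`, and `81/400 · 5 > 1`: the exponent of the rate
  -- appears with constant `1`.
  have h5 : 81 / 400 * Δ * (5 * Δ) * Real.exp (-4 * Δ) * (κ ^ 2 * Real.log (n * Δ))
      ≤ 81 / 400 * Δ * Real.exp (2 * Δ) * Real.exp (-4 * Δ) * (level n Δ κ ^ 2 * (n * Δ)) := by
    gcongr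
  have h6 : 0 ≤ Δ ^ 2 * Real.exp (-4 * Δ) * (κ ^ 2 * Real.log (n * Δ)) := by positivity
  rw [h4]
  nlinarith

end Level

theorem le_norm_exp {φ : ℝ → ℂ} (hφ1 : ∀ u, ‖φ u‖ ≤ 1) {Δ : ℝ} (hΔ : 0 ≤ Δ) (u : ℝ) :
    Real.exp (-(2 * Δ)) ≤ ‖Complex.exp (Δ * (φ u - 1))‖ := by
  rw [norm_exp_eq]
  refine Real.exp_le_exp.2 ?_
  have h6 := (abs_le.1 ((Complex.abs_re_le_norm (φ u)).trans (hφ1 u))).1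
  nlinarith

theorem norm_exp_le_one {φ : ℝ → ℂ} (hφ1 : ∀ u, ‖φ u‖ ≤ 1) {Δ : ℝ} (hΔ : 0 ≤ Δ) (u : ℝ) :
    ‖Complex.exp (Δ * (φ u - 1))‖ ≤ 1 := by
  rw [norm_exp_eq]
  refine Real.exp_le_one_iff.2 ?_
  have h6 := (abs_le.1 ((Complex.abs_re_le_norm (φ u)).trans (hφ1 u))).2
  nlinarith

/-- With high probability the empirical characteristic function is close to the true one on a long
interval. -/
theorem exists_measurableSet_isClose [IsProbabilityMeasure P] {n : ℕ} (hn : 0 < n)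
    {Y : Fin n → Ω → ℝ} (hY : ∀ j, Measurable (Y j)) (hind : iIndepFun Y P) {φ : ℝ → ℂ} {Δ : ℝ}
    (hΔ : 0 < Δ) (hφ1 : ∀ u, ‖φ u‖ ≤ 1)
    (hχ : ∀ j, charFun (P.map (Y j)) = fun u => Complex.exp (Δ * (φ u - 1)))
    {c w a : ℝ} (hc0 : 0 ≤ c)
    (hc : ∀ j, ∫⁻ ω, ‖Y j ω‖ₑ ∂P ≤ ENNReal.ofReal (Real.exp Δ * c)) (hT : n * Δ = w ^ 16)
    (hw : 100 ≤ w) (hcw : c ≤ w) (hexp : Real.exp (2 * Δ) ≤ w) (hΔw : 1 ≤ Δ ^ 2 * w)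
    (hwexp : 80 * w ^ 100 ≤ Real.exp w) (ha0 : 0 ≤ a) (ha : a ≤ n * Δ) :
    ∃ E : Set Ω, MeasurableSet E ∧ P.real E ≤ 2 / (n * Δ) ^ 2 ∧
      ∀ ω ∉ E, IsClose (fun j => Y j ω) φ Δ (a + a * (n * Δ)) := by
  have hw0 : 0 < w := by linarith
  have hw1 : 1 ≤ w := by linarith
  have hn' : (0 : ℝ) < n := by exact_mod_cast hn
  have hexpΔ : Real.exp Δ ≤ w := (Real.exp_le_exp.2 (by linarith)).trans hexp
  have hΔle : Δ ≤ w := by linarith [Real.add_one_le_exp Δ]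
  have hΔge : 1 / w ≤ Δ := by
    rw [div_le_iff₀ hw0]
    by_contra! h
    nlinarith [mul_pos hΔ hw0]
  have hnw : w ^ 15 ≤ n := by
    have : w ^ 15 * w ≤ n * w := by
      calc w ^ 15 * w = n * Δ := by rw [hT]; ring
        _ ≤ n * w := by gcongr
    exact le_of_mul_le_mul_right this hw0
  have hcw2 : Real.exp Δ * c ≤ w ^ 2 := by
    calc Real.exp Δ * c ≤ w * w := by gcongr
      _ = w ^ 2 := by ring
  have hU0 : 0 ≤ a + a * (n * Δ) := by positivity
  -- In powers of `w = T^{1/16}`: `s = w^{-2}` is below both relative errors, `L = w^34` gives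
  -- Markov probability `w^{-32} = T^{-2}`, and `h` solves `2Lh = s/2`. The grid has at most `20
  -- w^68` points, each failing with probability at most `4e^{-w}`.
  obtain ⟨E, hEm, hEP, hE⟩ := exists_measurableSet_empCharFun_sub_le hn hY hind hχ
    (c := Real.exp Δ * c) (L := w ^ 34) (U := a + a * (n * Δ)) (h := 1 / (4 * w ^ 36))
    (s := 1 / w ^ 2) (by positivity) hc (hcw2.trans (by gcongr; norm_num)) (by positivity)
    (by positivity) (by field_simp; norm_num) (by positivity) hU0
  refine ⟨E, hEm, hEP.trans ?_, fun ω hω => ?_⟩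
  · have h1 : Real.exp Δ * c / w ^ 34 ≤ 1 / w ^ 32 := by
      rw [div_le_div_iff₀ (by positivity) (by positivity)]
      calc Real.exp Δ * c * w ^ 32 ≤ w ^ 2 * w ^ 32 := by gcongr
        _ = 1 * w ^ 34 := by ring
    have h2 : a + a * (n * Δ) ≤ 2 * w ^ 32 := by
      have h3 : w ^ 16 ≤ w ^ 32 := pow_le_pow_right₀ hw1 (by norm_num)
      have h4 : a * (n * Δ) ≤ w ^ 16 * w ^ 16 := by
        rw [hT] at ha ⊢
        gcongr
      nlinarith
    have h3 : 2 * ((a + a * (n * Δ)) / (1 / (4 * w ^ 36)) + 1) + 1 ≤ 20 * w ^ 68 := by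
      have h4 : (a + a * (n * Δ)) / (1 / (4 * w ^ 36)) ≤ 8 * w ^ 68 := by
        rw [div_div_eq_mul_div, div_one]
        calc (a + a * (n * Δ)) * (4 * w ^ 36) ≤ 2 * w ^ 32 * (4 * w ^ 36) := by gcongr
          _ = 8 * w ^ 68 := by ring
      have h5 : 1 ≤ w ^ 68 := one_le_pow₀ hw1
      linarith
    have h4 : Real.exp (-(n * (1 / w ^ 2 / 2) ^ 2 / 4)) ≤ Real.exp (-w) := by
      refine Real.exp_le_exp.2 (neg_le_neg ?_)
      have h5 : (1 / w ^ 2 / 2) ^ 2 = 1 / (4 * w ^ 4) := by field_simp; norm_num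
      rw [h5]
      calc w = 16 * (w * w ^ 4) * (1 / (4 * w ^ 4)) / 4 := by field_simp; norm_num
        _ ≤ n * (1 / (4 * w ^ 4)) / 4 := by
            gcongr
            refine le_trans ?_ hnw
            have h6 : 16 ≤ w ^ 10 := by
              calc (16 : ℝ) ≤ w := by linarith
                _ = w ^ 1 := (pow_one w).symm
                _ ≤ w ^ 10 := pow_le_pow_right₀ hw1 (by norm_num)
            calc 16 * (w * w ^ 4) ≤ w ^ 10 * (w * w ^ 4) := by gcongr
              _ = w ^ 15 := by ring
    have h5 : 80 * w ^ 68 * Real.exp (-w) ≤ 1 / w ^ 32 := by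
      rw [Real.exp_neg, ← div_eq_mul_inv, div_le_div_iff₀ (Real.exp_pos _) (by positivity)]
      calc 80 * w ^ 68 * w ^ 32 = 80 * w ^ 100 := by ring
        _ ≤ 1 * Real.exp w := by linarith
    have h6 : 2 / (n * Δ) ^ 2 = 1 / w ^ 32 + 1 / w ^ 32 := by rw [hT]; ring
    rw [h6]
    refine add_le_add h1 (le_trans ?_ h5)
    calc _ ≤ 20 * w ^ 68 * (4 * Real.exp (-w)) := by gcongr
      _ = 80 * w ^ 68 * Real.exp (-w) := by ring
  · have hlow (u : ℝ) : 1 / w ≤ ‖Complex.exp (Δ * (φ u - 1))‖ := by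
      refine le_trans ?_ (le_norm_exp hφ1 hΔ.le u)
      rw [Real.exp_neg, ← one_div]
      exact one_div_le_one_div_of_le (Real.exp_pos _) hexp
    -- One factor `1/w` is a lower bound for `|φ_Δ|`, the other is below both `1/100` and `Δ`.
    have hww : 1 / w ^ 2 = 1 / w * (1 / w) := by field_simp
    refine ⟨fun u hu => (hE ω hω u hu).trans ?_, fun u hu => (hE ω hω u hu).trans ?_⟩
    · rw [hww]
      have : 1 / w ≤ 1 / 100 := one_div_le_one_div_of_le (by norm_num) hw
      gcongr
      exact hlow u
    · rw [hww]
      gcongr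
      exact hlow u

/-- Since `|φ_Δ| ≤ 1`, the variance integral controls the length of the window. -/
theorem two_mul_le_integral_inv_sq {φ : ℝ → ℂ} (hφ : Continuous φ) (hφ1 : ∀ u, ‖φ u‖ ≤ 1) {Δ : ℝ}
    (hΔ : 0 ≤ Δ) {m : ℝ} (hm : 0 ≤ m) :
    2 * m ≤ ∫ u in (-m)..m, 1 / ‖Complex.exp (Δ * (φ u - 1))‖ ^ 2 := by
  have hne (u : ℝ) : 0 < ‖Complex.exp (Δ * (φ u - 1))‖ := norm_pos_iff.2 (Complex.exp_ne_zero _)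
  have hc : Continuous fun u : ℝ => 1 / ‖Complex.exp (Δ * (φ u - 1))‖ ^ 2 :=
    continuous_const.div (by fun_prop) fun u => pow_ne_zero 2 (hne u).ne'
  have h := intervalIntegral.integral_mono_on (μ := volume) (a := -m) (b := m)
    (f := fun _ => (1 : ℝ))
    (by linarith) intervalIntegrable_const (hc.intervalIntegrable _ _) fun u _ => ?_
  · rw [intervalIntegral.integral_const, smul_eq_mul] at h
    linarith
  · rw [one_le_div (pow_pos (hne u) 2)]
    exact pow_le_one₀ (hne u).le (norm_exp_le_one hφ1 hΔ u)

/-- The trivial risk bound, with the crude bound absorbed when `nΔ` stays bounded. -/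
theorem ofReal_const_le_oracle {φ : ℝ → ℂ} {c : ℝ} (hc : 0 < c)
    (hφc : ∀ u, ‖φ u - 1‖ ≤ |u| * c) {T T₀ m J K : ℝ} (hT : 0 < T)
    (hTT : T ≤ T₀) (hT₀ : 1 ≤ T₀) (hJ : 2 * m ≤ J) (hJK : 1 / T * J ≤ K) :
    ENNReal.ofReal (50 * T₀)
      ≤ ENNReal.ofReal (800 * c * T₀ ^ 2) * (tailEnergy φ m + ENNReal.ofReal K) := by
  -- For large `m` the variance term is bounded below by `2m/T`. For small `m` the bias is: `|φ| ≥
  -- 1/2` on `(1/(4c), 1/(2c)]`.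
  rcases le_total (1 / (4 * c)) m with h | h
  · refine le_trans ?_ (mul_le_mul_right (le_add_self) _)
    rw [← ENNReal.ofReal_mul (by positivity)]
    refine ENNReal.ofReal_le_ofReal ?_
    have h1 : 1 / (2 * c * T₀) ≤ K := by
      refine le_trans ?_ hJK
      calc 1 / (2 * c * T₀) = 1 / T₀ * (2 * (1 / (4 * c))) := by field_simp; norm_num
        _ ≤ 1 / T * (2 * m) := by gcongr
        _ ≤ 1 / T * J := by gcongr
    calc 50 * T₀ ≤ 400 * T₀ := by linarith
      _ = 800 * c * T₀ ^ 2 * (1 / (2 * c * T₀)) := by field_simp; norm_num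
      _ ≤ _ := by gcongr
  · have h1 : ENNReal.ofReal ((1 / (2 * c) - 1 / (4 * c)) * (1 / 4)) ≤ tailEnergy φ m := by
      refine le_tailEnergy h (by positivity) (by norm_num) fun u hu => ?_
      have hu0 : 0 ≤ u := le_trans (by positivity) hu.1.le
      have h2 : |u| * c ≤ 1 / 2 := by
        rw [abs_of_nonneg hu0]
        calc u * c ≤ 1 / (2 * c) * c := by gcongr; exact hu.2
          _ = 1 / 2 := by field_simp
      have h3 : 1 / 2 ≤ ‖φ u‖ := by
        have h4 := norm_sub_norm_le (1 : ℂ) (1 - φ u)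
        rw [sub_sub_cancel, norm_one, norm_sub_rev] at h4
        linarith [hφc u]
      nlinarith
    refine le_trans ?_ (mul_le_mul_right (h1.trans le_self_add) _)
    rw [← ENNReal.ofReal_mul (by positivity)]
    refine ENNReal.ofReal_le_ofReal ?_
    have h2 : 800 * c * T₀ ^ 2 * ((1 / (2 * c) - 1 / (4 * c)) * (1 / 4)) = 50 * T₀ ^ 2 := by
      field_simp
      norm_num
    rw [h2]
    nlinarith

/-- The contribution of the threshold to the risk is of the order of the variance term. -/
theorem mul_level_sq_le {n : ℕ} {Δ κ α m J w : ℝ} (hΔ : 0 < Δ) (hT : 1 ≤ n * Δ)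
    (hTw : n * Δ = w ^ 16) (hw : 1 ≤ w) (hexp : Real.exp (2 * Δ) ≤ w) (hm : 0 ≤ m)
    (hma : m ≤ (n * Δ) ^ α) (hJ : 2 * m ≤ J) :
    4 * m * level n Δ κ ^ 2 ≤ 16 * κ ^ 4 * (1 / (n * Δ) * J)
      + 8 * κ ^ 2 * (Real.log (n * Δ) * m / (n * Δ))
      + 8 * (n * Δ) ^ (α - κ ^ 2 * Δ ^ 2 * Real.exp (-4 * Δ)) := by
  have hT0 : 0 < n * Δ := by linarith
  set T := n * Δ with hTdef
  set q := κ ^ 2 * Δ ^ 2 * Real.exp (-4 * Δ) with hq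
  have h1 := level_sq_le (κ := κ) hT
  have hJ0 : 0 ≤ J := by linarith
  have h4 : Real.exp (4 * Δ) = Real.exp (2 * Δ) ^ 2 := by
    rw [← Real.exp_nat_mul]; congr 1; push_cast; ring
  have hpow : 0 < T ^ (α - q) := Real.rpow_pos_of_pos hT0 _
  suffices h2 : 8 * (Real.exp (4 * Δ) / T * m) ≤ 16 * κ ^ 4 * (1 / T * J) + 8 * T ^ (α - q) by
    have h3 := mul_le_mul_of_nonneg_left h1 (by positivity : 0 ≤ 4 * m)
    have h5 : 4 * m * (2 * (Real.exp (4 * Δ) / T) + 2 * κ ^ 2 * (Real.log T / T))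
        = 8 * (Real.exp (4 * Δ) / T * m) + 8 * κ ^ 2 * (Real.log T * m / T) := by ring
    linarith
  -- If `q ≥ 1/2`, then `Δ² ≤ e^{2Δ}` yields `e^{2Δ} ≤ 2κ²`, a constant. If `q ≤ 1/2`, then
  -- `e^{4Δ}/T ≤ w²/T ≤ T^{-1/2} ≤ T^{-q}`, so the residual rate absorbs the term.
  rcases le_total (1 / 2) q with hq2 | hq2
  · have h5 : Real.exp (2 * Δ) ≤ 2 * κ ^ 2 := by
      have h6 : Δ ^ 2 ≤ Real.exp (2 * Δ) := by
        have : Real.exp (2 * Δ) = Real.exp Δ ^ 2 := by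
          rw [← Real.exp_nat_mul]; push_cast; rfl
        rw [this]
        exact pow_le_pow_left₀ hΔ.le (by linarith [Real.add_one_le_exp Δ]) 2
      have h7 : q * Real.exp (2 * Δ) ^ 2 = κ ^ 2 * Δ ^ 2 := by
        rw [hq, ← h4, mul_assoc, ← Real.exp_add]; ring_nf; simp
      have h8 : q * Real.exp (2 * Δ) ^ 2 ≤ κ ^ 2 * Real.exp (2 * Δ) := by rw [h7]; gcongr
      have h9 : 1 / 2 * Real.exp (2 * Δ) ^ 2 ≤ κ ^ 2 * Real.exp (2 * Δ) :=
        le_trans (by gcongr) h8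
      have h10 := Real.exp_pos (2 * Δ)
      have : 1 / 2 * Real.exp (2 * Δ) ≤ κ ^ 2 := by
        refine le_of_mul_le_mul_right ?_ h10
        linarith
      linarith
    have h6 : Real.exp (4 * Δ) ≤ 4 * κ ^ 4 := by
      rw [h4]
      calc Real.exp (2 * Δ) ^ 2 ≤ (2 * κ ^ 2) ^ 2 := by gcongr
        _ = 4 * κ ^ 4 := by ring
    have h7 : 8 * (Real.exp (4 * Δ) / T * m) ≤ 16 * κ ^ 4 * (1 / T * J) := by
      calc 8 * (Real.exp (4 * Δ) / T * m) ≤ 8 * (4 * κ ^ 4 / T * (J / 2)) := by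
            gcongr
            linarith
        _ = 16 * κ ^ 4 * (1 / T * J) := by ring
    linarith
  · have h5 : Real.exp (4 * Δ) / T * m ≤ T ^ (α - q) := by
      have h6 : Real.exp (4 * Δ) / T ≤ T ^ (-q) := by
        refine le_trans ?_ (Real.rpow_le_rpow_of_exponent_le hT (by linarith : -(1 / 2) ≤ -q))
        have h7 : T ^ (-(1 / 2) : ℝ) = 1 / w ^ 8 := by
          rw [Real.rpow_neg hT0.le, ← Real.sqrt_eq_rpow, hTw, one_div]
          congr 1
          rw [show w ^ 16 = (w ^ 8) ^ 2 by ring, Real.sqrt_sq (by positivity)]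
        rw [h7, hTw, h4, div_le_div_iff₀ (by positivity) (by positivity)]
        calc Real.exp (2 * Δ) ^ 2 * w ^ 8 ≤ w ^ 2 * w ^ 8 := by gcongr
          _ = w ^ 10 := by ring
          _ ≤ w ^ 16 := pow_le_pow_right₀ hw (by norm_num)
          _ = 1 * w ^ 16 := (one_mul _).symm
      calc Real.exp (4 * Δ) / T * m ≤ T ^ (-q) * T ^ α := by gcongr
        _ = T ^ (α - q) := by rw [← Real.rpow_add hT0]; ring_nf
    have : 0 ≤ 16 * κ ^ 4 * (1 / T * J) := by positivity
    linarith

theorem ofReal_mul_add_ofReal {x y z : ℝ} (t : ℝ≥0∞) (hx : 0 ≤ x) (hy : 0 ≤ y) (hz : 0 ≤ z) :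
    ENNReal.ofReal x * t + ENNReal.ofReal (x * y + z)
      = ENNReal.ofReal x * (t + ENNReal.ofReal y) + ENNReal.ofReal z := by
  rw [ENNReal.ofReal_add (by positivity) hz, ENNReal.ofReal_mul hx, mul_add, add_assoc]

set_option maxHeartbeats 1000000 in
/-- The oracle inequality in the Fourier domain. -/
theorem exists_lintegral_risk_le_oracle {c κ : ℝ} (hc0 : 0 < c) (hκ : 0 < κ) :
    ∃ C₁ : ℝ, 0 < C₁ ∧ ∀ (Ω : Type*) [MeasurableSpace Ω] (P : Measure Ω) [IsProbabilityMeasure P]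
      (n : ℕ) (Y : Fin n → Ω → ℝ) (φ : ℝ → ℂ) (Δ α m : ℝ), (∀ j, Measurable (Y j)) → iIndepFun Y P →
      (∀ j, charFun (P.map (Y j)) = fun u => Complex.exp (Δ * (φ u - 1))) →
      (∀ j, ∫⁻ ω, ‖Y j ω‖ₑ ∂P ≤ ENNReal.ofReal (Real.exp Δ * c)) →
      ContDiff ℝ 1 φ → φ 0 = 1 → (∀ u, ‖φ u‖ ≤ 1) → (∀ u, φ (-u) = starRingEnd ℂ (φ u)) →
      (∀ u, ‖φ u - 1‖ ≤ |u| * c) → 0 < α → α ≤ 1 → 0 < Δ → Δ ≤ 1 / 4 * Real.log (n * Δ) →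
      0 ≤ m → m ≤ (n * Δ) ^ α →
      ∫⁻ ω, (∫⁻ u : ℝ, ENNReal.ofReal (fourierError Δ κ α (fun j => Y j ω) φ u ^ 2)) ∂P
        ≤ ENNReal.ofReal C₁ * (tailEnergy φ m + ENNReal.ofReal (Real.log (n * Δ) * m / (n * Δ)
            + 1 / (n * Δ) * (∫ u in (-m)..m, 1 / ‖Complex.exp (Δ * (φ u - 1))‖ ^ 2)
            + m ^ 2 / (n * Δ) ^ 2))
          + ENNReal.ofReal (400 * (1 / (n * Δ)
            + (n * Δ) ^ (α - κ ^ 2 * Δ ^ 2 * Real.exp (-4 * Δ)))) := by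
  obtain ⟨w₀, hw₀1, hw₀⟩ := exists_dominating κ c
  -- `80002` for the tail energy plus `10` for the variance, the `κ` terms from `mul_level_sq_le`,
  -- and the last summand for bounded `T`.
  refine ⟨80012 + 16 * κ ^ 4 + 8 * κ ^ 2 + 800 * c * (w₀ ^ 16) ^ 2, by positivity, ?_⟩
  intro Ω _ P _ n Y φ Δ α m hY hind hχ hc hφ hφ0 hφ1 hφn hφc hα0 hα1 hΔ hΔT hm0 hma
  have hT1 : 1 < n * Δ := by
    have h1 : 0 < Real.log (n * Δ) := by linarith
    by_contra! h
    have h2 : 0 ≤ n * Δ := by positivity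
    linarith [Real.log_nonpos h2 h]
  have hT0 : 0 < n * Δ := by linarith
  have hn : 0 < n := by
    rcases Nat.eq_zero_or_pos n with h | h
    · simp [h] at hT0
    · exact h
  have hn' : (0 : ℝ) < n := by exact_mod_cast hn
  have hlog : 0 < Real.log (n * Δ) := Real.log_pos hT1
  have haT : (n * Δ) ^ α ≤ n * Δ := by
    simpa using Real.rpow_le_rpow_of_exponent_le hT1.le hα1
  have ha0 : 0 ≤ (n * Δ) ^ α := by positivity
  have hJ := two_mul_le_integral_inv_sq hφ.continuous hφ1 hΔ.le hm0
  set J := ∫ u in (-m)..m, 1 / ‖Complex.exp (Δ * (φ u - 1))‖ ^ 2 with hJdef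
  have hJ0 : 0 ≤ J := by linarith
  have hA0 : 0 ≤ Real.log (n * Δ) * m / (n * Δ) := by positivity
  have hB0 : 0 ≤ 1 / (n * Δ) * J := by positivity
  have hD0 : 0 ≤ m ^ 2 / (n * Δ) ^ 2 := by positivity
  set K := Real.log (n * Δ) * m / (n * Δ) + 1 / (n * Δ) * J + m ^ 2 / (n * Δ) ^ 2 with hK
  have hK0 : 0 ≤ K := by positivity
  set q := κ ^ 2 * Δ ^ 2 * Real.exp (-4 * Δ) with hq
  have hpow : 0 < (n * Δ) ^ (α - q) := Real.rpow_pos_of_pos hT0 _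
  have hpow_eq : (n * Δ) ^ (α - q) = (n * Δ) ^ α * (n * Δ) ^ (-q) := by
    rw [← Real.rpow_add hT0, sub_eq_add_neg]
  have htriv : ∫⁻ ω, (∫⁻ u : ℝ, ENNReal.ofReal (fourierError Δ κ α (fun j => Y j ω) φ u ^ 2)) ∂P
      ≤ ENNReal.ofReal (50 * (n * Δ) ^ α) + tailEnergy φ m := by
    refine (lintegral_mono fun ω => lintegral_fourierError_sq_le (fun j => Y j ω)
      hφ.continuous.measurable hφ1 hΔ.le κ α hma).trans ?_
    rw [lintegral_const, measure_univ, mul_one]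
  -- If `q log T < 1`, then `T^{-q} ≥ 1/3` and the residual `T^{α-q}` already pays for the trivial
  -- bound.
  rcases lt_or_ge (q * Real.log (n * Δ)) 1 with hqT | hqT
  · refine htriv.trans ?_
    rw [add_comm]
    refine add_le_add ?_ (ENNReal.ofReal_le_ofReal ?_)
    · refine le_self_add.trans (le_mul_of_one_le_left zero_le ?_)
      rw [ENNReal.one_le_ofReal]
      have : 0 ≤ 16 * κ ^ 4 + 8 * κ ^ 2 + 800 * c * (w₀ ^ 16) ^ 2 := by positivity
      linarith
    · have h1 : 1 / 3 ≤ (n * Δ) ^ (-q) := by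
        rw [Real.rpow_def_of_pos hT0]
        calc (1 : ℝ) / 3 ≤ (Real.exp 1)⁻¹ := by
              rw [one_div]
              exact inv_anti₀ (Real.exp_pos _) Real.exp_one_lt_three.le
          _ = Real.exp (-1) := (Real.exp_neg 1).symm
          _ ≤ _ := Real.exp_le_exp.2 (by linarith)
      have h2 : (n * Δ) ^ α * (1 / 3) ≤ (n * Δ) ^ (α - q) := by rw [hpow_eq]; gcongr
      have h3 : 0 ≤ 1 / (n * Δ) := by positivity
      linarith
  rcases lt_or_ge (n * Δ) (w₀ ^ 16) with hTw₀ | hTw₀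
  · refine htriv.trans (le_add_right ?_)
    have h1 : 1 ≤ w₀ ^ 16 := one_le_pow₀ hw₀1
    have h2 := ofReal_const_le_oracle hc0 hφc hT0 hTw₀.le h1 hJ
      (by linarith : 1 / (n * Δ) * J ≤ K)
    have h3 : ENNReal.ofReal (50 * (n * Δ) ^ α) ≤ ENNReal.ofReal (50 * w₀ ^ 16) :=
      ENNReal.ofReal_le_ofReal (by linarith)
    calc ENNReal.ofReal (50 * (n * Δ) ^ α) + tailEnergy φ m
        ≤ ENNReal.ofReal (800 * c * (w₀ ^ 16) ^ 2) * (tailEnergy φ m + ENNReal.ofReal K)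
          + ENNReal.ofReal (80012 + 16 * κ ^ 4 + 8 * κ ^ 2)
            * (tailEnergy φ m + ENNReal.ofReal K) := by
          refine add_le_add (h3.trans h2) (le_self_add.trans (le_mul_of_one_le_left zero_le ?_))
          rw [ENNReal.one_le_ofReal]
          have : 0 ≤ 16 * κ ^ 4 + 8 * κ ^ 2 := by positivity
          linarith
      _ = _ := by
          rw [← add_mul, ← ENNReal.ofReal_add (by positivity) (by positivity), add_comm]
  obtain ⟨w, hTw, hw0⟩ : ∃ w : ℝ, n * Δ = w ^ 16 ∧ 0 ≤ w := by
    refine ⟨(n * Δ) ^ (1 / 16 : ℝ), ?_, by positivity⟩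
    rw [← Real.rpow_natCast, ← Real.rpow_mul hT0.le]
    norm_num
  have hww₀ : w₀ ≤ w := by
    rw [hTw] at hTw₀
    exact le_of_pow_le_pow_left₀ (by norm_num) hw0 hTw₀
  obtain ⟨hw100, hcw, hlogw, hexpw⟩ := hw₀ w hww₀
  rw [← hTw] at hlogw
  have hw1 : 1 ≤ w := by linarith
  have h4 : Real.exp (4 * Δ) = Real.exp (2 * Δ) ^ 2 := by
    rw [← Real.exp_nat_mul]; congr 1; push_cast; ring
  -- The bound `q log T ≥ 1` confines `Δ`: with `κ² log T ≤ w` it gives `e^{4Δ} ≤ Δ²w`, hence both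
  -- `e^{2Δ} ≤ w` and `1 ≤ Δ²w`.
  have hqexp : Real.exp (2 * Δ) ^ 2 ≤ Δ ^ 2 * w := by
    calc Real.exp (2 * Δ) ^ 2 ≤ q * Real.log (n * Δ) * Real.exp (2 * Δ) ^ 2 :=
          le_mul_of_one_le_left (by positivity) hqT
      _ = Δ ^ 2 * (κ ^ 2 * Real.log (n * Δ)) * (Real.exp (-4 * Δ) * Real.exp (4 * Δ)) := by
          rw [hq, h4]; ring
      _ = Δ ^ 2 * (κ ^ 2 * Real.log (n * Δ)) := by
          rw [← Real.exp_add]; ring_nf; simp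
      _ ≤ Δ ^ 2 * w := by gcongr
  have hexp2 : Real.exp (2 * Δ) = Real.exp Δ ^ 2 := by
    rw [← Real.exp_nat_mul]; push_cast; rfl
  have hΔexp : Δ ≤ Real.exp Δ := by linarith [Real.add_one_le_exp Δ]
  have hexp : Real.exp (2 * Δ) ≤ w := by
    have h5 : Real.exp (2 * Δ) ^ 2 ≤ Real.exp (2 * Δ) * w := by
      refine hqexp.trans ?_
      rw [hexp2]
      gcongr
    refine le_of_mul_le_mul_left ?_ (Real.exp_pos (2 * Δ))
    linarith
  have hΔw : 1 ≤ Δ ^ 2 * w :=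
    (one_le_pow₀ (Real.one_le_exp (by linarith))).trans hqexp
  obtain ⟨E, hEm, hEP, hE⟩ := exists_measurableSet_isClose hn hY hind hΔ hφ1 hχ hc0.le hc hTw hw100
    hcw hexp hΔw hexpw ha0 haT
  have hℓ := level_pos (n := n) (Δ := Δ) hκ.le hT0
  have hℓ2 := exp_div_le_level_sq hκ.le hT0
  have hTℓ : 1 ≤ n * Δ * level n Δ κ ^ 2 := by
    have h5 := (div_le_iff₀ hT0).1 hℓ2
    have h6 : 1 ≤ Real.exp (4 * Δ) := Real.one_le_exp (by linarith)
    linarith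
  have hΔℓ : Δ * level n Δ κ ≤ 1 := by
    have h5 : κ * √(Real.log (n * Δ)) ≤ w := by
      refine le_of_sq_le_sq ?_ hw0
      rw [mul_pow, Real.sq_sqrt hlog.le]
      nlinarith
    have h6 : √(n * Δ) = w ^ 8 := by
      rw [hTw, show w ^ 16 = (w ^ 8) ^ 2 by ring, Real.sqrt_sq (by positivity)]
    have h7 : Δ ≤ w := by
      refine hΔexp.trans (le_trans ?_ hexp)
      exact Real.exp_le_exp.2 (by linarith)
    rw [level, h6, ← mul_div_assoc, div_le_one (by positivity)]
    calc Δ * (Real.exp (2 * Δ) + κ * √(Real.log (n * Δ))) ≤ w * (w + w) := by gcongr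
      _ = 2 * w ^ 2 := by ring
      _ ≤ w * w ^ 2 := by gcongr; linarith
      _ = w ^ 3 := by ring
      _ ≤ w ^ 8 := pow_le_pow_right₀ hw1 (by norm_num)
  -- With `U = a + aT` the length condition reads `a ≤ aTℓ²`, which is `hTℓ`.
  have hrisk := lintegral_risk_le hn hY hind hΔ hφ hφ0 hφ1 hφn hχ (κ := κ) (α := α) hℓ hΔℓ hℓ2 hm0
    hma (by nlinarith) (by nlinarith) (exp_deviation_le hκ.le hΔ hT1.le) hEm hE
  refine hrisk.trans ?_
  have hlev := mul_level_sq_le (κ := κ) (α := α) hΔ hT1.le hTw hw1 hexp hm0 hma hJ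
  rw [← hq] at hlev ⊢
  rw [← hJdef]
  have hPE : 50 * (n * Δ) ^ α * P.real E ≤ 100 * (1 / (n * Δ)) := by
    calc 50 * (n * Δ) ^ α * P.real E ≤ 50 * (n * Δ) * (2 / (n * Δ) ^ 2) := by gcongr
      _ = 100 * (1 / (n * Δ)) := by field_simp; norm_num
  have hrest : 4 * m * level n Δ κ ^ 2 + 10 / (n * Δ) * J + 208 * (n * Δ) ^ α * (n * Δ) ^ (-q)
      + 50 * (n * Δ) ^ α * P.real E
      ≤ (80012 + 16 * κ ^ 4 + 8 * κ ^ 2 + 800 * c * (w₀ ^ 16) ^ 2) * K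
        + 400 * (1 / (n * Δ) + (n * Δ) ^ (α - q)) := by
    have h5 : 10 / (n * Δ) * J = 10 * (1 / (n * Δ) * J) := by ring
    have h6 : 208 * (n * Δ) ^ α * (n * Δ) ^ (-q) = 208 * (n * Δ) ^ (α - q) := by
      rw [hpow_eq]; ring
    have h7 : 16 * κ ^ 4 * (1 / (n * Δ) * J) ≤ 16 * κ ^ 4 * K := by gcongr; linarith
    have h8 : 8 * κ ^ 2 * (Real.log (n * Δ) * m / (n * Δ)) ≤ 8 * κ ^ 2 * K := by gcongr; linarith
    have h9 : 0 ≤ 800 * c * (w₀ ^ 16) ^ 2 * K := by positivity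
    have h10 : 0 ≤ 1 / (n * Δ) := by positivity
    linarith
  calc _ ≤ ENNReal.ofReal (80012 + 16 * κ ^ 4 + 8 * κ ^ 2 + 800 * c * (w₀ ^ 16) ^ 2)
          * tailEnergy φ m
        + ENNReal.ofReal ((80012 + 16 * κ ^ 4 + 8 * κ ^ 2 + 800 * c * (w₀ ^ 16) ^ 2) * K
        + 400 * (1 / (n * Δ) + (n * Δ) ^ (α - q))) := by
        refine add_le_add (mul_le_mul_left ?_ _) (ENNReal.ofReal_le_ofReal hrest)
        rw [← ENNReal.ofReal_ofNat]
        refine ENNReal.ofReal_le_ofReal ?_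
        have : 0 ≤ 16 * κ ^ 4 + 8 * κ ^ 2 + 800 * c * (w₀ ^ 16) ^ 2 := by positivity
        linarith
    _ = _ := ofReal_mul_add_ofReal _ (by positivity) hK0 (by positivity)

/-! ### Back from characteristic functions to densities -/

/-- The bias of the spectral cutoff is the energy of the tail of the characteristic function. -/
theorem eLpNorm_spectralCutoff_sub_sq_eq_tailEnergy {φ : ℝ → ℂ} (hφ : Measurable φ)
    (hφ1 : ∀ u, ‖φ u‖ ≤ 1) {m : ℝ} (hm : 0 ≤ m) {f : ℝ → ℂ} (hf : Integrable f)
    (hf2 : MemLp f 2 volume) (hφf : ∀ u : ℝ, ∫ x : ℝ, Complex.exp (u * x * Complex.I) * f x = φ u) :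
    eLpNorm (fun x => spectralCutoff φ m x - f x) 2 volume ^ 2
      = ENNReal.ofReal (1 / (2 * Real.pi)) * tailEnergy φ m := by
  rw [eLpNorm_spectralCutoff_sub_sq hφ hφ1 hm hf hf2, tailEnergy,
    ← lintegral_indicator (measurableSet_abs_gt m)]
  congr 1
  refine lintegral_congr_ae ?_
  filter_upwards [Measure.ae_ne volume (-m)] with u hu
  rw [hφf]
  by_cases h : |u| ≤ m
  · have h1 : u ∉ {u : ℝ | m < |u|} := fun h' => absurd h (not_le.2 h')
    have h2 := abs_le.1 h
    rw [indicator_of_notMem h1, indicator_of_mem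
      (show u ∈ Ioc (-m) m from ⟨lt_of_le_of_ne h2.1 (Ne.symm hu), h2.2⟩)]
    simp
  · have h1 : u ∈ {u : ℝ | m < |u|} := not_le.1 h
    have h2 : u ∉ Ioc (-m) m := fun h' => h (abs_le.2 ⟨h'.1.le, h'.2⟩)
    rw [indicator_of_mem h1, indicator_of_notMem h2, zero_sub, enorm_neg]

/-- The squared error of the adaptive estimator in the Fourier domain. -/
theorem eLpNorm_adaptiveEstimator_sub_sq {n : ℕ} (y : Fin n → ℝ) {Δ : ℝ} (hΔ : 0 ≤ Δ) (κ α : ℝ)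
    {φ : ℝ → ℂ} {f : ℝ → ℂ} (hf : Integrable f) (hf2 : MemLp f 2 volume)
    (hφf : ∀ u : ℝ, ∫ x : ℝ, Complex.exp (u * x * Complex.I) * f x = φ u) :
    eLpNorm (fun x => adaptiveEstimator Δ κ α y x - f x) 2 volume ^ 2
      = ENNReal.ofReal (1 / (2 * Real.pi))
        * ∫⁻ u : ℝ, ENNReal.ofReal (fourierError Δ κ α y φ u ^ 2) := by
  unfold adaptiveEstimator
  rw [eLpNorm_spectralCutoff_sub_sq (measurable_phiBar y Δ κ) (norm_phiBar_le y Δ κ)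
    (mHat_nonneg y hΔ κ α) hf hf2]
  congr 1
  refine lintegral_congr fun u => ?_
  rw [hφf, fourierError, ENNReal.ofReal_pow (norm_nonneg _), ofReal_norm]

section Density

variable {f : ℝ → ℝ}

theorem integrable_of_isProbabilityMeasure_withDensity (hf : Measurable f) (hf0 : ∀ x, 0 ≤ f x)
    [IsProbabilityMeasure (volume.withDensity fun x => ENNReal.ofReal (f x))] :
    Integrable f := by
  refine ⟨hf.aestronglyMeasurable, ?_⟩
  have h := measure_univ (μ := volume.withDensity fun x => ENNReal.ofReal (f x))
  rw [withDensity_apply _ MeasurableSet.univ, setLIntegral_univ] at h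
  rw [hasFiniteIntegral_iff_ofReal (ae_of_all _ hf0), h]
  exact ENNReal.one_lt_top

theorem integral_exp_mul_density (hf : Measurable f) (hf0 : ∀ x, 0 ≤ f x) (u : ℝ) :
    ∫ x : ℝ, Complex.exp (u * x * Complex.I) * (f x : ℂ)
      = charFun (volume.withDensity fun x => ENNReal.ofReal (f x)) u := by
  rw [charFun_apply_real, integral_withDensity_eq_integral_toReal_smul hf.ennreal_ofReal
    (ae_of_all _ fun x => ENNReal.ofReal_lt_top)]
  refine integral_congr_ae (ae_of_all _ fun x => ?_)
  simp only [ENNReal.toReal_ofReal (hf0 x), Complex.real_smul]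
  ring

end Density

section Moments

variable [IsProbabilityMeasure P] {X : Ω → ℝ}

theorem integrable_sq_of_integrable_pow_four (hX : Measurable X)
    (h4 : Integrable (fun ω => X ω ^ 4) P) : Integrable (fun ω => X ω ^ 2) P := by
  refine ((integrable_const (1 : ℝ)).add h4).mono' (hX.pow_const 2).aestronglyMeasurable
    (ae_of_all _ fun ω => ?_)
  rw [Real.norm_of_nonneg (sq_nonneg _)]
  change X ω ^ 2 ≤ 1 + X ω ^ 4
  nlinarith [sq_nonneg (X ω ^ 2 - 1)]

theorem lintegral_enorm_le_one_add_sq (h2 : Integrable (fun ω => X ω ^ 2) P) :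
    ∫⁻ ω, ‖X ω‖ₑ ∂P ≤ ENNReal.ofReal (1 + ∫ ω, X ω ^ 2 ∂P) := by
  have h : 1 + ∫ ω, X ω ^ 2 ∂P = ∫ ω, (1 + X ω ^ 2) ∂P := by
    rw [integral_add (integrable_const _) h2]
    simp
  have hi : Integrable (fun ω => 1 + X ω ^ 2) P := (integrable_const _).add h2
  rw [h, ofReal_integral_eq_lintegral_ofReal hi
    (ae_of_all _ fun ω => by positivity)]
  refine lintegral_mono fun ω => ?_
  rw [← ofReal_norm, Real.norm_eq_abs]
  refine ENNReal.ofReal_le_ofReal ?_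
  nlinarith [sq_nonneg (|X ω| - 1), sq_abs (X ω), abs_nonneg (X ω)]

end Moments

end Decompounding

end

theorem theorem3 (M₂ M₄ : ℝ) :
    ∃ C₂ : ℝ, 0 < C₂ ∧ ∀ κ : ℝ, 0 < κ → ∃ C₁ : ℝ, 0 < C₁ ∧
      ∀ (Ω : Type*) [MeasurableSpace Ω] (P : Measure Ω) [IsProbabilityMeasure P]
        (f : ℝ → ℝ) (X : ℕ → Ω → ℝ) (N : ℝ≥0 → Ω → ℕ) (α : ℝ) (n : ℕ) (Δ : ℝ≥0),
        Measurable f → (∀ x, 0 ≤ f x) →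
        (∀ j, Measurable (X j)) →
        (∀ j, HasLaw (X j) (volume.withDensity fun x => ENNReal.ofReal (f x)) P) →
        iIndepFun X P →
        Decompounding.IsPoissonProcess N 1 P →
        IndepFun (fun ω t => N t ω) (fun ω j => X j ω) P →
        Integrable (fun ω => X 0 ω ^ 4) P →
        ∫ ω, X 0 ω ^ 2 ∂P = M₂ →
        ∫ ω, X 0 ω ^ 4 ∂P = M₄ →
        0 < α → α ≤ 1 →
        0 < Δ → (Δ : ℝ) ≤ 1 / 4 * Real.log (n * Δ) →
        ∫⁻ ω, eLpNorm (fun x =>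
            Decompounding.adaptiveEstimator Δ κ α
              (Decompounding.increments (Decompounding.compound N X) Δ n ω) x - (f x : ℂ))
            2 volume ^ 2 ∂P
          ≤ ENNReal.ofReal C₁ *
              (⨅ m ∈ Icc (0 : ℝ) ((n * Δ : ℝ) ^ α),
                (eLpNorm (fun x =>
                    Decompounding.spectralCutoff (charFun (P.map (X 0))) m x - (f x : ℂ))
                    2 volume ^ 2
                  + ENNReal.ofReal
                    (Real.log (n * Δ) * m / (n * Δ)
                      + 1 / (n * Δ) * (∫ u in (-m)..m,
                          1 / ‖charFun (P.map (Decompounding.compound N X Δ)) u‖ ^ 2)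
                      + m ^ 2 / (n * Δ : ℝ) ^ 2)))
            + ENNReal.ofReal
                (C₂ * (1 / (n * Δ)
                  + (n * Δ : ℝ) ^ (α - κ ^ 2 * (Δ : ℝ) ^ 2 * Real.exp (-4 * Δ)))) := by
  refine ⟨400, by norm_num, fun κ hκ => ?_⟩
  -- This will bound `E|X|`; the absolute value keeps the constant positive for every real `M₂`.
  have hc0 : 0 < 1 + |M₂| := by positivity
  obtain ⟨C₁, hC₁, horacle⟩ := Decompounding.exists_lintegral_risk_le_oracle hc0 hκ
  refine ⟨C₁, hC₁, ?_⟩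
  intro Ω _ P _ f X N α n Δ hf hf0 hX hlaw hind hN hNX h4 hM₂ _ hα0 hα1 hΔ hΔT
  have hΔ' : (0 : ℝ) < Δ := by exact_mod_cast hΔ
  have hmap (j : ℕ) : P.map (X j) = volume.withDensity fun x => ENNReal.ofReal (f x) :=
    (hlaw j).map_eq
  have hprob : IsProbabilityMeasure (volume.withDensity fun x => ENNReal.ofReal (f x)) := by
    rw [← hmap 0]
    exact Measure.isProbabilityMeasure_map (hX 0).aemeasurable
  have hprob0 : IsProbabilityMeasure (P.map (X 0)) := by rwa [hmap 0]
  set φ := charFun (P.map (X 0)) with hφdef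
  have hφX (j : ℕ) : charFun (P.map (X j)) = φ := by rw [hφdef, hmap j, hmap 0]
  have hφ1 (u : ℝ) : ‖φ u‖ ≤ 1 := norm_charFun_le_one u
  have hφ0 : φ 0 = 1 := by simp [hφdef]
  have h2 := Decompounding.integrable_sq_of_integrable_pow_four (hX 0) h4
  have hmean : ∫⁻ ω, ‖X 0 ω‖ₑ ∂P ≤ ENNReal.ofReal (1 + |M₂|) := by
    refine (Decompounding.lintegral_enorm_le_one_add_sq h2).trans (ENNReal.ofReal_le_ofReal ?_)
    rw [hM₂]
    linarith [le_abs_self M₂]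
  have hmeanj (j : ℕ) : ∫⁻ ω, ‖X j ω‖ₑ ∂P = ∫⁻ ω, ‖X 0 ω‖ₑ ∂P := by
    rw [← lintegral_map measurable_enorm (hX j), ← lintegral_map measurable_enorm (hX 0),
      hmap j, hmap 0]
  have hφ : ContDiff ℝ 1 φ := by
    have hL : MemLp (id : ℝ → ℝ) (1 : ℕ) (P.map (X 0)) := by
      rw [Nat.cast_one, memLp_one_iff_integrable]
      refine ⟨measurable_id.aestronglyMeasurable, ?_⟩
      rw [hasFiniteIntegral_iff_enorm, lintegral_map measurable_id.enorm (hX 0)]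
      exact hmean.trans_lt ENNReal.ofReal_lt_top
    exact_mod_cast contDiff_charFun hL
  have hφc (u : ℝ) : ‖φ u - 1‖ ≤ |u| * (1 + |M₂|) := by
    have := Decompounding.norm_charFun_sub_le (hX 0) hc0.le hmean u 0
    rwa [← hφdef, hφ0, sub_zero] at this
  have hfi : Integrable f := Decompounding.integrable_of_isProbabilityMeasure_withDensity hf hf0
  have hfc : Integrable (fun x => (f x : ℂ)) := hfi.ofReal
  have hφf (u : ℝ) : ∫ x : ℝ, Complex.exp (u * x * Complex.I) * (f x : ℂ) = φ u := by
    rw [Decompounding.integral_exp_mul_density hf hf0 u, hφdef, hmap 0]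
  have hcomp : charFun (P.map (Decompounding.compound N X Δ))
      = fun u => Complex.exp ((Δ : ℝ) * (φ u - 1)) :=
    funext fun u => Decompounding.charFun_compound hX hind hφX hN hNX Δ u
  by_cases hf2 : MemLp (fun x => (f x : ℂ)) 2 volume
  · have hrisk (m : ℝ) (hm : m ∈ Icc (0 : ℝ) ((n * Δ : ℝ) ^ α)) :=
      horacle Ω P n (fun j ω => Decompounding.increments (Decompounding.compound N X) Δ n ω j) φ Δ α
        m (Decompounding.measurable_increments hN.measurable hX Δ n)
        (Decompounding.iIndepFun_increments hX hind hφX hN hNX Δ n)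
        (fun j => funext fun u => Decompounding.charFun_increments hX hind hφX hN hNX Δ n j u)
        (fun j => by
          refine (Decompounding.lintegral_increments_le hX hN hNX hmeanj Δ n j).trans ?_
          rw [ENNReal.ofReal_mul (Real.exp_nonneg _)]
          gcongr)
        hφ hφ0 hφ1 (fun u => charFun_neg u) hφc hα0 hα1 hΔ' hΔT hm.1 hm.2
    have hπ : ENNReal.ofReal (1 / (2 * Real.pi)) ≤ 1 := by
      rw [ENNReal.ofReal_le_one, div_le_one (by positivity)]
      linarith [Real.pi_gt_three]
    have hloss (ω : Ω) := Decompounding.eLpNorm_adaptiveEstimator_sub_sq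
      (f := fun x => (f x : ℂ)) (Decompounding.increments (Decompounding.compound N X) Δ n ω)
      hΔ'.le κ α hfc hf2 hφf
    rw [lintegral_congr hloss, hcomp]
    -- As `C₁` is nonzero and finite, the infimum can be pulled outside, and each `m` is treated
    -- separately.
    rw [lintegral_const_mul' _ _ ENNReal.ofReal_ne_top, ENNReal.mul_iInf_of_ne
      (by simpa using hC₁) ENNReal.ofReal_ne_top, ENNReal.iInf_add]
    refine le_iInf fun m => ?_
    rw [ENNReal.mul_iInf_of_ne (by simpa using hC₁) ENNReal.ofReal_ne_top, ENNReal.iInf_add]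
    refine le_iInf fun hm => ?_
    rw [Decompounding.eLpNorm_spectralCutoff_sub_sq_eq_tailEnergy hφ.continuous.measurable hφ1 hm.1
      hfc hf2 hφf]
    -- The factor `1/(2π)` matches on the bias terms and is dropped, being at most `1`, on the
    -- others.
    refine (mul_le_mul_right (hrisk m hm) _).trans ?_
    rw [mul_add, mul_left_comm, mul_add (ENNReal.ofReal (1 / _))]
    gcongr
    · exact mul_le_of_le_one_left zero_le hπ
    · exact mul_le_of_le_one_left zero_le hπ
  -- Each `f_m` lies in `L²`, so if `f` does not, every bias is infinite and the bound is trivial.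
  · have htop : (⨅ m ∈ Icc (0 : ℝ) ((n * Δ : ℝ) ^ α),
        (eLpNorm (fun x => Decompounding.spectralCutoff φ m x - (f x : ℂ)) 2 volume ^ 2
          + ENNReal.ofReal (Real.log (n * Δ) * m / (n * Δ)
            + 1 / (n * Δ) * (∫ u in (-m)..m,
                1 / ‖charFun (P.map (Decompounding.compound N X Δ)) u‖ ^ 2)
            + m ^ 2 / (n * Δ : ℝ) ^ 2))) = ⊤ := by
      refine iInf₂_eq_top.2 fun m hm => ?_
      have hcut := Decompounding.memLp_spectralCutoff hφ.continuous.measurable hφ1 hm.1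
      have h : eLpNorm (fun x => Decompounding.spectralCutoff φ m x - (f x : ℂ)) 2 volume = ⊤ := by
        by_contra hne
        have hfm : AEStronglyMeasurable (fun x => (f x : ℂ)) volume :=
          (Complex.measurable_ofReal.comp hf).aestronglyMeasurable
        have h' : MemLp (fun x => Decompounding.spectralCutoff φ m x - (f x : ℂ)) 2 volume :=
          ⟨hcut.1.sub hfm, lt_top_iff_ne_top.2 hne⟩
        refine hf2 ((hcut.sub h').ae_eq (ae_of_all _ fun x => ?_))
        simp
      rw [h]
      simp
    rw [htop, ENNReal.mul_top (by simpa using hC₁), top_add]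
    exact le_top
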